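/- Let $a<b$. For $d\ge 1$ and $k\ge 0$ let $C^k([a,b]^d;\mathbb R^{n})$ be the space of functions that are $C^k$ up to the boundary, with norm $\|g\|_{C^k}=\max_{|\beta|\le k}\sup_{x\in[a,b]^d}\|D^\beta g(x)\|_2$. For $m>1$ the $m$-point Clenshaw--Curtis rule on $[a,b]$ with respect to a probability measure $\nu_i$ on $[a,b]$ has nodes $\xi_j=\frac{a+b}2+\frac{b-a}2\cos\frac{(j-1)\pi}{m-1}$, $j=1,\dots,m$ (for $m=1$ the single node is $\frac{a+b}{2}$), and the weights $w_j$ for which $\sum_j w_jP(\xi_j)=\int P\,d\nu_i$ for all polynomials $P$ of degree less than $m$. With the closed nonlinear growth $m_1=1$, $m_l=2^{l-1}+1$ for $l>1$, and given probability measures $\nu_1,\dots,\nu_d$ on $[a,b]$, let $I^d_{\mathbf k}$, $\mathbf k\in\{1,2,\dots\}^d$, be the tensor product over $i=1,\dots,d$ of the $m_{k_i}$-point rules with respect to $\nu_i$. For $\ell\ge 0$ let $$\mathcal S^d_{\ell+d}(g)=\sum_{\ell+1\le|\mathbf k|\le \ell+d}(-1)^{\ell+d-|\mathbf k|}\binom{d-1}{\ell+d-|\mathbf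 k|}I^d_{\mathbf k}(g),\qquad |\mathbf k|=k_1+\dots+k_d,$$ be the Smolyak sparse grid rule of level $\ell$, and let $m(\ell+d,d)$ be the number of distinct points at which it evaluates $g$. **(i)** Let $d\ge1$, $k\ge 0$, $1<p\le\infty$ and $M\ge 0$. There is a constant $c>0$, depending only on $d,k,a,b,p,M$, such that the following holds. Let $\nu$ be a probability measure on $[a,b]^d$ with density $f_\nu(x)=\prod_{i=1}^d f_{\nu_i}(x_i)$, where each $f_{\nu_i}\ge0$ is the density of a probability measure $\nu_i$ on $[a,b]$ and $f_{\nu_i}\in L^p([a,b])$ with $\|f_{\nu_i}\|_{L^p}\le M$. Let $\varphi\in C^k([a,b]^d;\mathbb R)$, $\Phi\in C^k([a,b]^d;\mathbb R^d)$ with $\Phi([a,b]^d)\subset[a,b]^d$, and $\ell\ge1$. Then, with $m=m(\ell+d,d)$ and $\mathcal S^d_{\ell+d}$ formed with respect to $\nu_1,\dots,\nu_d$, $$\left|\int_{[a,b]^d}\varphi(\Phi(x))\,d\nu(x)-\mathcal S^d_{\ell+d}(\varphi\circ\Phi)\right|\le c\,m^{-k/d}(\log m)^{(d-1)(k/d+1)}\,\|\varphi\|_{C^k}\,\bigl(1+\|\Phi\|_{C^k}\bigr)^k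 .$$ **(ii)** For every fixed $\ell\ge 0$, $m(\ell+d,d)\sim\frac{2^\ell}{\ell!}d^\ell$ as $d\to\infty$. -/

import Mathlib

open MeasureTheory
open scoped ENNReal NNReal

noncomputable section

namespace SparseGrid

/-! ## Cubes and `C^k` norms -/

/-- The cube `[a,b]^d` as a subset of Euclidean space `ℝ^d`. -/
def cube (d : ℕ) (a b : ℝ) : Set (EuclideanSpace ℝ (Fin d)) :=
  {x | ∀ i, x i ∈ Set.Icc a b}

/-- The iterated partial derivative `∂_{i₁} ⋯ ∂_{iₙ} g (x)` on the closed cube `[a,b]^d`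
(one-sided at the boundary, i.e. the continuous extension of the interior derivative when `g` is
`C^n` on the closed cube).  When `g` is `C^n`, these are, as `(i₁, …, iₙ)` varies, exactly the
derivatives `D^β g (x)` with `|β| = n`. -/
def partialDeriv {d : ℕ} {F : Type*} [NormedAddCommGroup F] [NormedSpace ℝ F] (a b : ℝ) {n : ℕ}
    (i : Fin n → Fin d) (g : EuclideanSpace ℝ (Fin d) → F) (x : EuclideanSpace ℝ (Fin d)) : F :=
  iteratedFDerivWithin ℝ n g (cube d a b) x (fun j => EuclideanSpace.single (i j) 1)

/-- `‖g‖_{C^k([a,b]^d)} = max_{|β| ≤ k} sup_{x ∈ [a,b]^d} ‖D^β g (x)‖`.  For a vector-valued `g` the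
inner norm is the norm of the codomain, i.e. the Euclidean norm if `F = EuclideanSpace ℝ (Fin d)`. -/
def ckNorm {d : ℕ} {F : Type*} [NormedAddCommGroup F] [NormedSpace ℝ F] (a b : ℝ) (k : ℕ)
    (g : EuclideanSpace ℝ (Fin d) → F) : ℝ :=
  sSup {r : ℝ | ∃ n : ℕ, n ≤ k ∧ ∃ i : Fin n → Fin d, ∃ x ∈ cube d a b,
    r = ‖partialDeriv a b i g x‖}

/-! ## Measures with (product) densities -/

/-- The measure on `[a,b]` with Lebesgue density `g`. -/
def intervalDensityMeasure (a b : ℝ) (g : ℝ → ℝ) : Measure ℝ :=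
  (volume.restrict (Set.Icc a b)).withDensity fun x => ENNReal.ofReal (g x)

/-- The measure on `[a,b]^d` with Lebesgue density `x ↦ ∏ i, f i (x i)`. -/
def cubeDensityMeasure {d : ℕ} (a b : ℝ) (f : Fin d → ℝ → ℝ) :
    Measure (EuclideanSpace ℝ (Fin d)) :=
  (volume.restrict (cube d a b)).withDensity fun x => ENNReal.ofReal (∏ i, f i (x i))

/-! ## Univariate Clenshaw–Curtis rules -/

/-- The `j`-th (`0 ≤ j < m`) of the `m` Clenshaw–Curtis nodes on `[-1,1]`:
`cos (jπ/(m-1))`, and the midpoint `0` if `m = 1`. -/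
def ccNodeStd (m j : ℕ) : ℝ :=
  if m = 1 then 0 else Real.cos (j * Real.pi / ((m : ℝ) - 1))

/-- The `j`-th of the `m` Clenshaw–Curtis nodes, mapped affinely to `[a,b]`. -/
def ccNode (a b : ℝ) (m j : ℕ) : ℝ :=
  (a + b) / 2 + (b - a) / 2 * ccNodeStd m j

/-- The `j`-th weight of the `m`-point Clenshaw–Curtis rule on `[a,b]` with respect to `μ`: the
`μ`-integral of the `j`-th Lagrange basis polynomial.  By `ccWeight_unique` these are the weights
which make the rule exact for all polynomials of degree less than `m`. -/
def ccWeight (μ : Measure ℝ) (a b : ℝ) (m : ℕ) (j : Fin m) : ℝ :=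
  ∫ x, (Lagrange.basis Finset.univ (fun i : Fin m => ccNode a b m i) j).eval x ∂μ

/-- The closed non-linear growth rule `m₁ = 1`, `mₗ = 2^(l-1) + 1` for `l > 1`. -/
def growth (l : ℕ) : ℕ := if l = 1 then 1 else 2 ^ (l - 1) + 1

/-! ## Smolyak's construction, for `q = ℓ + d` -/

/-- The grid point `(ξ_{j₁,k₁}, …, ξ_{j_d,k_d})`. -/
def gridPoint {d : ℕ} (a b : ℝ) (k : Fin d → ℕ) (j : (i : Fin d) → Fin (growth (k i))) :
    EuclideanSpace ℝ (Fin d) :=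
  WithLp.toLp 2 fun i => ccNode a b (growth (k i)) (j i)

/-- The tensorized rule `I_k^d (g)` with respect to the measures `μ₁, …, μ_d`. -/
def tensorRule {d : ℕ} (μ : Fin d → Measure ℝ) (a b : ℝ) (k : Fin d → ℕ)
    (g : EuclideanSpace ℝ (Fin d) → ℝ) : ℝ :=
  ∑ j : (i : Fin d) → Fin (growth (k i)),
    (∏ i, ccWeight (μ i) a b (growth (k i)) (j i)) * g (gridPoint a b k j)

/-- The multi-indices `k` with positive entries and `q - d + 1 ≤ |k| ≤ q`, where `q = ℓ + d`. -/
def smolyakIndices (d l : ℕ) : Finset (Fin d → ℕ) :=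
  (Fintype.piFinset fun _ : Fin d => Finset.Icc 1 (l + d)).filter
    fun k => l + 1 ≤ ∑ i, k i ∧ ∑ i, k i ≤ l + d

/-- The sparse grid operator `S_{ℓ+d}^d` with respect to the measures `μ₁, …, μ_d`. -/
def sparseRule {d : ℕ} (μ : Fin d → Measure ℝ) (a b : ℝ) (l : ℕ)
    (g : EuclideanSpace ℝ (Fin d) → ℝ) : ℝ :=
  ∑ k ∈ smolyakIndices d l,
    (-1 : ℝ) ^ (l + d - ∑ i, k i) * ((d - 1).choose (l + d - ∑ i, k i) : ℝ) *
      tensorRule μ a b k g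

/-- The sparse grid: the set of all points at which `S_{ℓ+d}^d` evaluates its argument. -/
def sparseGrid (d : ℕ) (a b : ℝ) (l : ℕ) : Set (EuclideanSpace ℝ (Fin d)) :=
  {x | ∃ k ∈ smolyakIndices d l, ∃ j : (i : Fin d) → Fin (growth (k i)), x = gridPoint a b k j}

/-- The number `m(ℓ+d, d)` of function evaluations used by `S_{ℓ+d}^d`. -/
def numNodes (d : ℕ) (a b : ℝ) (l : ℕ) : ℕ := (sparseGrid d a b l).ncard

/-! ## The weights are the ones determined by polynomial exactness -/

theorem ccNodeStd_injective (m : ℕ) : Function.Injective fun j : Fin m => ccNodeStd m j := by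
  intro i j hij
  by_cases hm : m = 1
  · subst hm; exact Subsingleton.elim _ _
  simp only [ccNodeStd, hm, if_false] at hij
  have hi := i.2
  have hm2 : 2 ≤ m := by omega
  have hpos : (0 : ℝ) < (m : ℝ) - 1 := by
    have : (2 : ℝ) ≤ m := by exact_mod_cast hm2
    linarith
  have key : ∀ t : Fin m, (t : ℝ) * Real.pi / ((m : ℝ) - 1) ∈ Set.Icc 0 Real.pi := by
    intro t
    have ht : (t : ℝ) ≤ (m : ℝ) - 1 := by
      have : ((t : ℕ) : ℝ) + 1 ≤ m := by exact_mod_cast t.2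
      linarith
    refine ⟨by have := Real.pi_pos; positivity, ?_⟩
    rw [div_le_iff₀ hpos, mul_comm]
    exact mul_le_mul_of_nonneg_left ht Real.pi_pos.le
  have h := Real.injOn_cos (key i) (key j) hij
  rw [div_left_inj' hpos.ne', mul_left_inj' Real.pi_pos.ne'] at h
  exact Fin.ext (by exact_mod_cast h)

theorem ccNode_injective {a b : ℝ} (hab : a < b) (m : ℕ) :
    Function.Injective fun j : Fin m => ccNode a b m j := by
  intro i j hij
  apply ccNodeStd_injective m
  simp only [ccNode, add_right_inj] at hij
  exact mul_left_cancel₀ (by linarith : (b - a) / 2 ≠ 0) hij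

/-- Weights `w` make the rule with the Clenshaw–Curtis nodes exact for all polynomials of degree
less than `m` if and only if they are the weights `ccWeight`. -/
theorem ccWeight_unique {a b : ℝ} (hab : a < b) (m : ℕ) (μ : Measure ℝ)
    (hμ : ∀ P : Polynomial ℝ, Integrable (fun x => P.eval x) μ) (w : Fin m → ℝ) :
    (∀ P : Polynomial ℝ, P.degree < m → ∑ j, w j * P.eval (ccNode a b m j) = ∫ x, P.eval x ∂μ) ↔
      w = ccWeight μ a b m := by
  have hinj : Set.InjOn (fun j : Fin m => ccNode a b m j) (Finset.univ : Finset (Fin m)) :=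
    (ccNode_injective hab m).injOn
  constructor
  · intro h
    funext j
    have hdeg : (Lagrange.basis Finset.univ (fun i : Fin m => ccNode a b m i) j).degree < m := by
      rw [Lagrange.degree_basis hinj (Finset.mem_univ j)]
      have := j.2
      simp only [Finset.card_univ, Fintype.card_fin]
      exact_mod_cast (by omega : m - 1 < m)
    rw [ccWeight, ← h _ hdeg, Finset.sum_eq_single j]
    · have := Lagrange.eval_basis_self hinj (Finset.mem_univ j)
      rw [this, mul_one]
    · intro i _ hi
      have := Lagrange.eval_basis_of_ne (v := fun i : Fin m => ccNode a b m i) (Ne.symm hi)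
        (Finset.mem_univ i)
      rw [this, mul_zero]
    · simp
  · rintro rfl P hP
    have hP' : P = Lagrange.interpolate Finset.univ (fun i : Fin m => ccNode a b m i)
        (fun i => P.eval (ccNode a b m i)) :=
      Lagrange.eq_interpolate hinj (by simpa using hP)
    have hev : ∀ x, P.eval x = ∑ j : Fin m, P.eval (ccNode a b m j) *
        (Lagrange.basis Finset.univ (fun i : Fin m => ccNode a b m i) j).eval x := by
      intro x
      conv_lhs => rw [hP']
      simp [Lagrange.interpolate_apply, Polynomial.eval_finsetSum]
    rw [integral_congr_ae (Filter.Eventually.of_forall hev),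
      integral_finsetSum _ fun j _ => (hμ _).const_mul _]
    refine Finset.sum_congr rfl fun j _ => ?_
    rw [integral_const_mul, mul_comm]
    rfl

/-- Polynomials are integrable with respect to the measures of the theorem. -/
theorem integrable_eval_intervalDensityMeasure (a b : ℝ) (g : ℝ → ℝ)
    [IsFiniteMeasure (intervalDensityMeasure a b g)] (P : Polynomial ℝ) :
    Integrable (fun x => P.eval x) (intervalDensityMeasure a b g) := by
  obtain ⟨C, hC⟩ := isCompact_Icc.exists_bound_of_continuousOn
    (P.continuous.continuousOn (s := Set.Icc a b))
  refine Integrable.of_bound P.continuous.aestronglyMeasurable C ?_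
  refine (withDensity_absolutelyContinuous _ _).ae_le ?_
  filter_upwards [ae_restrict_mem measurableSet_Icc] with x hx using hC x hx

end SparseGrid

end

/-! The error bound uses isotropic smoothness only, which is why the exponent is `k/d`. Put `g = φ ∘
Φ`. The Smolyak rule reproduces the integral of a product of univariate polynomials once every
factor is integrated exactly from level `l/d + 1` on (`sparseRule_prod_polynomial`). This allows
degree about `2^(l/d)` in each coordinate. The error is therefore at most `1 + ‖S‖` times the
distance of `g` to such tensor polynomials (`abs_integral_sub_sparseRule_le`), where `‖S‖` is the
sum of the absolute weights.

Distance: after the substitution `x_i = (a+b)/2 + (b-a)/2 cos θ_i`, `g` becomes even, periodic and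
`C^k` in each angle, and the chain rule bounds its pure derivatives by a multiple of `‖φ‖ (1 +
‖Φ‖)^k` (`exists_norm_iteratedFDeriv_comp_le`). A univariate sampling operator of norm at most 2
that reproduces trigonometric polynomials of degree `n` turns Jackson's theorem into a linear
approximation scheme (`exists_polynomial_sampling`). Applied to one variable at a time, it gives the
error `n^(-k)` with `n` of order `2^(l/d)` (`exists_tensor_approx`).

Stability: the weights may be negative, so their absolute sum must be bounded uniformly in the
number of nodes (`exists_sum_abs_ccWeight_le`). By exactness this sum is the integral of the
polynomial interpolating the signs of the weights. Such an interpolant is the even part of a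
modulated Fejér interpolant: the real part of the latter's analytic completion is bounded by 1, and
the conjugate function is exponentially integrable (`exists_interpolant`). All `L^q` norms with `q <
∞` are thus bounded uniformly, and Hölder's inequality against an `L^p` density finishes the
argument. Summing over the tensor rules costs a factor of order `l^(d-1)`.

Counting: `2^l ≤ m ≤ A l^(d-1) 2^l` trades the level for the number of nodes (`rate_le`), which
produces the logarithms.

For fixed level and large `d`, almost all grid points have exactly `l` coordinates in `{a, b}` and
the midpoint elsewhere. There are `d.choose l * 2^l` of these, and every other point moves at most
`l - 1` coordinates off the midpoint. -/

namespace SparseGrid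

/-! ## Trigonometric polynomials and equispaced nodes -/

/-- The character `θ ↦ exp (i k θ)`. -/
noncomputable def expI (k : ℤ) (θ : ℝ) : ℂ := Complex.exp (((k * θ : ℝ) : ℂ) * Complex.I)

theorem expI_add_left (j k : ℤ) (θ : ℝ) : expI (j + k) θ = expI j θ * expI k θ := by
  simp only [expI, ← Complex.exp_add]
  congr 1
  push_cast
  ring

theorem expI_add_right (k : ℤ) (θ t : ℝ) : expI k (θ + t) = expI k θ * expI k t := by
  simp only [expI, ← Complex.exp_add]
  congr 1
  push_cast
  ring

theorem expI_neg_right (k : ℤ) (θ : ℝ) : expI k (-θ) = expI (-k) θ := by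
  simp only [expI]
  congr 1
  push_cast
  ring

theorem expI_sub_right (k : ℤ) (θ t : ℝ) : expI k (θ - t) = expI k θ * expI (-k) t := by
  rw [sub_eq_add_neg, expI_add_right, expI_neg_right]

@[simp] theorem expI_zero_left (θ : ℝ) : expI 0 θ = 1 := by simp [expI]

@[simp] theorem norm_expI (k : ℤ) (θ : ℝ) : ‖expI k θ‖ = 1 := Complex.norm_exp_ofReal_mul_I _

theorem conj_expI (k : ℤ) (θ : ℝ) : (starRingEnd ℂ) (expI k θ) = expI (-k) θ := by
  simp only [expI, ← Complex.exp_conj, map_mul, Complex.conj_ofReal, Complex.conj_I]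
  congr 1
  push_cast
  ring

theorem expI_re (k : ℤ) (θ : ℝ) : (expI k θ).re = Real.cos (k * θ) :=
  Complex.exp_ofReal_mul_I_re _

theorem expI_im (k : ℤ) (θ : ℝ) : (expI k θ).im = Real.sin (k * θ) :=
  Complex.exp_ofReal_mul_I_im _

theorem expI_add_two_pi (k : ℤ) (θ : ℝ) : expI k (θ + 2 * Real.pi) = expI k θ := by
  rw [expI_add_right]
  have : expI k (2 * Real.pi) = 1 := by
    rw [expI, Complex.exp_eq_one_iff]
    exact ⟨k, by push_cast; ring⟩
  rw [this, mul_one]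

theorem hasDerivAt_expI (k : ℤ) (θ : ℝ) :
    HasDerivAt (expI k) ((k : ℂ) * Complex.I * expI k θ) θ := by
  have h : HasDerivAt (fun t : ℝ => (((k * t : ℝ) : ℂ) * Complex.I)) ((k : ℂ) * Complex.I) θ := by
    have h1 : HasDerivAt (fun t : ℝ => ((t : ℝ) : ℂ)) 1 θ := Complex.ofRealCLM.hasDerivAt
    have h2 := (h1.const_mul (k : ℂ)).mul_const Complex.I
    simpa using h2
  have := h.cexp
  rw [mul_comm] at this
  exact this

theorem continuous_expI (k : ℤ) : Continuous (expI k) :=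
  continuous_iff_continuousAt.2 fun θ => (hasDerivAt_expI k θ).continuousAt

/-- The `m`-th of `M` equispaced nodes on the circle. -/
noncomputable def circleNode (M m : ℕ) : ℝ := 2 * Real.pi * m / M

theorem sum_expI_circleNode {M : ℕ} (hM : 0 < M) {k : ℤ} (hk : ¬ (M : ℤ) ∣ k) :
    ∑ m ∈ Finset.range M, expI k (circleNode M m) = 0 := by
  have hM' : (M : ℂ) ≠ 0 := by exact_mod_cast hM.ne'
  set z : ℂ := Complex.exp (2 * Real.pi * k / M * Complex.I) with hz
  have h1 : ∀ m : ℕ, expI k (circleNode M m) = z ^ m := by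
    intro m
    rw [hz, ← Complex.exp_nat_mul, expI, circleNode]
    congr 1
    push_cast
    field_simp
  have hz1 : z ≠ 1 := by
    rw [hz, Ne, Complex.exp_eq_one_iff]
    rintro ⟨n, hn⟩
    apply hk
    refine ⟨n, ?_⟩
    have hpi : (2 * Real.pi * Complex.I : ℂ) ≠ 0 := Complex.two_pi_I_ne_zero
    have : (k : ℂ) = M * n := by
      field_simp at hn
      linear_combination hn
    exact_mod_cast this
  have hzM : z ^ M = 1 := by
    rw [hz, ← Complex.exp_nat_mul, Complex.exp_eq_one_iff]
    exact ⟨k, by field_simp⟩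
  simp only [h1]
  rw [geom_sum_eq hz1, hzM, sub_self, zero_div]

theorem sum_expI_circleNode_of_abs_lt {M : ℕ} (hM : 0 < M) {k : ℤ} (hk : |k| < M) :
    ∑ m ∈ Finset.range M, expI k (circleNode M m) = if k = 0 then (M : ℂ) else 0 := by
  split_ifs with h
  · simp [h]
  · exact sum_expI_circleNode hM fun hd => h (Int.eq_zero_of_abs_lt_dvd hd hk)

/-- Discrete Parseval identity. -/
theorem sum_norm_sq_circleNode {ι : Type*} {M : ℕ} (hM : 0 < M) (s : Finset ι) (c : ι → ℂ)
    (k : ι → ℤ) (hk : Function.Injective k) (hs : ∀ i ∈ s, ∀ j ∈ s, |k i - k j| < M) (θ : ℝ) :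
    ∑ m ∈ Finset.range M, ‖∑ j ∈ s, c j * expI (k j) (θ - circleNode M m)‖ ^ 2 =
      M * ∑ j ∈ s, ‖c j‖ ^ 2 := by
  classical
  have key : ((∑ m ∈ Finset.range M, ‖∑ j ∈ s, c j * expI (k j) (θ - circleNode M m)‖ ^ 2 : ℝ) : ℂ)
      = ((M * ∑ j ∈ s, ‖c j‖ ^ 2 : ℝ) : ℂ) := by
    push_cast
    simp only [← Complex.mul_conj', map_sum, map_mul, conj_expI, Finset.sum_mul_sum]
    rw [Finset.sum_comm, Finset.mul_sum]
    refine Finset.sum_congr rfl fun i hi => ?_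
    rw [Finset.sum_comm]
    have : ∀ j ∈ s, ∑ m ∈ Finset.range M, c i * expI (k i) (θ - circleNode M m) *
        ((starRingEnd ℂ) (c j) * expI (-k j) (θ - circleNode M m)) =
        if j = i then (M : ℂ) * (c i * (starRingEnd ℂ) (c i)) else 0 := by
      intro j hj
      have h1 : ∀ m, c i * expI (k i) (θ - circleNode M m) *
        ((starRingEnd ℂ) (c j) * expI (-k j) (θ - circleNode M m)) =
        c i * (starRingEnd ℂ) (c j) * expI (k i - k j) θ *
          expI (k j - k i) (circleNode M m) := by
        intro m
        rw [show k i - k j = k i + (-k j) by ring, show k j - k i = (-k i) + (- -k j) by ring,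
          expI_add_left, expI_add_left, expI_sub_right, expI_sub_right]
        ring
      simp only [h1, ← Finset.mul_sum]
      rw [sum_expI_circleNode_of_abs_lt hM (hs j hj i hi)]
      by_cases h : j = i
      · subst h; simp; ring
      · simp [h, sub_eq_zero, hk.eq_iff]
    rw [Finset.sum_congr rfl this, Finset.sum_ite_eq' s i]
    simp [hi]
  exact_mod_cast key

/-- Trigonometric polynomials of degree at most `n`. -/
noncomputable def trigPoly (n : ℕ) : Submodule ℂ (ℝ → ℂ) :=
  Submodule.span ℂ (expI '' (Set.Icc (-(n : ℤ)) n))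

theorem expI_mem_trigPoly {n : ℕ} {k : ℤ} (hk : |k| ≤ n) : expI k ∈ trigPoly n :=
  Submodule.subset_span ⟨k, abs_le.1 hk, rfl⟩

theorem expI_sub_mem_trigPoly {n : ℕ} {k : ℤ} (hk : |k| ≤ n) (t : ℝ) :
    (fun θ => expI k (θ - t)) ∈ trigPoly n := by
  have : (fun θ => expI k (θ - t)) = expI (-k) t • expI k := by
    funext θ
    simp [expI_sub_right, mul_comm]
  rw [this]
  exact Submodule.smul_mem _ _ (expI_mem_trigPoly hk)

theorem trigPoly_add_two_pi {n : ℕ} {T : ℝ → ℂ} (hT : T ∈ trigPoly n) (θ : ℝ) :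
    T (θ + 2 * Real.pi) = T θ := by
  induction hT using Submodule.span_induction with
  | mem x hx => obtain ⟨k, -, rfl⟩ := hx; exact expI_add_two_pi k θ
  | zero => rfl
  | add x y _ _ hx hy => simp [hx, hy]
  | smul c x _ hx => simp [hx]

/-- Every character except the constant one has a primitive of the same frequency, so the constant
term is the only obstruction. Used to integrate an approximation of a derivative. -/
theorem exists_antideriv_trigPoly {n : ℕ} {T : ℝ → ℂ} (hT : T ∈ trigPoly n) :
    ∃ c : ℂ, ∃ S ∈ trigPoly n, ∀ θ, HasDerivAt S (T θ - c) θ := by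
  induction hT using Submodule.span_induction with
  | mem x hx =>
    obtain ⟨k, hk, rfl⟩ := hx
    by_cases h0 : k = 0
    · subst h0
      exact ⟨1, 0, Submodule.zero_mem _, fun θ => by simp⟩
    · refine ⟨0, ((k : ℂ) * Complex.I)⁻¹ • expI k,
        Submodule.smul_mem _ _ (Submodule.subset_span ⟨k, hk, rfl⟩), fun θ => ?_⟩
      refine ((hasDerivAt_expI k θ).const_smul ((k : ℂ) * Complex.I)⁻¹).congr_deriv ?_
      have hk' : (k : ℂ) ≠ 0 := by exact_mod_cast h0
      have := Complex.I_ne_zero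
      rw [smul_eq_mul]
      field_simp
      ring
  | zero => exact ⟨0, 0, Submodule.zero_mem _, fun θ => by simp⟩
  | add x y _ _ hx hy =>
    obtain ⟨c, S, hS, h⟩ := hx
    obtain ⟨c', S', hS', h'⟩ := hy
    refine ⟨c + c', S + S', Submodule.add_mem _ hS hS', fun θ => ?_⟩
    refine ((h θ).add (h' θ)).congr_deriv ?_
    simp only [Pi.add_apply]
    ring
  | smul a x _ hx =>
    obtain ⟨c, S, hS, h⟩ := hx
    refine ⟨a * c, a • S, Submodule.smul_mem _ _ hS, fun θ => ?_⟩
    refine ((h θ).const_smul a).congr_deriv ?_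
    simp only [Pi.smul_apply, smul_eq_mul]
    ring

/-- The even part of a trigonometric polynomial is a polynomial in `cos θ`. -/
theorem exists_polynomial_of_mem_trigPoly {n : ℕ} {T : ℝ → ℂ} (hT : T ∈ trigPoly n) :
    ∃ P Q : Polynomial ℝ, P.natDegree ≤ n ∧ Q.natDegree ≤ n ∧
      ∀ θ : ℝ, (T θ + T (-θ)) / 2 = P.eval (Real.cos θ) + Q.eval (Real.cos θ) * Complex.I := by
  induction hT using Submodule.span_induction with
  | mem x hx =>
    obtain ⟨k, hk, rfl⟩ := hx
    refine ⟨Polynomial.Chebyshev.T ℝ k, 0, ?_, by simp, fun θ => ?_⟩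
    · rw [Polynomial.Chebyshev.natDegree_T]
      have := hk.1
      have := hk.2
      omega
    · rw [Polynomial.Chebyshev.T_real_cos, expI_neg_right, ← conj_expI, Complex.add_conj, expI_re]
      push_cast
      simp
  | zero => exact ⟨0, 0, by simp, by simp, by simp⟩
  | add x y _ _ hx hy =>
    obtain ⟨P, Q, hP, hQ, h⟩ := hx
    obtain ⟨P', Q', hP', hQ', h'⟩ := hy
    refine ⟨P + P', Q + Q', Polynomial.natDegree_add_le_of_degree_le hP hP',
      Polynomial.natDegree_add_le_of_degree_le hQ hQ', fun θ => ?_⟩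
    simp only [Pi.add_apply, Polynomial.eval_add, Complex.ofReal_add]
    linear_combination h θ + h' θ
  | smul c x _ hx =>
    obtain ⟨P, Q, hP, hQ, h⟩ := hx
    refine ⟨c.re • P - c.im • Q, c.im • P + c.re • Q, ?_, ?_, fun θ => ?_⟩
    · exact (Polynomial.natDegree_sub_le_of_le
        ((Polynomial.natDegree_smul_le _ _).trans hP) ((Polynomial.natDegree_smul_le _ _).trans hQ)).trans
          (by simp)
    · exact Polynomial.natDegree_add_le_of_degree_le
        ((Polynomial.natDegree_smul_le _ _).trans hP) ((Polynomial.natDegree_smul_le _ _).trans hQ)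
    · simp only [Pi.smul_apply, smul_eq_mul, Polynomial.eval_add, Polynomial.eval_sub,
        Polynomial.eval_smul, Complex.ofReal_add, Complex.ofReal_sub, Complex.ofReal_mul]
      have hc : c = c.re + c.im * Complex.I := (Complex.re_add_im c).symm
      have hI := Complex.I_sq
      rw [← mul_add, mul_div_assoc, h θ]
      conv_lhs => rw [hc]
      linear_combination (c.im * ((Q.eval (Real.cos θ) : ℝ) : ℂ)) * hI

/-! ## Jackson's theorem -/

/-- An arc of length at most `π` is at most `π/2` times its chord. This converts distances on the
circle into the factor `expI 1 φ - 1`, to which Parseval applies. -/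
theorem exists_int_sub_mul_two_pi (φ : ℝ) :
    ∃ z : ℤ, (φ - z * (2 * Real.pi)) ^ 2 ≤ Real.pi ^ 2 / 4 * ‖expI 1 φ - 1‖ ^ 2 := by
  refine ⟨round (φ / (2 * Real.pi)), ?_⟩
  set z := round (φ / (2 * Real.pi))
  have hpi := Real.pi_pos
  have h1 : |φ - z * (2 * Real.pi)| ≤ Real.pi := by
    have h := abs_sub_round (φ / (2 * Real.pi))
    have : φ - z * (2 * Real.pi) = (φ / (2 * Real.pi) - z) * (2 * Real.pi) := by
      field_simp
    rw [this, abs_mul, abs_of_pos (by positivity : (0 : ℝ) < 2 * Real.pi)]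
    nlinarith
  have h2 := Real.cos_le_one_sub_mul_cos_sq h1
  rw [Real.cos_sub_int_mul_two_pi] at h2
  have h3 : ‖expI 1 φ - 1‖ ^ 2 = 2 - 2 * Real.cos φ := by
    rw [← Complex.normSq_eq_norm_sq, Complex.normSq_apply]
    simp only [Complex.sub_re, Complex.sub_im, expI_re, expI_im, Complex.one_re, Complex.one_im]
    have := Real.sin_sq_add_cos_sq φ
    simp only [Int.cast_one, one_mul]
    nlinarith
  rw [h3]
  set x := φ - z * (2 * Real.pi)
  have : 2 / Real.pi ^ 2 * x ^ 2 * (Real.pi ^ 2 / 2) = x ^ 2 := by field_simp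
  have h4 : 2 / Real.pi ^ 2 * x ^ 2 * (Real.pi ^ 2 / 2) ≤ (1 - Real.cos φ) * (Real.pi ^ 2 / 2) :=
    mul_le_mul_of_nonneg_right (by linarith) (by positivity)
  nlinarith

/-- Coefficients of the square root of the Jackson kernel. -/
noncomputable def parabola (n j : ℕ) : ℝ := j * ((n : ℝ) + 2 - j)

/-- The square root of the Jackson kernel. -/
noncomputable def jacksonRoot (n : ℕ) (θ : ℝ) : ℂ :=
  ∑ j ∈ Finset.range (n + 1), (parabola n (j + 1) : ℂ) * expI ((j : ℤ) + 1) θ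

/-- With `N = n + 2` the sum equals `(N^5 - N)/30` exactly. It is the mass of the Jackson kernel,
and only its order `N^5` matters. -/
theorem sum_parabola_sq (n : ℕ) :
    ((n : ℝ) + 2) ^ 5 ≤ 32 * ∑ j ∈ Finset.range (n + 1), parabola n (j + 1) ^ 2 := by
  have key : ∀ (N : ℝ) (K : ℕ), 30 * ∑ j ∈ Finset.range K, (((j + 1 : ℕ) : ℝ) * (N - (j + 1 : ℕ))) ^ 2
      = 5 * N ^ 2 * (K * (K + 1) * (2 * K + 1)) - 15 * N * (K * (K + 1)) ^ 2 +
        K * (K + 1) * (2 * K + 1) * (3 * K ^ 2 + 3 * K - 1) := by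
    intro N K
    induction K with
    | zero => simp
    | succ K ih =>
      rw [Finset.sum_range_succ, mul_add, ih]
      push_cast
      ring
  have h := key (n + 2) (n + 1)
  unfold parabola
  push_cast at h ⊢
  have hn : (0 : ℝ) ≤ n := n.cast_nonneg
  have h2 : 30 * ∑ j ∈ Finset.range (n + 1), (((j : ℝ) + 1) * ((n : ℝ) + 2 - (j + 1))) ^ 2 =
      ((n : ℝ) + 2) ^ 5 - (n + 2) := by
    rw [h]; ring
  have h3 : (16 : ℝ) ≤ ((n : ℝ) + 2) ^ 4 := by
    have : (2 : ℝ) ^ 4 ≤ ((n : ℝ) + 2) ^ 4 := pow_le_pow_left₀ (by norm_num) (by linarith) 4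
    linarith
  have h4 : 16 * ((n : ℝ) + 2) ≤ ((n : ℝ) + 2) ^ 5 := by
    rw [pow_succ]
    exact mul_le_mul_of_nonneg_right h3 (by linarith)
  linarith

/-- Summation by parts. No boundary terms appear because the parabola vanishes at both `0` and `n +
2`; this vanishing is what makes the second moment of the kernel small. -/
theorem expI_sub_one_mul_jacksonRoot (n : ℕ) (θ : ℝ) :
    (expI 1 θ - 1) * jacksonRoot n θ = ∑ j ∈ Finset.range (n + 2),
      ((parabola n j - parabola n (j + 1) : ℝ) : ℂ) * expI ((j : ℤ) + 1) θ := by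
  have h1 : jacksonRoot n θ = ∑ j ∈ Finset.range (n + 2),
      (parabola n (j + 1) : ℂ) * expI ((j : ℤ) + 1) θ := by
    rw [Finset.sum_range_succ _ (n + 1), jacksonRoot]
    have : parabola n (n + 1 + 1) = 0 := by
      simp only [parabola]
      push_cast
      ring
    rw [this]
    simp
  have h2 : expI 1 θ * jacksonRoot n θ = ∑ j ∈ Finset.range (n + 2),
      (parabola n j : ℂ) * expI ((j : ℤ) + 1) θ := by
    rw [Finset.sum_range_succ' _ (n + 1), jacksonRoot, Finset.mul_sum]
    simp only [parabola, Nat.cast_zero, zero_mul, Complex.ofReal_zero, add_zero]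
    refine Finset.sum_congr rfl fun j _ => ?_
    rw [expI_add_left (((j + 1 : ℕ) : ℤ)) 1]
    push_cast
    ring
  rw [sub_mul, one_mul, h2]
  conv_lhs => rw [h1]
  rw [← Finset.sum_sub_distrib]
  refine Finset.sum_congr rfl fun j _ => ?_
  push_cast
  ring

theorem sum_norm_sq_jacksonRoot (n : ℕ) (θ : ℝ) :
    ∑ m ∈ Finset.range (n + 3), ‖jacksonRoot n (θ - circleNode (n + 3) m)‖ ^ 2 =
      (n + 3 : ℕ) * ∑ j ∈ Finset.range (n + 1), parabola n (j + 1) ^ 2 := by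
  have := sum_norm_sq_circleNode (M := n + 3) (by omega) (Finset.range (n + 1))
    (fun j => (parabola n (j + 1) : ℂ)) (fun j => (j : ℤ) + 1)
    (fun i j h => by simpa using h) (fun i hi j hj => by
      rw [Finset.mem_range] at hi hj
      rw [abs_lt]
      push_cast
      constructor <;> omega) θ
  simp only [Complex.norm_real, Real.norm_eq_abs, sq_abs] at this
  exact this

/-- Second moment of the kernel: by Parseval, `n + 2` squared differences, each at most `(n + 2)^2`.
Against the mass of order `(n + 2)^5` this means concentration at scale `1/n`. -/
theorem sum_norm_sq_jacksonRoot_mul (n : ℕ) (θ : ℝ) :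
    ∑ m ∈ Finset.range (n + 3), ‖expI 1 (θ - circleNode (n + 3) m) - 1‖ ^ 2 *
        ‖jacksonRoot n (θ - circleNode (n + 3) m)‖ ^ 2 ≤ (n + 3 : ℕ) * ((n : ℝ) + 2) ^ 3 := by
  have := sum_norm_sq_circleNode (M := n + 3) (by omega) (Finset.range (n + 2))
    (fun j => ((parabola n j - parabola n (j + 1) : ℝ) : ℂ)) (fun j => (j : ℤ) + 1)
    (fun i j h => by simpa using h) (fun i hi j hj => by
      rw [Finset.mem_range] at hi hj
      rw [abs_lt]
      push_cast
      constructor <;> omega) θ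
  simp only [← expI_sub_one_mul_jacksonRoot, norm_mul, mul_pow, Complex.norm_real,
    Real.norm_eq_abs, sq_abs] at this
  rw [this]
  refine mul_le_mul_of_nonneg_left ?_ (by positivity)
  have h : ∀ j ∈ Finset.range (n + 2), (parabola n j - parabola n (j + 1)) ^ 2 ≤ ((n : ℝ) + 2) ^ 2 := by
    intro j hj
    rw [Finset.mem_range] at hj
    have hj' : (j : ℝ) ≤ n + 1 := by exact_mod_cast Nat.lt_succ_iff.1 hj
    have hj0 : (0 : ℝ) ≤ j := j.cast_nonneg
    unfold parabola
    push_cast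
    exact sq_le_sq' (by nlinarith) (by nlinarith)
  calc _ ≤ ∑ _j ∈ Finset.range (n + 2), ((n : ℝ) + 2) ^ 2 := Finset.sum_le_sum h
    _ = _ := by
      rw [Finset.sum_const, Finset.card_range, nsmul_eq_mul]
      push_cast
      ring

theorem norm_sq_jacksonRoot_mem (n : ℕ) (t : ℝ) :
    (fun θ => ((‖jacksonRoot n (θ - t)‖ ^ 2 : ℝ) : ℂ)) ∈ trigPoly n := by
  have : (fun θ => ((‖jacksonRoot n (θ - t)‖ ^ 2 : ℝ) : ℂ)) =
      ∑ i ∈ Finset.range (n + 1), ∑ j ∈ Finset.range (n + 1),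
        ((parabola n (i + 1) * parabola n (j + 1) : ℝ) : ℂ) •
          fun θ => expI ((i : ℤ) - j) (θ - t) := by
    funext θ
    simp only [Finset.sum_apply, Pi.smul_apply, smul_eq_mul]
    rw [Complex.ofReal_pow, ← Complex.mul_conj', jacksonRoot, map_sum, Finset.sum_mul_sum]
    refine Finset.sum_congr rfl fun i _ => Finset.sum_congr rfl fun j _ => ?_
    rw [map_mul, conj_expI, Complex.conj_ofReal,
      show (i : ℤ) - j = (i + 1) + (-(j + 1)) by ring, expI_add_left ((i : ℤ) + 1) (-(j + 1))]
    push_cast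
    ring
  rw [this]
  refine Submodule.sum_mem _ fun i hi => Submodule.sum_mem _ fun j hj =>
    Submodule.smul_mem _ _ (expI_sub_mem_trigPoly ?_ t)
  rw [Finset.mem_range] at hi hj
  rw [abs_le]
  constructor <;> omega

/-- Jackson's theorem for Lipschitz functions. -/
theorem exists_trigPoly_near_of_lipschitz (n : ℕ) {h : ℝ → ℂ} {B : ℝ}
    (hper : Function.Periodic h (2 * Real.pi)) (hB : ∀ x y, ‖h x - h y‖ ≤ B * |x - y|) :
    ∃ T ∈ trigPoly n, ∀ θ, ‖h θ - T θ‖ ≤ 41 * B / ((n : ℝ) + 1) := by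
  have hB0 : 0 ≤ B := by
    have := (norm_nonneg _).trans (hB 1 0)
    simpa using this
  set S : ℝ := ∑ j ∈ Finset.range (n + 1), parabola n (j + 1) ^ 2 with hS
  have hS32 := sum_parabola_sq n
  rw [← hS] at hS32
  have hN : (0 : ℝ) < (n : ℝ) + 2 := by positivity
  have hS0 : 0 < S := by
    have : 0 < ((n : ℝ) + 2) ^ 5 := by positivity
    linarith
  -- The discrete Parseval identity needs more nodes than the frequency spread, which is at most `n
  -- + 1` for the kernel root times `expI 1 - 1`.
  set M : ℕ := n + 3 with hM
  have hM0 : (0 : ℝ) < M := by rw [hM]; positivity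
  set w : ℝ → ℕ → ℝ := fun θ m => ‖jacksonRoot n (θ - circleNode M m)‖ ^ 2 / (M * S) with hw
  have hw0 : ∀ θ m, 0 ≤ w θ m := fun θ m => by positivity
  have hw1 : ∀ θ, ∑ m ∈ Finset.range M, w θ m = 1 := by
    intro θ
    rw [hw]
    simp only
    rw [← Finset.sum_div, sum_norm_sq_jacksonRoot]
    exact div_self (by positivity)
  have hw2 : ∀ θ, ∑ m ∈ Finset.range M, w θ m * ‖expI 1 (θ - circleNode M m) - 1‖ ^ 2 ≤
      32 / ((n : ℝ) + 2) ^ 2 := by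
    intro θ
    have h1 := sum_norm_sq_jacksonRoot_mul n θ
    have : ∀ m, w θ m * ‖expI 1 (θ - circleNode M m) - 1‖ ^ 2 =
      ‖expI 1 (θ - circleNode M m) - 1‖ ^ 2 * ‖jacksonRoot n (θ - circleNode M m)‖ ^ 2 / (M * S) := by
      intro m
      rw [hw]
      ring
    simp only [this]
    rw [← Finset.sum_div, div_le_div_iff₀ (by positivity) (by positivity)]
    calc _ ≤ M * ((n : ℝ) + 2) ^ 3 * ((n : ℝ) + 2) ^ 2 :=
          mul_le_mul_of_nonneg_right h1 (by positivity)
      _ = M * ((n : ℝ) + 2) ^ 5 := by ring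
      _ ≤ M * (32 * S) := mul_le_mul_of_nonneg_left hS32 hM0.le
      _ = _ := by ring
  refine ⟨∑ m ∈ Finset.range M, (h (circleNode M m) / (M * S : ℝ)) •
    fun θ => ((‖jacksonRoot n (θ - circleNode M m)‖ ^ 2 : ℝ) : ℂ),
    Submodule.sum_mem _ fun m _ => Submodule.smul_mem _ _ (norm_sq_jacksonRoot_mem n _),
    fun θ => ?_⟩
  have hT : h θ - (∑ m ∈ Finset.range M, (h (circleNode M m) / (M * S : ℝ)) •
    fun θ => ((‖jacksonRoot n (θ - circleNode M m)‖ ^ 2 : ℝ) : ℂ)) θ =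
    ∑ m ∈ Finset.range M, (w θ m : ℂ) * (h θ - h (circleNode M m)) := by
    simp only [mul_sub, Finset.sum_sub_distrib, ← Finset.sum_mul, ← Complex.ofReal_sum, hw1,
      Complex.ofReal_one, one_mul, Finset.sum_apply, Pi.smul_apply, smul_eq_mul]
    congr 1
    refine Finset.sum_congr rfl fun m _ => ?_
    rw [hw]
    push_cast
    ring
  rw [hT]
  have hterm : ∀ m ∈ Finset.range M, ‖(w θ m : ℂ) * (h θ - h (circleNode M m))‖ ≤
      B * (Real.pi ^ 2 / 8 * ((n : ℝ) + 2)) * (w θ m * ‖expI 1 (θ - circleNode M m) - 1‖ ^ 2) +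
        B / (2 * ((n : ℝ) + 2)) * w θ m := by
    intro m _
    rw [norm_mul, Complex.norm_real, Real.norm_eq_abs, abs_of_nonneg (hw0 θ m)]
    obtain ⟨z, hz⟩ := exists_int_sub_mul_two_pi (θ - circleNode M m)
    set x := θ - circleNode M m - z * (2 * Real.pi)
    have h1 : ‖h θ - h (circleNode M m)‖ ≤ B * |x| := by
      have := hB (θ - z * (2 * Real.pi)) (circleNode M m)
      rw [hper.sub_int_mul_eq] at this
      convert this using 3
      ring
    -- Weighted AM–GM, balanced at `|x| = 1/(n+2)`: the first moment is controlled by the second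
    -- moment `hw2` and the total mass `hw1`.
    have h2 : |x| ≤ ((n : ℝ) + 2) / 2 * x ^ 2 + 1 / (2 * ((n : ℝ) + 2)) := by
      have h3 : 0 ≤ (((n : ℝ) + 2) * |x| - 1) ^ 2 / (2 * ((n : ℝ) + 2)) := by positivity
      have h4 : (((n : ℝ) + 2) * |x| - 1) ^ 2 / (2 * ((n : ℝ) + 2)) =
          ((n : ℝ) + 2) / 2 * |x| ^ 2 + 1 / (2 * ((n : ℝ) + 2)) - |x| := by
        field_simp
        ring
      rw [h4, sq_abs] at h3
      linarith
    have h5 : |x| ≤ ((n : ℝ) + 2) / 2 * (Real.pi ^ 2 / 4 * ‖expI 1 (θ - circleNode M m) - 1‖ ^ 2)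
        + 1 / (2 * ((n : ℝ) + 2)) :=
      h2.trans (add_le_add_left (mul_le_mul_of_nonneg_left hz (by positivity)) _)
    calc _ ≤ w θ m * (B * (((n : ℝ) + 2) / 2 *
          (Real.pi ^ 2 / 4 * ‖expI 1 (θ - circleNode M m) - 1‖ ^ 2) + 1 / (2 * ((n : ℝ) + 2)))) :=
          mul_le_mul_of_nonneg_left (h1.trans (mul_le_mul_of_nonneg_left h5 hB0)) (hw0 θ m)
      _ = _ := by
        field_simp
        ring
  calc _ ≤ ∑ m ∈ Finset.range M, (B * (Real.pi ^ 2 / 8 * ((n : ℝ) + 2)) *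
          (w θ m * ‖expI 1 (θ - circleNode M m) - 1‖ ^ 2) + B / (2 * ((n : ℝ) + 2)) * w θ m) :=
        norm_sum_le_of_le _ hterm
    _ = B * (Real.pi ^ 2 / 8 * ((n : ℝ) + 2)) * (∑ m ∈ Finset.range M,
          w θ m * ‖expI 1 (θ - circleNode M m) - 1‖ ^ 2) + B / (2 * ((n : ℝ) + 2)) := by
        rw [Finset.sum_add_distrib, ← Finset.mul_sum, ← Finset.mul_sum, hw1, mul_one]
    _ ≤ B * (Real.pi ^ 2 / 8 * ((n : ℝ) + 2)) * (32 / ((n : ℝ) + 2) ^ 2) +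
          B / (2 * ((n : ℝ) + 2)) := by
        gcongr
        exact hw2 θ
    _ = B * (4 * Real.pi ^ 2 + 1 / 2) / ((n : ℝ) + 2) := by
        field_simp
        ring
    _ ≤ B * 41 / ((n : ℝ) + 2) := by
        have h1 := Real.pi_lt_d2
        have h2 := Real.pi_pos
        have : 4 * Real.pi ^ 2 + 1 / 2 ≤ 41 := by nlinarith
        gcongr
    _ ≤ 41 * B / ((n : ℝ) + 1) := by
        rw [mul_comm B]
        gcongr
        norm_num

/-- Jackson's theorem for `C^k` functions. -/
theorem exists_trigPoly_near (k n : ℕ) {h : ℝ → ℂ} {B : ℝ} (hh : ContDiff ℝ k h)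
    (hper : Function.Periodic h (2 * Real.pi)) (hB : ∀ x, ‖iteratedDeriv k h x‖ ≤ B) :
    ∃ T ∈ trigPoly n, ∀ θ, ‖h θ - T θ‖ ≤ B * (82 / ((n : ℝ) + 1)) ^ k := by
  induction k generalizing h with
  | zero => exact ⟨0, Submodule.zero_mem _, fun θ => by simpa using hB θ⟩
  | succ k ih =>
    have hd : ContDiff ℝ k (deriv h) := by
      have := (contDiff_succ_iff_deriv (n := (k : ℕ∞)) (f := h) (𝕜 := ℝ)).1 (by exact_mod_cast hh)
      exact_mod_cast this.2.2
    have hdiff : Differentiable ℝ h := hh.differentiable (by simp)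
    have hdper : Function.Periodic (deriv h) (2 * Real.pi) := by
      intro x
      rw [← deriv_comp_add_const]
      congr 1
      funext y
      exact hper y
    obtain ⟨T', hT', hT'e⟩ := ih hd hdper fun x => by
      rw [← iteratedDeriv_succ']
      exact hB x
    obtain ⟨c, S, hS, hSd⟩ := exists_antideriv_trigPoly hT'
    set ε := B * (82 / ((n : ℝ) + 1)) ^ k
    have hlip : ∀ (f f' : ℝ → ℂ) (C : ℝ), (∀ x, HasDerivAt f (f' x) x) → (∀ x, ‖f' x‖ ≤ C) →
        ∀ x y, ‖f x - f y‖ ≤ C * |x - y| := by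
      intro f f' C hf hC x y
      have := Convex.norm_image_sub_le_of_norm_hasDerivWithin_le (s := Set.univ)
        (fun x _ => (hf x).hasDerivWithinAt) (fun x _ => hC x) convex_univ
        (Set.mem_univ y) (Set.mem_univ x)
      simpa [Real.norm_eq_abs] using this
    -- Over one period `h - S - c x` changes by exactly `-2π c`, while its derivative `h' - T'` is
    -- at most `ε`.
    have hcε : ‖c‖ ≤ ε := by
      have h1 := hlip (fun x => h x - S x - (x : ℂ) * c) (fun x => deriv h x - T' x) ε
        (fun x => by
          have h2 : HasDerivAt (fun t : ℝ => ((t : ℝ) : ℂ)) 1 x := Complex.ofRealCLM.hasDerivAt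
          refine (((hdiff x).hasDerivAt.sub (hSd x)).sub (h2.mul_const c)).congr_deriv ?_
          ring) hT'e (0 + 2 * Real.pi) 0
      have hpi := Real.pi_pos
      rw [hper 0, trigPoly_add_two_pi hS 0] at h1
      have h3 : h 0 - S 0 - ((0 + 2 * Real.pi : ℝ) : ℂ) * c - (h 0 - S 0 - ((0 : ℝ) : ℂ) * c) =
          ((-(2 * Real.pi) : ℝ) : ℂ) * c := by
        push_cast
        ring
      rw [h3, norm_mul, Complex.norm_real, Real.norm_eq_abs, abs_neg, zero_add, sub_zero,
        abs_of_pos (by positivity : (0 : ℝ) < 2 * Real.pi), mul_comm] at h1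
      exact le_of_mul_le_mul_right h1 (by positivity)
    -- Restoring the mean `c` doubles the Lipschitz constant; together with the factor 41 of the
    -- Lipschitz case this gives 82 per derivative.
    have hu := hlip (fun x => h x - S x) (fun x => deriv h x - T' x + c) (2 * ε)
      (fun x => ((hdiff x).hasDerivAt.sub (hSd x)).congr_deriv (by ring))
      (fun x => (norm_add_le _ _).trans (by linarith [hT'e x]))
    obtain ⟨T₁, hT₁, hT₁e⟩ := exists_trigPoly_near_of_lipschitz n (h := fun x => h x - S x)
      (fun x => by simp only [hper x, trigPoly_add_two_pi hS x]) hu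
    refine ⟨S + T₁, Submodule.add_mem _ hS hT₁, fun θ => ?_⟩
    have := hT₁e θ
    rw [Pi.add_apply, ← sub_sub]
    refine this.trans (le_of_eq ?_)
    simp only [ε]
    rw [pow_succ]
    ring

/-! ## A sampling operator of de la Vallée Poussin type -/

/-- The Dirichlet kernel. -/
noncomputable def dirichlet (n : ℕ) (θ : ℝ) : ℂ := ∑ j ∈ Finset.Icc (-(n : ℤ)) n, expI j θ

/-- A kernel of degree `3n` which reproduces trigonometric polynomials of degree `n`. -/
noncomputable def poussin (n : ℕ) (θ : ℝ) : ℂ :=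
  dirichlet (2 * n) θ * dirichlet n θ / (2 * n + 1 : ℕ)

theorem poussin_eq (n : ℕ) (θ : ℝ) :
    poussin n θ = ((2 * n + 1 : ℕ) : ℂ)⁻¹ * ∑ l ∈ Finset.Icc (-(n : ℤ)) n,
      ∑ j ∈ Finset.Icc (-((2 * n : ℕ) : ℤ)) (2 * n : ℕ), expI (j + l) θ := by
  rw [poussin, dirichlet, dirichlet, Finset.sum_mul_sum, Finset.sum_comm, div_eq_inv_mul]
  simp only [expI_add_left]

theorem poussin_sub_mem (n : ℕ) (t : ℝ) : (fun θ => poussin n (θ - t)) ∈ trigPoly (3 * n) := by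
  have : (fun θ => poussin n (θ - t)) = ((2 * n + 1 : ℕ) : ℂ)⁻¹ • ∑ l ∈ Finset.Icc (-(n : ℤ)) n,
      ∑ j ∈ Finset.Icc (-((2 * n : ℕ) : ℤ)) (2 * n : ℕ), fun θ => expI (j + l) (θ - t) := by
    funext θ
    simp only [poussin_eq, Pi.smul_apply, Finset.sum_apply, smul_eq_mul]
  rw [this]
  refine Submodule.smul_mem _ _ (Submodule.sum_mem _ fun l hl => Submodule.sum_mem _ fun j hj =>
    expI_sub_mem_trigPoly ?_ t)
  rw [Finset.mem_Icc] at hl hj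
  rw [abs_le]
  push_cast at hj ⊢
  constructor <;> omega

/-- The frequencies `k - l - j` have modulus at most `4n`, so there is no aliasing on `4n + 1`
nodes. For each `l` only `j = k - l` survives, and it lies in the range of the larger Dirichlet
kernel. -/
theorem sum_poussin_mul_expI (n : ℕ) {k : ℤ} (hk : |k| ≤ n) (θ : ℝ) :
    ∑ m ∈ Finset.range (4 * n + 1), expI k (circleNode (4 * n + 1) m) *
      poussin n (θ - circleNode (4 * n + 1) m) = (4 * n + 1 : ℕ) * expI k θ := by
  have hN : ((2 * n + 1 : ℕ) : ℂ) ≠ 0 := by exact_mod_cast (2 * n).succ_ne_zero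
  have hk' := abs_le.1 hk
  have h1 : ∀ m, expI k (circleNode (4 * n + 1) m) * poussin n (θ - circleNode (4 * n + 1) m) =
      ((2 * n + 1 : ℕ) : ℂ)⁻¹ * ∑ l ∈ Finset.Icc (-(n : ℤ)) n,
      ∑ j ∈ Finset.Icc (-((2 * n : ℕ) : ℤ)) (2 * n : ℕ),
        expI (j + l) θ * expI (k - l - j) (circleNode (4 * n + 1) m) := by
    intro m
    rw [poussin_eq, mul_left_comm, Finset.mul_sum]
    congr 1
    refine Finset.sum_congr rfl fun l _ => ?_
    rw [Finset.mul_sum]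
    refine Finset.sum_congr rfl fun j _ => ?_
    rw [expI_sub_right, show k - l - j = k + -(j + l) by ring, expI_add_left k]
    ring
  simp only [h1, ← Finset.mul_sum]
  rw [Finset.sum_comm]
  have h2 : ∀ l ∈ Finset.Icc (-(n : ℤ)) n, ∑ m ∈ Finset.range (4 * n + 1),
      ∑ j ∈ Finset.Icc (-((2 * n : ℕ) : ℤ)) (2 * n : ℕ),
        expI (j + l) θ * expI (k - l - j) (circleNode (4 * n + 1) m) =
      (4 * n + 1 : ℕ) * expI k θ := by
    intro l hl
    rw [Finset.mem_Icc] at hl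
    rw [Finset.sum_comm, Finset.sum_eq_single (k - l)]
    · simp
    · intro j hj hne
      rw [Finset.mem_Icc] at hj
      rw [← Finset.mul_sum, sum_expI_circleNode_of_abs_lt (by omega), if_neg, mul_zero]
      · intro h
        exact hne (by linarith)
      · rw [abs_lt]
        push_cast at hj ⊢
        constructor <;> omega
    · intro h
      exfalso
      apply h
      rw [Finset.mem_Icc]
      push_cast
      constructor <;> omega
  rw [Finset.sum_congr rfl h2, Finset.sum_const, Int.card_Icc, nsmul_eq_mul,
    show ((n : ℤ) + 1 - -n).toNat = 2 * n + 1 by omega, inv_mul_cancel_left₀ hN]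

theorem sum_poussin_mul (n : ℕ) {T : ℝ → ℂ} (hT : T ∈ trigPoly n) (θ : ℝ) :
    ∑ m ∈ Finset.range (4 * n + 1), T (circleNode (4 * n + 1) m) *
      poussin n (θ - circleNode (4 * n + 1) m) = (4 * n + 1 : ℕ) * T θ := by
  induction hT using Submodule.span_induction with
  | mem x hx => obtain ⟨k, hk, rfl⟩ := hx; exact sum_poussin_mul_expI n (abs_le.2 hk) θ
  | zero => simp
  | add x y _ _ hx hy => simp only [Pi.add_apply, add_mul, Finset.sum_add_distrib, hx, hy, mul_add]
  | smul c x _ hx =>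
    simp only [Pi.smul_apply, smul_eq_mul, mul_assoc, ← Finset.mul_sum, hx]
    ring

theorem sum_norm_sq_dirichlet (n M : ℕ) (hM : 2 * n < M) (θ : ℝ) :
    ∑ m ∈ Finset.range M, ‖dirichlet n (θ - circleNode M m)‖ ^ 2 = M * (2 * n + 1) := by
  have := sum_norm_sq_circleNode (M := M) (by omega) (Finset.Icc (-(n : ℤ)) n)
    (fun _ => 1) id Function.injective_id (fun i hi j hj => by
      rw [Finset.mem_Icc] at hi hj
      rw [abs_lt]
      simp only [id]
      constructor <;> omega) θ
  simp only [one_mul, id, norm_one, one_pow, Finset.sum_const, Int.card_Icc, nsmul_eq_mul, mul_one,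
    show ((n : ℤ) + 1 - -n).toNat = 2 * n + 1 by omega] at this
  simp only [dirichlet, this]
  push_cast
  ring

/-- The kernel is a product of two Dirichlet kernels, so AM–GM reduces its `ℓ¹` norm to two Parseval
sums of comparable size; no logarithm arises, unlike for a single Dirichlet kernel. -/
theorem sum_norm_poussin_le (n : ℕ) (θ : ℝ) :
    ∑ m ∈ Finset.range (4 * n + 1), ‖poussin n (θ - circleNode (4 * n + 1) m)‖ ≤
      2 * (4 * n + 1 : ℕ) := by
  have hN : (0 : ℝ) < (2 * n + 1 : ℕ) := by positivity
  have h : ∀ m ∈ Finset.range (4 * n + 1), ‖poussin n (θ - circleNode (4 * n + 1) m)‖ ≤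
      (‖dirichlet (2 * n) (θ - circleNode (4 * n + 1) m)‖ ^ 2 / 4 +
        ‖dirichlet n (θ - circleNode (4 * n + 1) m)‖ ^ 2) / (2 * n + 1 : ℕ) := by
    intro m _
    rw [poussin, norm_div, norm_mul, Complex.norm_natCast]
    refine div_le_div_of_nonneg_right ?_ hN.le
    nlinarith [sq_nonneg (‖dirichlet (2 * n) (θ - circleNode (4 * n + 1) m)‖ / 2 -
      ‖dirichlet n (θ - circleNode (4 * n + 1) m)‖)]
  refine (Finset.sum_le_sum h).trans ?_
  rw [← Finset.sum_div, Finset.sum_add_distrib, ← Finset.sum_div,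
    sum_norm_sq_dirichlet _ _ (by omega), sum_norm_sq_dirichlet _ _ (by omega), div_le_iff₀ hN]
  push_cast
  have hn : (0 : ℝ) ≤ n := n.cast_nonneg
  nlinarith

/-- Even periodic `C^k` functions are approximated, at the Jackson rate, by finitely many samples
times fixed polynomials in `cos θ`, with uniformly bounded Lebesgue constants. -/
theorem exists_polynomial_sampling (n : ℕ) :
    ∃ (M : ℕ) (t : Fin M → ℝ) (P : Fin M → Polynomial ℝ), (∀ m, (P m).natDegree ≤ 3 * n) ∧
      (∀ θ : ℝ, ∑ m, |(P m).eval (Real.cos θ)| ≤ 2) ∧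
      ∀ (k : ℕ) (h : ℝ → ℝ) (B : ℝ), ContDiff ℝ k h → Function.Periodic h (2 * Real.pi) →
        (∀ x, h (-x) = h x) → (∀ x, ‖iteratedFDeriv ℝ k h x‖ ≤ B) →
        ∀ θ : ℝ, |h θ - ∑ m, h (t m) * (P m).eval (Real.cos θ)| ≤
          3 * (B * (82 / ((n : ℝ) + 1)) ^ k) := by
  set M := 4 * n + 1 with hM
  have hM0 : (0 : ℝ) < M := by rw [hM]; positivity
  have hM0' : (M : ℂ) ≠ 0 := by exact_mod_cast hM0.ne'
  set W : ℕ → ℝ → ℂ := fun m θ => (M : ℂ)⁻¹ * poussin n (θ - circleNode M m) with hW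
  have hWmem : ∀ m, W m ∈ trigPoly (3 * n) := fun m =>
    Submodule.smul_mem _ ((M : ℂ)⁻¹) (poussin_sub_mem n (circleNode M m))
  choose P Q hP _ hPQ using fun m => exists_polynomial_of_mem_trigPoly (hWmem m)
  have hPre : ∀ m (θ : ℝ), (P m).eval (Real.cos θ) = ((W m θ + W m (-θ)) / 2).re := by
    intro m θ
    rw [hPQ]
    simp
  have hWsum : ∀ θ, ∑ m ∈ Finset.range M, ‖W m θ‖ ≤ 2 := by
    intro θ
    simp only [hW, norm_mul, ← Finset.mul_sum, norm_inv, Complex.norm_natCast]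
    rw [inv_mul_le_iff₀ hM0, mul_comm]
    exact sum_norm_poussin_le n θ
  refine ⟨M, fun m => circleNode M m, fun m => P m, fun m => hP m, fun θ => ?_, ?_⟩
  · rw [← Finset.sum_range fun m => |(P m).eval (Real.cos θ)|]
    have : ∀ m ∈ Finset.range M, |(P m).eval (Real.cos θ)| ≤ (‖W m θ‖ + ‖W m (-θ)‖) / 2 := by
      intro m _
      rw [hPre]
      refine (Complex.abs_re_le_norm _).trans ?_
      rw [norm_div, Complex.norm_ofNat]
      exact div_le_div_of_nonneg_right (norm_add_le _ _) (by norm_num)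
    refine (Finset.sum_le_sum this).trans ?_
    rw [← Finset.sum_div, Finset.sum_add_distrib]
    linarith [hWsum θ, hWsum (-θ)]
  · intro k h B hh hper heven hB θ
    rw [← Finset.sum_range fun m => h (circleNode M m) * (P m).eval (Real.cos θ)]
    obtain ⟨T, hT, hTe⟩ := exists_trigPoly_near k n (h := fun x => (h x : ℂ)) (B := B)
      (Complex.ofRealCLM.contDiff.comp hh) (fun x => by simp only [hper x]) (fun x => by
        rw [← norm_iteratedFDeriv_eq_norm_iteratedDeriv]
        have := Complex.ofRealLI.norm_iteratedFDeriv_comp_left (f := h) (x := x) (n := k) (i := k)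
          hh.contDiffAt le_rfl
        exact this.trans_le (hB x))
    set ε := B * (82 / ((n : ℝ) + 1)) ^ k
    -- Lebesgue's inequality: the operator reproduces `T` and has norm at most 2, hence the factor
    -- `1 + 2`.
    have hQ : ∀ θ, ‖(h θ : ℂ) - ∑ m ∈ Finset.range M, (h (circleNode M m) : ℂ) * W m θ‖ ≤ 3 * ε := by
      intro θ
      have hTr : T θ = ∑ m ∈ Finset.range M, T (circleNode M m) * W m θ := by
        have := sum_poussin_mul n hT θ
        rw [← hM] at this
        simp only [hW, mul_left_comm _ (M : ℂ)⁻¹, ← Finset.mul_sum]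
        rw [this, inv_mul_cancel_left₀ hM0']
      have : (h θ : ℂ) - ∑ m ∈ Finset.range M, (h (circleNode M m) : ℂ) * W m θ =
          ((h θ : ℂ) - T θ) - ∑ m ∈ Finset.range M,
            ((h (circleNode M m) : ℂ) - T (circleNode M m)) * W m θ := by
        simp only [sub_mul, Finset.sum_sub_distrib]
        rw [← hTr]
        ring
      rw [this]
      have hε : 0 ≤ ε := (norm_nonneg _).trans (hTe 0)
      have h2 : ‖∑ m ∈ Finset.range M,
            ((h (circleNode M m) : ℂ) - T (circleNode M m)) * W m θ‖ ≤ ε * 2 := by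
        refine (norm_sum_le_of_le (f := fun m =>
          ((h (circleNode M m) : ℂ) - T (circleNode M m)) * W m θ) _
          (n := fun m => ε * ‖W m θ‖) fun m _ => ?_).trans ?_
        · rw [norm_mul]
          exact mul_le_mul_of_nonneg_right (hTe _) (norm_nonneg _)
        · rw [← Finset.mul_sum]
          exact mul_le_mul_of_nonneg_left (hWsum θ) hε
      refine (norm_sub_le _ _).trans ?_
      linarith [hTe θ]
    -- Since `h` is real and even, averaging over `±θ` and taking real parts leaves it unchanged and
    -- turns the kernels into polynomials in `cos θ`.
    have h3 : h θ - ∑ m ∈ Finset.range M, h (circleNode M m) * (P m).eval (Real.cos θ) =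
        ((((h θ : ℂ) - ∑ m ∈ Finset.range M, (h (circleNode M m) : ℂ) * W m θ) +
          ((h (-θ) : ℂ) - ∑ m ∈ Finset.range M, (h (circleNode M m) : ℂ) * W m (-θ))) / 2).re := by
      simp only [hPre, heven]
      rw [show ((((h θ : ℂ) - ∑ m ∈ Finset.range M, (h (circleNode M m) : ℂ) * W m θ) +
          ((h θ : ℂ) - ∑ m ∈ Finset.range M, (h (circleNode M m) : ℂ) * W m (-θ))) / 2) =
          (h θ : ℂ) - ∑ m ∈ Finset.range M, (h (circleNode M m) : ℂ) * ((W m θ + W m (-θ)) / 2) by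
        have : ∀ m, (h (circleNode M m) : ℂ) * ((W m θ + W m (-θ)) / 2) =
          ((h (circleNode M m) : ℂ) * W m θ + (h (circleNode M m) : ℂ) * W m (-θ)) / 2 := by
          intro m; ring
        simp only [this, ← Finset.sum_div, Finset.sum_add_distrib]
        ring]
      simp only [Complex.sub_re, Complex.ofReal_re, Complex.re_sum, Complex.re_ofReal_mul]
    rw [h3]
    refine (Complex.abs_re_le_norm _).trans ?_
    rw [norm_div, Complex.norm_ofNat]
    have := norm_add_le ((h θ : ℂ) - ∑ m ∈ Finset.range M, (h (circleNode M m) : ℂ) * W m θ)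
      ((h (-θ) : ℂ) - ∑ m ∈ Finset.range M, (h (circleNode M m) : ℂ) * W m (-θ))
    linarith [hQ θ, hQ (-θ)]

/-! ## Tensor product approximation -/

/-- One coordinate is sampled at a time. A new coordinate adds its own error `ε`, and the sampling
operator of norm 2 doubles the error already made, so `e ↦ 2e + ε` yields `2^|S| - 1`. Because the
operator uses point samples, the coefficient functions stay samples of `G` and only pure derivatives
are needed. -/
theorem exists_partial_tensor_approx {d : ℕ} (k n : ℕ) {G : (Fin d → ℝ) → ℝ} {B : ℝ}
    (hG : ∀ i θ, ContDiff ℝ k fun t => G (Function.update θ i t))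
    (hper : ∀ i θ, Function.Periodic (fun t => G (Function.update θ i t)) (2 * Real.pi))
    (heven : ∀ i θ t, G (Function.update θ i (-t)) = G (Function.update θ i t))
    (hB : ∀ i θ x, ‖iteratedFDeriv ℝ k (fun t => G (Function.update θ i t)) x‖ ≤ B)
    (S : Finset (Fin d)) :
    ∃ (ι : Type) (_ : Fintype ι) (p : ι → Fin d → Polynomial ℝ) (u : ι → (Fin d → ℝ) → ℝ),
      (∀ r i, (p r i).natDegree ≤ 3 * n) ∧
      (∀ r θ θ', (∀ i ∉ S, θ i = θ' i) → u r θ = u r θ') ∧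
      ∀ θ, |G θ - ∑ r, u r θ * ∏ i ∈ S, (p r i).eval (Real.cos (θ i))| ≤
        (2 ^ S.card - 1) * (3 * (B * (82 / ((n : ℝ) + 1)) ^ k)) := by
  obtain ⟨M, t, P, hPdeg, hPsum, hPapp⟩ := exists_polynomial_sampling n
  set ε := 3 * (B * (82 / ((n : ℝ) + 1)) ^ k)
  induction S using Finset.induction_on with
  | empty =>
    refine ⟨Unit, inferInstance, fun _ _ => 0, fun _ => G, by simp, fun _ θ θ' h => ?_, by simp⟩
    rw [funext fun i => h i (by simp)]
  | insert i S hi ih =>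
    obtain ⟨ι, _, p, u, hp, hu, happ⟩ := ih
    refine ⟨Fin M × ι, inferInstance, fun r j => if j = i then P r.1 else p r.2 j,
      fun r θ => u r.2 (Function.update θ i (t r.1)), fun r j => ?_, fun r θ θ' h => ?_, fun θ => ?_⟩
    · dsimp only
      split_ifs
      exacts [hPdeg _, hp _ _]
    · refine hu _ _ _ fun j hj => ?_
      by_cases hji : j = i
      · subst hji; simp
      · simp [hji, h j (by simp [hji, hj])]
    · set F : (Fin d → ℝ) → ℝ := fun θ => ∑ r, u r θ * ∏ i ∈ S, (p r i).eval (Real.cos (θ i))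
      have h1 : ∑ r : Fin M × ι, u r.2 (Function.update θ i (t r.1)) * ∏ j ∈ insert i S,
          (if j = i then P r.1 else p r.2 j).eval (Real.cos (θ j)) =
          ∑ m, F (Function.update θ i (t m)) * (P m).eval (Real.cos (θ i)) := by
        rw [Fintype.sum_prod_type]
        refine Finset.sum_congr rfl fun m _ => ?_
        rw [Finset.sum_mul]
        refine Finset.sum_congr rfl fun r _ => ?_
        rw [Finset.prod_insert hi, if_pos rfl, mul_assoc]
        congr 1
        rw [mul_comm]
        congr 1
        refine Finset.prod_congr rfl fun j hj => ?_
        have hji : j ≠ i := fun h => hi (h ▸ hj)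
        rw [if_neg hji, Function.update_of_ne hji]
      rw [h1]
      have h2 := hPapp k _ B (hG i θ) (hper i θ) (heven i θ) (hB i θ) (θ i)
      rw [Function.update_eq_self] at h2
      have h3 : |∑ m, (G (Function.update θ i (t m)) - F (Function.update θ i (t m))) *
          (P m).eval (Real.cos (θ i))| ≤ ((2 ^ S.card - 1) * ε) * 2 := by
        refine (Finset.abs_sum_le_sum_abs _ _).trans ?_
        have h4 : ∀ m ∈ Finset.univ, |(G (Function.update θ i (t m)) -
            F (Function.update θ i (t m))) * (P m).eval (Real.cos (θ i))| ≤
            ((2 ^ S.card - 1) * ε) * |(P m).eval (Real.cos (θ i))| := fun m _ => by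
          rw [abs_mul]
          exact mul_le_mul_of_nonneg_right (happ _) (abs_nonneg _)
        refine (Finset.sum_le_sum h4).trans ?_
        rw [← Finset.mul_sum]
        exact mul_le_mul_of_nonneg_left (hPsum _) ((abs_nonneg _).trans (happ θ))
      have h5 : G θ - ∑ m, F (Function.update θ i (t m)) * (P m).eval (Real.cos (θ i)) =
          (G θ - ∑ m, G (Function.update θ i (t m)) * (P m).eval (Real.cos (θ i))) +
          ∑ m, (G (Function.update θ i (t m)) - F (Function.update θ i (t m))) *
          (P m).eval (Real.cos (θ i)) := by
        simp only [sub_mul, Finset.sum_sub_distrib]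
        ring
      rw [h5, Finset.card_insert_of_notMem hi, pow_succ]
      refine (abs_add_le _ _).trans ((add_le_add h2 h3).trans (le_of_eq ?_))
      ring

/-- The affine map from `[a,b]` to `[-1,1]` as a polynomial. -/
noncomputable def toStd (a b : ℝ) : Polynomial ℝ :=
  Polynomial.C ((b - a) / 2)⁻¹ * Polynomial.X +
    Polynomial.C (-((b - a) / 2)⁻¹ * ((a + b) / 2))

theorem toStd_eval {a b : ℝ} (hab : a < b) (y : ℝ) :
    (toStd a b).eval ((a + b) / 2 + (b - a) / 2 * y) = y := by
  have hh : (b - a) / 2 ≠ 0 := by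
    have : 0 < (b - a) / 2 := by linarith
    exact this.ne'
  simp only [toStd, Polynomial.eval_add, Polynomial.eval_mul, Polynomial.eval_C, Polynomial.eval_X]
  rw [mul_add, inv_mul_cancel_left₀ hh]
  ring

theorem natDegree_comp_toStd_le (a b : ℝ) (P : Polynomial ℝ) :
    (P.comp (toStd a b)).natDegree ≤ P.natDegree := by
  refine Polynomial.natDegree_comp_le.trans ?_
  have : (toStd a b).natDegree ≤ 1 := Polynomial.natDegree_linear_le
  simpa using Nat.mul_le_mul_left P.natDegree this

/-- Approximation of a function on the cube by tensor products of univariate polynomials. -/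
theorem exists_tensor_approx {a b : ℝ} (hab : a < b) {d : ℕ} (k n : ℕ)
    {g : EuclideanSpace ℝ (Fin d) → ℝ} {G : (Fin d → ℝ) → ℝ} {B : ℝ}
    (hgG : ∀ θ : Fin d → ℝ, G θ =
      g (WithLp.toLp 2 fun i => (a + b) / 2 + (b - a) / 2 * Real.cos (θ i)))
    (hG : ∀ i θ, ContDiff ℝ k fun t => G (Function.update θ i t))
    (hB : ∀ i θ x, ‖iteratedFDeriv ℝ k (fun t => G (Function.update θ i t)) x‖ ≤ B) :
    ∃ (ι : Type) (_ : Fintype ι) (p : ι → Fin d → Polynomial ℝ) (u : ι → ℝ),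
      (∀ r i, (p r i).natDegree ≤ 3 * n) ∧
      ∀ x ∈ cube d a b, |g x - ∑ r, u r * ∏ i, (p r i).eval (x i)| ≤
        (2 ^ d - 1) * (3 * (B * (82 / ((n : ℝ) + 1)) ^ k)) := by
  have hcos : ∀ i (θ : Fin d → ℝ) (s t : ℝ), Real.cos s = Real.cos t →
      G (Function.update θ i s) = G (Function.update θ i t) := by
    intro i θ s t hst
    rw [hgG, hgG]
    congr 2
    funext j
    by_cases hj : j = i
    · subst hj; simp [hst]
    · simp [hj]
  obtain ⟨ι, _, p, u, hp, hu, happ⟩ := exists_partial_tensor_approx k n hG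
    (fun i θ t => hcos i θ _ _ (Real.cos_add_two_pi t)) (fun i θ t => hcos i θ _ _ (Real.cos_neg t))
    hB Finset.univ
  have hh : 0 < (b - a) / 2 := by linarith
  refine ⟨ι, inferInstance, fun r i => (p r i).comp (toStd a b), fun r => u r 0, fun r i =>
    (natDegree_comp_toStd_le a b _).trans (hp r i), fun x hx => ?_⟩
  · set θ : Fin d → ℝ := fun i => Real.arccos (((b - a) / 2)⁻¹ * (x i - (a + b) / 2))
    have hc : ∀ i, Real.cos (θ i) = ((b - a) / 2)⁻¹ * (x i - (a + b) / 2) := by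
      intro i
      have := hx i
      rw [Set.mem_Icc] at this
      refine Real.cos_arccos ?_ ?_
      · rw [← neg_le_neg_iff, neg_neg, ← mul_neg, inv_mul_le_iff₀ hh]
        linarith
      · rw [inv_mul_le_iff₀ hh]
        linarith
    have hx' : WithLp.toLp 2 (fun i => (a + b) / 2 + (b - a) / 2 * Real.cos (θ i)) = x := by
      ext i
      simp only [hc]
      rw [mul_inv_cancel_left₀ hh.ne']
      ring
    have h1 := happ θ
    rw [hgG, hx', Finset.card_univ, Fintype.card_fin] at h1
    have h2 : ∑ r, u r 0 * ∏ i, ((p r i).comp (toStd a b)).eval (x i) =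
        ∑ r, u r θ * ∏ i, (p r i).eval (Real.cos (θ i)) := ?_
    · rw [h2]
      exact h1
    refine Finset.sum_congr rfl fun r _ => ?_
    -- Once all coordinates have been treated, `u r` depends on nothing, so its value at `0` serves
    -- as the coefficient.
    rw [hu r 0 θ (by simp)]
    congr 1
    refine Finset.prod_congr rfl fun i _ => ?_
    rw [Polynomial.eval_comp, ← congrArg (fun y : EuclideanSpace ℝ (Fin d) => y i) hx', toStd_eval hab]

/-! ## Interpolation in the Clenshaw–Curtis nodes -/

/-- The analytic completion of the (normalized) Fejér kernel. -/
noncomputable def fejerAnalytic (N : ℕ) (θ : ℝ) : ℂ :=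
  (2 * ∑ k ∈ Finset.range N, ((N : ℂ) - k) * expI k θ - N) / (N : ℂ) ^ 2

/-- The real part of the analytic completion is the Fejér kernel, the squared modulus of a geometric
sum; in particular it is nonnegative. In the induction both sides grow by the same cross term, after
reversing the order of summation. -/
theorem re_fejer_sum (N : ℕ) (θ : ℝ) :
    (2 * ∑ k ∈ Finset.range N, ((N : ℂ) - k) * expI k θ - N).re =
      ‖∑ k ∈ Finset.range N, expI k θ‖ ^ 2 := by
  induction N with
  | zero => simp
  | succ N ih =>
    have h1 : (2 * ∑ k ∈ Finset.range (N + 1), (((N + 1 : ℕ) : ℂ) - k) * expI k θ - (N + 1 : ℕ)) =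
        (2 * ∑ k ∈ Finset.range N, ((N : ℂ) - k) * expI k θ - N) +
          (2 * ∑ k ∈ Finset.range (N + 1), expI k θ - 1) := by
      rw [Finset.sum_range_succ, Finset.sum_range_succ (fun k : ℕ => expI k θ)]
      have : ∑ k ∈ Finset.range N, (((N + 1 : ℕ) : ℂ) - k) * expI k θ =
          ∑ k ∈ Finset.range N, ((N : ℂ) - k) * expI k θ + ∑ k ∈ Finset.range N, expI k θ := by
        rw [← Finset.sum_add_distrib]
        refine Finset.sum_congr rfl fun k _ => ?_
        push_cast
        ring
      rw [this]
      push_cast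
      ring
    rw [h1, Complex.add_re, ih, Finset.sum_range_succ (fun k : ℕ => expI k θ) N,
      ← Complex.normSq_eq_norm_sq, ← Complex.normSq_eq_norm_sq, Complex.normSq_add,
      Complex.normSq_eq_norm_sq (expI N θ), norm_expI]
    have h2 : (∑ k ∈ Finset.range N, expI k θ * (starRingEnd ℂ) (expI N θ)).re =
        (∑ k ∈ Finset.range N, expI ((k : ℤ) + 1) θ).re := by
      rw [← Finset.sum_range_reflect (fun k : ℕ => expI ((k : ℤ) + 1) θ), Complex.re_sum,
        Complex.re_sum]
      refine Finset.sum_congr rfl fun k hk => ?_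
      rw [Finset.mem_range] at hk
      rw [conj_expI, ← expI_add_left, expI_re, expI_re, ← Real.cos_neg]
      congr 1
      have : ((N - 1 - k : ℕ) : ℤ) = N - 1 - k := by omega
      rw [this]
      push_cast
      ring
    rw [← Finset.sum_mul] at h2
    rw [h2, ← Finset.sum_range_succ (fun k : ℕ => expI k θ), Finset.sum_range_succ']
    simp
    ring

theorem fejerAnalytic_re (N : ℕ) (θ : ℝ) :
    (fejerAnalytic N θ).re = ‖∑ k ∈ Finset.range N, expI k θ‖ ^ 2 / (N : ℝ) ^ 2 := by
  rw [← re_fejer_sum, fejerAnalytic, ← Complex.div_ofReal_re]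
  push_cast
  rfl

theorem fejerAnalytic_re_nonneg (N : ℕ) (θ : ℝ) : 0 ≤ (fejerAnalytic N θ).re := by
  rw [fejerAnalytic_re]
  positivity

theorem sum_fejerAnalytic_re {N : ℕ} (hN : 0 < N) (θ : ℝ) :
    ∑ m ∈ Finset.range N, (fejerAnalytic N (θ - circleNode N m)).re = 1 := by
  have h := sum_norm_sq_circleNode hN (Finset.range N) (fun _ => 1) (fun j : ℕ => (j : ℤ))
    Nat.cast_injective (fun i hi j hj => by
      rw [Finset.mem_range] at hi hj
      rw [abs_lt]
      constructor <;> omega) θ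
  simp only [one_mul, norm_one, one_pow, Finset.sum_const, Finset.card_range, nsmul_eq_mul,
    mul_one] at h
  simp only [fejerAnalytic_re, ← Finset.sum_div, h]
  have : (N : ℝ) ≠ 0 := by exact_mod_cast hN.ne'
  field_simp

/-- The geometric sum of length `N` vanishes at the nonzero `N`-th roots of unity angles, so the
positive kernel is also a cardinal function for the `N` nodes. -/
theorem fejerAnalytic_re_node {N : ℕ} {i j : ℕ} (hi : i < N) (hj : j < N) :
    (fejerAnalytic N (circleNode N i - circleNode N j)).re = if j = i then 1 else 0 := by
  have hN : 0 < N := by omega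
  have hN' : (N : ℝ) ≠ 0 := by exact_mod_cast hN.ne'
  have h1 : ∀ k : ℕ, expI k (circleNode N i - circleNode N j) =
      expI ((i : ℤ) - j) (circleNode N k) := by
    intro k
    simp only [expI, circleNode]
    congr 3
    push_cast
    ring
  rw [fejerAnalytic_re]
  simp only [h1]
  rw [sum_expI_circleNode_of_abs_lt hN (by rw [abs_lt]; constructor <;> omega)]
  by_cases h : j = i
  · subst h
    simp [hN']
  · have : (i : ℤ) - j ≠ 0 := by omega
    simp [h, this]

/-- The analytic completion of the Fejér interpolant of the data `δ`. -/
noncomputable def fejerInterp (N : ℕ) (δ : ℕ → ℝ) (θ : ℝ) : ℂ :=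
  ∑ j ∈ Finset.range N, (δ j : ℂ) * fejerAnalytic N (θ - circleNode N j)

theorem fejerInterp_re_node {N i : ℕ} (hi : i < N) (δ : ℕ → ℝ) :
    (fejerInterp N δ (circleNode N i)).re = δ i := by
  simp only [fejerInterp, Complex.re_sum, Complex.re_ofReal_mul]
  have : ∀ j ∈ Finset.range N,
      δ j * (fejerAnalytic N (circleNode N i - circleNode N j)).re = if j = i then δ j else 0 := by
    intro j hj
    rw [fejerAnalytic_re_node hi (Finset.mem_range.1 hj)]
    simp
  rw [Finset.sum_congr rfl this, Finset.sum_ite_eq' _ i]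
  simp [hi]

theorem abs_fejerInterp_re_le {N : ℕ} (hN : 0 < N) {δ : ℕ → ℝ} (hδ : ∀ j, |δ j| ≤ 1) (θ : ℝ) :
    |(fejerInterp N δ θ).re| ≤ 1 := by
  simp only [fejerInterp, Complex.re_sum, Complex.re_ofReal_mul]
  refine (Finset.abs_sum_le_sum_abs _ _).trans ?_
  rw [← sum_fejerAnalytic_re hN θ]
  refine Finset.sum_le_sum fun j _ => ?_
  rw [abs_mul, abs_of_nonneg (fejerAnalytic_re_nonneg _ _)]
  exact mul_le_of_le_one_left (fejerAnalytic_re_nonneg _ _) (hδ j)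

/-- Only nonnegative frequencies occur, so the interpolant is a polynomial in `exp (iθ)`. For real
data its constant coefficient is real, which the mean value argument below requires. -/
theorem exists_analytic_fejerInterp {N : ℕ} (hN : 0 < N) (δ : ℕ → ℝ) :
    ∃ (p : ℂ → ℂ) (r : ℝ), Differentiable ℂ p ∧ p 0 = r ∧
      ∀ θ : ℝ, fejerInterp N δ θ = p (circleMap 0 1 θ) := by
  refine ⟨fun z => ∑ j ∈ Finset.range N, (δ j : ℂ) *
    ((2 * ∑ k ∈ Finset.range N, ((N : ℂ) - k) * (expI (-k) (circleNode N j) * z ^ k) - N) /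
      (N : ℂ) ^ 2), ∑ j ∈ Finset.range N, δ j * ((2 * N - N) / (N : ℝ) ^ 2), ?_, ?_, fun θ => ?_⟩
  · fun_prop
  · push_cast
    refine Finset.sum_congr rfl fun j _ => ?_
    rw [Finset.sum_eq_single 0]
    · simp
    · intro k _ hk
      simp [hk]
    · simp [hN.ne']
  · simp only [fejerInterp, fejerAnalytic]
    refine Finset.sum_congr rfl fun j _ => ?_
    congr 4
    refine Finset.sum_congr rfl fun k _ => ?_
    rw [expI_sub_right]
    have : expI k θ = circleMap 0 1 θ ^ k := by
      rw [circleMap, expI, Complex.ofReal_one, one_mul, zero_add, ← Complex.exp_nat_mul]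
      congr 1
      push_cast
      ring
    rw [this]
    ring

theorem continuous_fejerInterp (N : ℕ) (δ : ℕ → ℝ) : Continuous (fejerInterp N δ) := by
  have := continuous_expI
  unfold fejerInterp fejerAnalytic
  fun_prop

theorem fejerInterp_periodic (N : ℕ) (δ : ℕ → ℝ) :
    Function.Periodic (fejerInterp N δ) (2 * Real.pi) := by
  intro θ
  simp only [fejerInterp, fejerAnalytic, add_sub_right_comm, expI_add_two_pi]

/-- The conjugate function of a function bounded by `1` is exponentially integrable. -/
theorem integral_exp_im_fejerInterp_le {N : ℕ} (hN : 0 < N) {δ : ℕ → ℝ} (hδ : ∀ j, |δ j| ≤ 1)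
    {s : ℝ} (hs : |s| = 1) :
    ∫ θ in (0 : ℝ)..2 * Real.pi, Real.exp (s * (fejerInterp N δ θ).im) ≤
      2 * Real.pi / Real.cos 1 := by
  obtain ⟨p, r, hp, hp0, hpA⟩ := exists_analytic_fejerInterp hN δ
  have hcont := continuous_fejerInterp N δ
  -- The mean of `f` over the circle is `f 0`, of modulus 1 because `p 0` is real. On the circle `Re
  -- f = exp (s Im p) cos (s Re p)`, and `|Re p| ≤ 1` keeps the cosine above `cos 1 > 0`.
  set f : ℂ → ℂ := fun z => Complex.exp (-(s : ℂ) * Complex.I * p z) with hf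
  have hfd : Differentiable ℂ f := by
    rw [hf]
    fun_prop
  have havg : Real.circleAverage f 0 1 = f 0 := (hfd.diffContOnCl).circleAverage
  have hint : ∫ θ in (0 : ℝ)..2 * Real.pi, f (circleMap 0 1 θ) = (2 * Real.pi : ℝ) * f 0 := by
    rw [← havg, Real.circleAverage, Complex.real_smul, ← mul_assoc, ← Complex.ofReal_mul,
      mul_inv_cancel₀ (by positivity), Complex.ofReal_one, one_mul]
  have hf0 : ‖f 0‖ = 1 := by
    rw [hf]
    simp only [hp0]
    rw [show -(s : ℂ) * Complex.I * r = ((-(s * r) : ℝ) : ℂ) * Complex.I by push_cast; ring]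
    exact Complex.norm_exp_ofReal_mul_I _
  have hfc : Continuous fun θ : ℝ => f (circleMap 0 1 θ) :=
    hfd.continuous.comp (continuous_circleMap 0 1)
  have hcos1 : 0 < Real.cos 1 := Real.cos_one_pos
  have hre : ∀ θ, Real.cos 1 * Real.exp (s * (fejerInterp N δ θ).im) ≤
      (f (circleMap 0 1 θ)).re := by
    intro θ
    simp only [hf, ← hpA, Complex.exp_re]
    have h1 : (-(s : ℂ) * Complex.I * fejerInterp N δ θ).re = s * (fejerInterp N δ θ).im := by
      simp [Complex.mul_re, Complex.mul_im]
    have h2 : (-(s : ℂ) * Complex.I * fejerInterp N δ θ).im = -(s * (fejerInterp N δ θ).re) := by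
      simp [Complex.mul_re, Complex.mul_im]
    rw [h1, h2, mul_comm, Real.cos_neg]
    refine mul_le_mul_of_nonneg_left ?_ (Real.exp_pos _).le
    rw [← Real.cos_abs (s * _), abs_mul, hs, one_mul]
    refine Real.cos_le_cos_of_nonneg_of_le_pi (abs_nonneg _) ?_ (abs_fejerInterp_re_le hN hδ θ)
    linarith [Real.pi_gt_three]
  have hmono : ∫ θ in (0 : ℝ)..2 * Real.pi, Real.cos 1 * Real.exp (s * (fejerInterp N δ θ).im) ≤
      ∫ θ in (0 : ℝ)..2 * Real.pi, (f (circleMap 0 1 θ)).re := by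
    refine intervalIntegral.integral_mono_on (by positivity) ?_ ?_ fun θ _ => hre θ
    · refine Continuous.intervalIntegrable ?_ _ _
      have : Continuous fun θ => (fejerInterp N δ θ).im := Complex.continuous_im.comp hcont
      fun_prop
    · exact (Complex.continuous_re.comp hfc).intervalIntegrable _ _
  have hre2 : ∫ θ in (0 : ℝ)..2 * Real.pi, (f (circleMap 0 1 θ)).re =
      (∫ θ in (0 : ℝ)..2 * Real.pi, f (circleMap 0 1 θ)).re :=
    intervalIntegral.intervalIntegral_re (hfc.intervalIntegrable _ _)
  rw [intervalIntegral.integral_const_mul, hre2, hint] at hmono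
  rw [le_div_iff₀ hcos1, mul_comm]
  refine hmono.trans ((Complex.re_le_norm _).trans ?_)
  rw [norm_mul, hf0, Complex.norm_real, Real.norm_eq_abs, abs_of_pos (by positivity), mul_one]

theorem expI_neg_circleNode_two_mul {n : ℕ} (hn : 0 < n) (i : ℕ) :
    expI (-n) (circleNode (2 * n) i) = (((-1) ^ i : ℝ) : ℂ) := by
  have hn' : (n : ℂ) ≠ 0 := by exact_mod_cast hn.ne'
  rw [expI, circleNode, Complex.ofReal_pow, Complex.ofReal_neg, Complex.ofReal_one,
    ← Complex.exp_neg_pi_mul_I, ← Complex.exp_nat_mul]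
  congr 1
  push_cast
  field_simp

/-- The modulation shifts the frequencies `0, …, 2n - 1` to `-n, …, n - 1`. It halves the degree
without changing the modulus. -/
theorem expI_mul_fejerInterp_mem {n : ℕ} (δ : ℕ → ℝ) :
    (fun θ => expI (-n) θ * fejerInterp (2 * n) δ θ) ∈ trigPoly n := by
  have : (fun θ => expI (-n) θ * fejerInterp (2 * n) δ θ) =
      ∑ j ∈ Finset.range (2 * n), ((δ j : ℂ) / ((2 * n : ℕ) : ℂ) ^ 2) •
        ((2 : ℂ) • (∑ k ∈ Finset.range (2 * n),
          ((((2 * n : ℕ) : ℂ) - k) * expI (-k) (circleNode (2 * n) j)) • expI ((k : ℤ) - n)) -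
        ((2 * n : ℕ) : ℂ) • expI (-n)) := by
    funext θ
    simp only [Finset.sum_apply, Pi.smul_apply, Pi.sub_apply, smul_eq_mul, fejerInterp,
      fejerAnalytic]
    rw [Finset.mul_sum]
    refine Finset.sum_congr rfl fun j _ => ?_
    have h1 : ∑ k ∈ Finset.range (2 * n), (((2 * n : ℕ) : ℂ) - k) *
        expI (-k) (circleNode (2 * n) j) * expI ((k : ℤ) - n) θ = expI (-n) θ *
        ∑ k ∈ Finset.range (2 * n), (((2 * n : ℕ) : ℂ) - k) * expI k (θ - circleNode (2 * n) j) := by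
      rw [Finset.mul_sum]
      refine Finset.sum_congr rfl fun k _ => ?_
      rw [expI_sub_right, sub_eq_add_neg (k : ℤ) n, expI_add_left (k : ℤ) (-n)]
      ring
    rw [h1]
    ring
  rw [this]
  refine Submodule.sum_mem _ fun j _ => Submodule.smul_mem _ _ (Submodule.sub_mem _
    (Submodule.smul_mem _ _ (Submodule.sum_mem _ fun k hk => Submodule.smul_mem _ _
      (expI_mem_trigPoly ?_))) (Submodule.smul_mem _ _ (expI_mem_trigPoly (by simp))))
  rw [Finset.mem_range] at hk
  rw [abs_le]
  constructor <;> omega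

/-- Interpolation of bounded data in the Clenshaw–Curtis nodes, with an exponential integrability
bound independent of the number of nodes. -/
theorem exists_interpolant {n : ℕ} (hn : 0 < n) {ε : ℕ → ℝ} (hε : ∀ j, |ε j| ≤ 1) :
    ∃ P : Polynomial ℝ, P.natDegree ≤ n ∧
      (∀ j ≤ n, P.eval (Real.cos (j * Real.pi / n)) = ε j) ∧
      ∫ θ in (0 : ℝ)..Real.pi, Real.exp |P.eval (Real.cos θ)| ≤
        8 * Real.pi * Real.exp 1 / Real.cos 1 := by
  have hn' : (n : ℝ) ≠ 0 := by exact_mod_cast hn.ne'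
  set N := 2 * n with hN
  have hN0 : 0 < N := by omega
  -- The sign cancels the value of `expI (-n)` at the `j`-th node; the index `min j (N - j)` extends
  -- the data evenly around the circle, so that taking the even part preserves interpolation.
  set δ : ℕ → ℝ := fun j => (-1) ^ j * ε (min j (N - j)) with hδ
  have hδ1 : ∀ j, |δ j| ≤ 1 := by
    intro j
    rw [hδ]
    simp only [abs_mul, abs_pow, abs_neg, abs_one, one_pow, one_mul]
    exact hε _
  set T : ℝ → ℂ := fun θ => expI (-n) θ * fejerInterp N δ θ with hT
  have hTmem : T ∈ trigPoly n := expI_mul_fejerInterp_mem δ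
  have hTnode : ∀ i < N, (T (circleNode N i)).re = ε (min i (N - i)) := by
    intro i hi
    rw [hT]
    simp only
    rw [hN, expI_neg_circleNode_two_mul hn, Complex.re_ofReal_mul, ← hN, fejerInterp_re_node hi, hδ]
    simp only
    rw [← mul_assoc, ← mul_pow]
    simp
  obtain ⟨P, Q, hP, -, hPQ⟩ := exists_polynomial_of_mem_trigPoly hTmem
  have hPre : ∀ θ : ℝ, P.eval (Real.cos θ) = ((T θ + T (-θ)) / 2).re := by
    intro θ
    rw [hPQ]
    simp
  refine ⟨P, hP, fun j hj => ?_, ?_⟩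
  · have h1 : (j : ℝ) * Real.pi / n = circleNode N j := by
      rw [circleNode, hN]
      push_cast
      field_simp
    rw [h1, hPre, Complex.div_ofNat_re, Complex.add_re, hTnode j (by omega)]
    have h2 : (T (-circleNode N j)).re = ε j := by
      rcases Nat.eq_zero_or_pos j with h0 | h0
      · subst h0
        have := hTnode 0 hN0
        simpa [circleNode] using this
      · have h3 : -circleNode N j + 2 * Real.pi = circleNode N (N - j) := by
          rw [circleNode, circleNode, Nat.cast_sub (by omega), hN]
          push_cast
          field_simp
          ring
        rw [← trigPoly_add_two_pi hTmem, h3, hTnode _ (by omega)]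
        congr 1
        omega
    rw [h2, min_eq_left (by omega)]
    ring
  · set V : ℝ → ℝ := fun θ => (fejerInterp N δ θ).im with hV
    have hVc : Continuous V := Complex.continuous_im.comp (continuous_fejerInterp N δ)
    have hVper : Function.Periodic V (2 * Real.pi) := fun θ => by
      rw [hV]
      simp only [fejerInterp_periodic N δ θ]
    have hTV : ∀ θ, ‖T θ‖ ≤ 1 + |V θ| := by
      intro θ
      rw [hT]
      simp only [norm_mul, norm_expI, one_mul]
      exact (Complex.norm_le_abs_re_add_abs_im _).trans
        (add_le_add_left (abs_fejerInterp_re_le hN0 hδ1 θ) _)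
    have hexp : ∀ x : ℝ, Real.exp |x| ≤ Real.exp x + Real.exp (-x) := by
      intro x
      rcases abs_choice x with h | h <;> rw [h] <;> linarith [Real.exp_pos x, Real.exp_pos (-x)]
    -- The real part of the interpolant contributes `exp 1`; its imaginary part enters through both
    -- signs and both `±θ`, giving four integrals of size at most `2π / cos 1`.
    have hpt : ∀ θ : ℝ, Real.exp |P.eval (Real.cos θ)| ≤ Real.exp 1 *
        ((Real.exp (1 * V θ) + Real.exp (-1 * V θ)) +
          (Real.exp (1 * V (-θ)) + Real.exp (-1 * V (-θ)))) := by
      intro θ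
      have h1 : |P.eval (Real.cos θ)| ≤ 1 + max |V θ| |V (-θ)| := by
        rw [hPre]
        refine (Complex.abs_re_le_norm _).trans ?_
        rw [norm_div, Complex.norm_ofNat]
        have := norm_add_le (T θ) (T (-θ))
        have h3 := le_max_left |V θ| |V (-θ)|
        have h4 := le_max_right |V θ| |V (-θ)|
        linarith [hTV θ, hTV (-θ)]
      refine (Real.exp_le_exp.2 h1).trans ?_
      rw [Real.exp_add]
      refine mul_le_mul_of_nonneg_left ?_ (Real.exp_pos 1).le
      have h5 := hexp (V θ)
      have h6 := hexp (V (-θ))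
      simp only [one_mul, neg_one_mul]
      rcases max_choice |V θ| |V (-θ)| with h | h <;> rw [h] <;>
        linarith [Real.exp_pos |V θ|, Real.exp_pos |V (-θ)|]
    have hi : ∀ s : ℝ, |s| = 1 → ∫ θ in (0 : ℝ)..2 * Real.pi, Real.exp (s * V (-θ)) ≤
        2 * Real.pi / Real.cos 1 := by
      intro s hs
      rw [intervalIntegral.integral_comp_neg (f := fun θ => Real.exp (s * V θ)), neg_zero]
      have h1 : Function.Periodic (fun θ => Real.exp (s * V θ)) (2 * Real.pi) := fun θ => by
        simp only [hVper θ]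
      have h2 := h1.intervalIntegral_add_eq (-(2 * Real.pi)) 0
      rw [neg_add_cancel, zero_add] at h2
      rw [h2]
      exact integral_exp_im_fejerInterp_le hN0 hδ1 hs
    have hPc : Continuous fun θ => Real.exp |P.eval (Real.cos θ)| := by
      have := P.continuous.comp Real.continuous_cos
      simp only [Function.comp_def] at this
      fun_prop
    have hVc' : Continuous fun θ => V (-θ) := hVc.comp continuous_neg
    have hI : ∀ (s : ℝ) (f : ℝ → ℝ), Continuous f →
        IntervalIntegrable (fun θ => Real.exp (s * f θ)) volume 0 (2 * Real.pi) := fun s f hf =>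
      Continuous.intervalIntegrable (by fun_prop) _ _
    have hpi := Real.pi_pos
    calc ∫ θ in (0 : ℝ)..Real.pi, Real.exp |P.eval (Real.cos θ)|
        ≤ ∫ θ in (0 : ℝ)..2 * Real.pi, Real.exp |P.eval (Real.cos θ)| :=
          intervalIntegral.integral_mono_interval le_rfl hpi.le (by linarith)
            (Filter.Eventually.of_forall fun θ => (Real.exp_pos _).le)
            (hPc.intervalIntegrable _ _)
      _ ≤ ∫ θ in (0 : ℝ)..2 * Real.pi, Real.exp 1 *
          ((Real.exp (1 * V θ) + Real.exp (-1 * V θ)) +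
          (Real.exp (1 * V (-θ)) + Real.exp (-1 * V (-θ)))) :=
          intervalIntegral.integral_mono_on (by positivity) (hPc.intervalIntegrable _ _)
            ((((hI 1 V hVc).add (hI (-1) V hVc)).add
              ((hI 1 _ hVc').add (hI (-1) _ hVc'))).const_mul _) fun θ _ => hpt θ
      _ ≤ _ := by
          rw [intervalIntegral.integral_const_mul,
            intervalIntegral.integral_add ((hI 1 V hVc).add (hI (-1) V hVc))
              ((hI 1 _ hVc').add (hI (-1) _ hVc')),
            intervalIntegral.integral_add (hI 1 V hVc) (hI (-1) V hVc),
            intervalIntegral.integral_add (hI 1 _ hVc') (hI (-1) _ hVc')]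
          have e1 := integral_exp_im_fejerInterp_le hN0 hδ1 (s := 1) (by simp)
          have e2 := integral_exp_im_fejerInterp_le hN0 hδ1 (s := -1) (by simp)
          have e3 := hi 1 (by simp)
          have e4 := hi (-1) (by simp)
          rw [show 8 * Real.pi * Real.exp 1 / Real.cos 1 =
            Real.exp 1 * (4 * (2 * Real.pi / Real.cos 1)) by ring]
          refine mul_le_mul_of_nonneg_left ?_ (Real.exp_pos 1).le
          linarith

/-! ## Stability of the Clenshaw–Curtis rules -/

/-- In the angular variable Lebesgue measure acquires the Jacobian `(b - a)/2 · sin θ`, and `sin θ ≤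
1` discards the sine. -/
theorem integral_exp_abs_comp_toStd_le {a b : ℝ} (hab : a < b) {P : Polynomial ℝ} {K : ℝ}
    (hP : ∫ θ in (0 : ℝ)..Real.pi, Real.exp |P.eval (Real.cos θ)| ≤ K) :
    ∫ x in a..b, Real.exp |(P.comp (toStd a b)).eval x| ≤ (b - a) / 2 * K := by
  have hh : 0 < (b - a) / 2 := by linarith
  set g : ℝ → ℝ := fun x => Real.exp |(P.comp (toStd a b)).eval x| with hg
  have hgc : Continuous g := by
    have := (P.comp (toStd a b)).continuous
    rw [hg]
    fun_prop
  have hPc : Continuous fun θ => Real.exp |P.eval (Real.cos θ)| := by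
    have := P.continuous.comp Real.continuous_cos
    simp only [Function.comp_def] at this
    fun_prop
  have hcv := intervalIntegral.integral_comp_mul_deriv (a := 0) (b := Real.pi)
    (f := fun θ => (a + b) / 2 + (b - a) / 2 * Real.cos θ)
    (f' := fun θ => (b - a) / 2 * (-Real.sin θ)) (g := g)
    (fun θ _ => ((Real.hasDerivAt_cos θ).const_mul _).const_add _)
    (by fun_prop) hgc
  have e0 : (a + b) / 2 + (b - a) / 2 * Real.cos 0 = b := by rw [Real.cos_zero]; ring
  have e1 : (a + b) / 2 + (b - a) / 2 * Real.cos Real.pi = a := by rw [Real.cos_pi]; ring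
  simp only [e0, e1] at hcv
  rw [intervalIntegral.integral_symm, ← hcv, ← intervalIntegral.integral_neg]
  refine le_trans ?_ (mul_le_mul_of_nonneg_left hP hh.le)
  rw [← intervalIntegral.integral_const_mul]
  refine intervalIntegral.integral_mono_on Real.pi_pos.le ?_ ?_ fun θ hθ => ?_
  · refine Continuous.intervalIntegrable ?_ _ _
    simp only [Function.comp_def]
    fun_prop
  · exact (hPc.const_mul _).intervalIntegrable _ _
  · simp only [Function.comp_def, hg, Polynomial.eval_comp, toStd_eval hab]
    have h1 := Real.sin_le_one θ
    have h2 := Real.exp_pos |P.eval (Real.cos θ)|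
    rw [show -(Real.exp |P.eval (Real.cos θ)| * ((b - a) / 2 * -Real.sin θ)) =
      (b - a) / 2 * (Real.exp |P.eval (Real.cos θ)| * Real.sin θ) by ring]
    exact mul_le_mul_of_nonneg_left (mul_le_of_le_one_right h2.le h1) hh.le

theorem rpow_le_mul_exp {q : ℝ} {n : ℕ} (hq : 0 ≤ q) (hqn : q ≤ n) {x : ℝ} (hx : 0 ≤ x) :
    x ^ q ≤ (1 + n.factorial) * Real.exp x := by
  have h1 : x ^ q ≤ 1 + x ^ n := by
    rcases le_total x 1 with h | h
    · have := Real.rpow_le_one hx h hq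
      have := pow_nonneg hx n
      linarith
    · have := Real.rpow_le_rpow_of_exponent_le h hqn
      rw [Real.rpow_natCast] at this
      linarith
  have h2 := Real.pow_div_factorial_le_exp x hx n
  rw [div_le_iff₀ (by positivity)] at h2
  have h3 := Real.one_le_exp hx
  linarith

theorem eLpNorm_le_of_integral_exp {a b : ℝ} (hab : a < b) {F : ℝ → ℝ} (hF : Continuous F) {K : ℝ}
    (hK : ∫ x in a..b, Real.exp |F x| ≤ K) {q : ℝ≥0∞} (hq0 : q ≠ 0) (hq : q ≠ ∞) {n : ℕ}
    (hqn : q.toReal ≤ n) :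
    eLpNorm F q (volume.restrict (Set.Icc a b)) ≤
      ENNReal.ofReal ((1 + n.factorial) * K) ^ (1 / q.toReal) := by
  rw [eLpNorm_eq_lintegral_rpow_enorm_toReal hq0 hq]
  refine ENNReal.rpow_le_rpow ?_ (by positivity)
  have hcont : Continuous fun x => (1 + (n.factorial : ℝ)) * Real.exp |F x| := by fun_prop
  calc ∫⁻ x in Set.Icc a b, ‖F x‖ₑ ^ q.toReal
      ≤ ∫⁻ x in Set.Icc a b, ENNReal.ofReal ((1 + n.factorial) * Real.exp |F x|) := by
        refine lintegral_mono fun x => ?_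
        rw [Real.enorm_eq_ofReal_abs, ENNReal.ofReal_rpow_of_nonneg (abs_nonneg _) (by positivity)]
        exact ENNReal.ofReal_le_ofReal (rpow_le_mul_exp (by positivity) hqn (abs_nonneg _))
    _ = ENNReal.ofReal (∫ x in Set.Icc a b, (1 + n.factorial) * Real.exp |F x|) :=
        (ofReal_integral_eq_lintegral_ofReal
          (hcont.continuousOn.integrableOn_compact isCompact_Icc)
          (Filter.Eventually.of_forall fun x => by positivity)).symm
    _ ≤ _ := by
        refine ENNReal.ofReal_le_ofReal ?_
        rw [integral_Icc_eq_integral_Ioc, ← intervalIntegral.integral_of_le hab.le,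
          intervalIntegral.integral_const_mul]
        exact mul_le_mul_of_nonneg_left hK (by positivity)

/-- Hölder's inequality. The measure uses the positive part of `f`, which is dominated by `|f|`, so
no sign condition on `f` is needed. -/
theorem abs_integral_intervalDensityMeasure_le {a b : ℝ} {f F : ℝ → ℝ} {p q : ℝ≥0∞}
    [ENNReal.HolderConjugate q p] (hf : MemLp f p (volume.restrict (Set.Icc a b)))
    (hF : Continuous F) :
    ‖∫ x, F x ∂intervalDensityMeasure a b f‖ₑ ≤
      eLpNorm F q (volume.restrict (Set.Icc a b)) * eLpNorm f p (volume.restrict (Set.Icc a b)) := by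
  rw [intervalDensityMeasure, integral_withDensity_eq_integral_toReal_smul₀
    hf.1.aemeasurable.ennreal_ofReal (Filter.Eventually.of_forall fun x => ENNReal.ofReal_lt_top)]
  refine (enorm_integral_le_lintegral_enorm _).trans ?_
  refine le_trans ?_ (eLpNorm_smul_le_mul_eLpNorm (r := 1) hf.1 hF.aestronglyMeasurable)
  rw [eLpNorm_one_eq_lintegral_enorm]
  refine lintegral_mono fun x => ?_
  rw [enorm_smul, Pi.smul_apply', enorm_smul, mul_comm]
  gcongr
  rw [ENNReal.toReal_ofReal', Real.enorm_eq_ofReal_abs, Real.enorm_eq_ofReal_abs]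
  refine ENNReal.ofReal_le_ofReal ?_
  rw [abs_of_nonneg (le_max_right _ _)]
  exact max_le (le_abs_self _) (abs_nonneg _)

/-- The Clenshaw–Curtis rules with respect to densities bounded in `L^p`, `p > 1`, are uniformly
stable. -/
theorem exists_sum_abs_ccWeight_le {a b : ℝ} (hab : a < b) {p : ℝ≥0∞} (hp : 1 < p) (M : ℝ≥0) :
    ∃ W : ℝ, 1 ≤ W ∧ ∀ f : ℝ → ℝ, IsProbabilityMeasure (intervalDensityMeasure a b f) →
      MemLp f p (volume.restrict (Set.Icc a b)) →
      eLpNorm f p (volume.restrict (Set.Icc a b)) ≤ M →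
      ∀ m : ℕ, 1 ≤ m → ∑ j, |ccWeight (intervalDensityMeasure a b f) a b m j| ≤ W := by
  have hpc := ENNReal.HolderConjugate.conjExponent hp.le
  set q := p.conjExponent with hq
  have hq0 : q ≠ 0 := (ENNReal.HolderConjugate.symm (p := p) (q := q)).ne_zero
  -- This is where `p > 1` enters: exponential integrability bounds every `L^q` norm with finite
  -- `q`, but not the supremum.
  have hqt : q ≠ ∞ := (ENNReal.HolderConjugate.ne_top_iff_ne_one q p).2 hp.ne'
  obtain ⟨n, hn⟩ := exists_nat_ge q.toReal
  set K := (b - a) / 2 * (8 * Real.pi * Real.exp 1 / Real.cos 1)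
  set E : ℝ≥0∞ := ENNReal.ofReal ((1 + n.factorial) * K) ^ (1 / q.toReal) * M with hE
  have hEt : E ≠ ∞ := ENNReal.mul_ne_top
    (ENNReal.rpow_ne_top_of_nonneg (by positivity) ENNReal.ofReal_ne_top) ENNReal.coe_ne_top
  refine ⟨max 1 E.toReal, le_max_left _ _, fun f hprob hf hfM m hm => ?_⟩
  set μ := intervalDensityMeasure a b f
  have hexact := (ccWeight_unique hab m μ (integrable_eval_intervalDensityMeasure a b f) _).2 rfl
  rcases Nat.lt_or_ge 1 m with hm1 | hm1
  · refine le_max_of_le_right ?_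
    have hm1' : (0 : ℝ) < (m : ℝ) - 1 := by
      have : (1 : ℝ) < m := by exact_mod_cast hm1
      linarith
    -- Duality: integrating the interpolant of the signs by the rule gives the sum of the absolute
    -- weights. The value beyond `m` is irrelevant but must be bounded by 1.
    set ε : ℕ → ℝ := fun j => if h : j < m then (SignType.sign (ccWeight μ a b m ⟨j, h⟩) : ℝ) else 0
    have hε : ∀ j, |ε j| ≤ 1 := by
      intro j
      simp only [ε]
      split_ifs with h
      · rcases SignType.sign (ccWeight μ a b m ⟨j, h⟩) with _ | _ | _ <;> simp
      · simp
    obtain ⟨P, hP, hPε, hPK⟩ := exists_interpolant (n := m - 1) (by omega) hε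
    have hnode : ∀ j : Fin m, (P.comp (toStd a b)).eval (ccNode a b m j) = ε j := by
      intro j
      rw [Polynomial.eval_comp, ccNode, toStd_eval hab, ccNodeStd, if_neg (by omega),
        ← hPε j (by omega), Nat.cast_sub hm, Nat.cast_one]
    have hdeg : (P.comp (toStd a b)).degree < m := by
      refine lt_of_le_of_lt Polynomial.degree_le_natDegree ?_
      have := natDegree_comp_toStd_le a b P
      exact_mod_cast (by omega : (P.comp (toStd a b)).natDegree < m)
    have h1 := hexact _ hdeg
    have h2 : ∑ j, |ccWeight μ a b m j| = ∫ x, (P.comp (toStd a b)).eval x ∂μ := by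
      rw [← h1]
      refine Finset.sum_congr rfl fun j _ => ?_
      rw [hnode j]
      simp only [ε, j.2, dif_pos]
      exact (self_mul_sign _).symm
    rw [h2]
    refine (le_abs_self _).trans ?_
    have h3 := abs_integral_intervalDensityMeasure_le (q := q) hf (P.comp (toStd a b)).continuous
    have h4 : ‖∫ x, (P.comp (toStd a b)).eval x ∂μ‖ₑ ≤ E :=
      h3.trans (mul_le_mul' (eLpNorm_le_of_integral_exp hab (P.comp (toStd a b)).continuous
        (integral_exp_abs_comp_toStd_le hab hPK) hq0 hqt hn) hfM)
    have h5 := ENNReal.toReal_mono hEt h4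
    rwa [toReal_enorm, Real.norm_eq_abs] at h5
  · refine le_max_of_le_left ?_
    obtain rfl : m = 1 := by omega
    have := hexact 1 (by rw [Polynomial.degree_one]; norm_num)
    simp only [Polynomial.eval_one, mul_one, integral_const, probReal_univ, smul_eq_mul] at this
    rw [Fin.sum_univ_one] at this ⊢
    rw [this, abs_one]

/-! ## Exactness of the combination formula -/

theorem coeff_one_sub_X_pow (n j : ℕ) :
    PowerSeries.coeff j ((1 - PowerSeries.X : PowerSeries ℝ) ^ n) = (-1) ^ j * (n.choose j : ℝ) := by
  induction n generalizing j with
  | zero =>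
    cases j with
    | zero => simp
    | succ j => simp [PowerSeries.coeff_one]
  | succ n ih =>
    rw [pow_succ', sub_mul, one_mul, map_sub]
    cases j with
    | zero => simp [ih]
    | succ j =>
      rw [PowerSeries.coeff_succ_X_mul, ih, ih, Nat.choose_succ_succ]
      push_cast
      ring

theorem sum_coeff_one_sub_X_mul (Z : PowerSeries ℝ) (l : ℕ) :
    ∑ t ∈ Finset.range (l + 1), PowerSeries.coeff t ((1 - PowerSeries.X) * Z) =
      PowerSeries.coeff l Z := by
  induction l with
  | zero => simp [sub_mul]
  | succ l ih =>
    rw [Finset.sum_range_succ, ih, sub_mul, one_mul, map_sub, PowerSeries.coeff_succ_X_mul]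
    ring

theorem coeff_prod_mk {d : ℕ} (X : Fin d → ℕ → ℝ) (t : ℕ) :
    PowerSeries.coeff t (∏ i, PowerSeries.mk (X i)) =
      ∑ κ ∈ Finset.piAntidiag Finset.univ t, ∏ i, X i (κ i) := by
  rw [PowerSeries.coeff_prod]
  refine Finset.sum_bij' (fun κ _ => (κ : Fin d → ℕ)) (fun κ _ => Finsupp.equivFunOnFinite.symm κ)
    ?_ ?_ ?_ ?_ ?_
  · intro κ hκ
    simpa using hκ
  · intro κ hκ
    simpa using hκ
  · intro κ _
    simp
  · intro κ _
    simp
  · intro κ _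
    simp

/-- If all univariate rules are exact from the level `k₀` on, then the combination formula is exact
as soon as `d * k₀ ≤ l + d`. -/
theorem coeff_combination_eq_prod {d : ℕ} (hd : 1 ≤ d) (l K : ℕ) (hK : d * K ≤ l)
    (X : Fin d → ℕ → ℝ) (v : Fin d → ℝ) (hX : ∀ i k, K ≤ k → X i k = v i) :
    PowerSeries.coeff l ((1 - PowerSeries.X) ^ (d - 1) * ∏ i, PowerSeries.mk (X i)) = ∏ i, v i := by
  -- Summing coefficients up to `l` absorbs one more factor `1 - X`, so each of the `d` series
  -- receives its own and becomes a series of first differences.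
  rw [← sum_coeff_one_sub_X_mul, ← mul_assoc, ← pow_succ', Nat.sub_add_cancel hd]
  have h1 : (1 - PowerSeries.X : PowerSeries ℝ) ^ d * ∏ i, PowerSeries.mk (X i) =
      ∏ i, ((1 - PowerSeries.X) * PowerSeries.mk (X i)) := by
    rw [Finset.prod_mul_distrib]
    simp
  -- The differences vanish after index `K`, so truncation loses nothing. The product then has
  -- degree at most `d * K ≤ l`, hence the partial sum of its coefficients is its value at 1, and
  -- each factor telescopes to `v i`.
  set D : Fin d → Polynomial ℝ := fun i =>
    PowerSeries.trunc (K + 1) ((1 - PowerSeries.X) * PowerSeries.mk (X i)) with hD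
  have h2 : ∀ i, (1 - PowerSeries.X) * PowerSeries.mk (X i) = (D i : PowerSeries ℝ) := by
    intro i
    ext k
    rw [Polynomial.coeff_coe, hD, PowerSeries.coeff_trunc]
    split_ifs with hk
    · rfl
    · obtain ⟨k, rfl⟩ := Nat.exists_eq_succ_of_ne_zero (by omega : k ≠ 0)
      rw [sub_mul, one_mul, map_sub, Nat.succ_eq_add_one, PowerSeries.coeff_succ_X_mul,
        PowerSeries.coeff_mk, PowerSeries.coeff_mk, hX i _ (by omega), hX i _ (by omega), sub_self]
  have h3 : ∀ i, (D i).eval 1 = v i := by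
    intro i
    rw [Polynomial.eval_eq_sum_range' (show (D i).natDegree < K + 1 from
      PowerSeries.natDegree_trunc_lt _ K)]
    have hco : ∀ x, (D i).coeff x = PowerSeries.coeff x ((1 - PowerSeries.X) * PowerSeries.mk (X i)) :=
      fun x => by rw [h2, Polynomial.coeff_coe]
    simp only [one_pow, mul_one, hco]
    rw [sum_coeff_one_sub_X_mul, PowerSeries.coeff_mk, hX i K le_rfl]
  have hdeg : (∏ i, D i).natDegree < l + 1 := by
    refine Nat.lt_succ_of_le ((Polynomial.natDegree_prod_le _ _).trans ?_)
    calc ∑ i, (D i).natDegree ≤ ∑ _i : Fin d, K := Finset.sum_le_sum fun i _ =>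
          Nat.lt_succ_iff.1 (PowerSeries.natDegree_trunc_lt _ K)
      _ ≤ l := by simpa using hK
  have h4 : ∏ i, ((1 - PowerSeries.X) * PowerSeries.mk (X i)) =
      ((∏ i, D i : Polynomial ℝ) : PowerSeries ℝ) := by
    rw [Finset.prod_congr rfl fun i _ => h2 i]
    exact (map_prod (Polynomial.coeToPowerSeries.ringHom (R := ℝ)) D _).symm
  rw [h1, h4]
  simp only [Polynomial.coeff_coe]
  rw [← Finset.prod_congr rfl fun i _ => h3 i, ← Polynomial.eval_prod,
    Polynomial.eval_eq_sum_range' hdeg]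
  simp

/-- The signed binomials are the coefficients of `(1 - X)^(d-1)`, so on product functions the
combination formula is a Cauchy product. Levels start at 1 and exponents at 0, hence `k i - 1`. -/
theorem sum_smolyakIndices_eq_coeff {d : ℕ} (hd : 1 ≤ d) (l : ℕ) (X : Fin d → ℕ → ℝ) :
    ∑ k ∈ smolyakIndices d l, (-1 : ℝ) ^ (l + d - ∑ i, k i) *
      ((d - 1).choose (l + d - ∑ i, k i) : ℝ) * ∏ i, X i (k i - 1) =
    PowerSeries.coeff l ((1 - PowerSeries.X) ^ (d - 1) * ∏ i, PowerSeries.mk (X i)) := by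
  have hadd : ∀ κ : Fin d → ℕ, ∑ i, (κ i + 1) = ∑ i, κ i + d := by
    intro κ
    simp [Finset.sum_add_distrib]
  rw [PowerSeries.coeff_mul, Finset.Nat.sum_antidiagonal_eq_sum_range_succ_mk]
  simp only [coeff_one_sub_X_pow, coeff_prod_mk, Finset.mul_sum]
  rw [Finset.sum_sigma']
  have hsub : smolyakIndices d l ⊆ (Fintype.piFinset fun _ : Fin d => Finset.Icc 1 (l + d)).filter
      fun k => ∑ i, k i ≤ l + d := by
    intro k hk
    simp only [smolyakIndices, Finset.mem_filter] at hk ⊢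
    exact ⟨hk.1, hk.2.2⟩
  rw [Finset.sum_subset hsub]
  · have hsum : ∀ k ∈ (Fintype.piFinset fun _ : Fin d => Finset.Icc 1 (l + d)).filter
        (fun k => ∑ i, k i ≤ l + d), ∑ i, k i = ∑ i, (k i - 1) + d ∧ ∑ i, k i ≤ l + d ∧
          ∀ i, k i - 1 + 1 = k i := by
      intro k hk
      simp only [Finset.mem_filter, Fintype.mem_piFinset, Finset.mem_Icc] at hk
      have h : ∀ i, k i - 1 + 1 = k i := fun i => by have := (hk.1 i).1; omega
      refine ⟨?_, hk.2, h⟩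
      rw [← hadd fun i => k i - 1]
      exact Finset.sum_congr rfl fun i _ => (h i).symm
    refine Finset.sum_bij' (fun k _ => ⟨l + d - ∑ i, k i, fun i => k i - 1⟩)
      (fun s _ => fun i => s.2 i + 1) ?_ ?_ ?_ ?_ ?_
    · intro k hk
      obtain ⟨h1, h2, -⟩ := hsum k hk
      simp only [Finset.mem_sigma, Finset.mem_range, Finset.mem_piAntidiag, Finset.mem_univ,
        implies_true, and_true]
      omega
    · rintro ⟨j, κ⟩ hs
      simp only [Finset.mem_sigma, Finset.mem_range, Finset.mem_piAntidiag, Finset.mem_univ,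
        implies_true, and_true] at hs
      have hj : j < l + 1 := hs.1
      have hκ : ∑ i, κ i = l - j := hs.2
      simp only [Finset.mem_filter, Fintype.mem_piFinset, Finset.mem_Icc, hadd]
      refine ⟨fun i => ?_, by omega⟩
      have := Finset.single_le_sum (f := κ) (fun _ _ => Nat.zero_le _) (Finset.mem_univ i)
      omega
    · intro k hk
      funext i
      exact (hsum k hk).2.2 i
    · rintro ⟨j, κ⟩ hs
      simp only [Finset.mem_sigma, Finset.mem_range, Finset.mem_piAntidiag, Finset.mem_univ,
        implies_true, and_true] at hs
      have hj : j < l + 1 := hs.1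
      have hκ : ∑ i, κ i = l - j := hs.2
      simp only [hadd, Nat.add_sub_cancel]
      congr 1
      omega
    · intro k _
      rfl
  -- Dropping the lower bound on `|k|` adds only zero terms: there `l + d - |k| ≥ d`, so the
  -- binomial coefficient vanishes.
  · intro k hk hk'
    simp only [smolyakIndices, Finset.mem_filter, not_and, not_le] at hk hk'
    rw [Nat.choose_eq_zero_of_lt]
    · simp
    · by_contra hcon
      have := hk' hk.1 (by omega)
      omega

theorem growth_pos (k : ℕ) : 1 ≤ growth k := by
  unfold growth
  split_ifs
  exacts [le_rfl, Nat.le_add_left _ _]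

theorem tensorRule_prod {d : ℕ} (μ : Fin d → Measure ℝ) (a b : ℝ) (k : Fin d → ℕ)
    (F : Fin d → ℝ → ℝ) :
    tensorRule μ a b k (fun x => ∏ i, F i (x i)) = ∏ i, ∑ j : Fin (growth (k i)),
      ccWeight (μ i) a b (growth (k i)) j * F i (ccNode a b (growth (k i)) j) := by
  rw [tensorRule, Finset.prod_univ_sum, Fintype.piFinset_univ]
  refine Finset.sum_congr rfl fun j _ => ?_
  rw [← Finset.prod_mul_distrib]
  rfl

theorem growth_mono {k k' : ℕ} (hk : 1 ≤ k) (h : k ≤ k') : growth k ≤ growth k' := by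
  unfold growth
  split_ifs with h1 h2
  · omega
  · exact Nat.le_add_left _ _
  · omega
  · have := Nat.pow_le_pow_right (n := 2) (by norm_num) (by omega : k - 1 ≤ k' - 1)
    omega

/-- Polynomial exactness of the Smolyak rule. -/
theorem sparseRule_prod_polynomial {a b : ℝ} (hab : a < b) {d : ℕ} (hd : 1 ≤ d) (l : ℕ)
    (μ : Fin d → Measure ℝ) (hμ : ∀ i, ∀ P : Polynomial ℝ, Integrable (fun x => P.eval x) (μ i))
    (Q : Fin d → Polynomial ℝ) (hQ : ∀ i, (Q i).natDegree < growth (l / d + 1)) :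
    sparseRule μ a b l (fun x => ∏ i, (Q i).eval (x i)) = ∏ i, ∫ x, (Q i).eval x ∂μ i := by
  -- `l / d` is the largest zero-based level `K` with `d * K ≤ l`.
  rw [← coeff_combination_eq_prod hd l (l / d) (Nat.mul_div_le l d)
    (fun i k => ∑ j : Fin (growth (k + 1)),
      ccWeight (μ i) a b (growth (k + 1)) j * (Q i).eval (ccNode a b (growth (k + 1)) j)) _ ?_,
    ← sum_smolyakIndices_eq_coeff hd, sparseRule]
  · refine Finset.sum_congr rfl fun k hk => ?_
    rw [tensorRule_prod μ a b k fun i x => (Q i).eval x]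
    congr 1
    refine Finset.prod_congr rfl fun i _ => ?_
    have : k i - 1 + 1 = k i := by
      simp only [smolyakIndices, Finset.mem_filter, Fintype.mem_piFinset, Finset.mem_Icc] at hk
      have := (hk.1 i).1
      omega
    rw [this]
  · intro i k hk
    refine (ccWeight_unique hab _ (μ i) (hμ i) _).2 rfl (Q i) ?_
    refine lt_of_le_of_lt Polynomial.degree_le_natDegree ?_
    exact_mod_cast (hQ i).trans_le (growth_mono (Nat.le_add_left _ _) (Nat.succ_le_succ hk))

/-! ## Cardinalities and stability -/

/-- An index is determined by its sum, which takes `d` values, and by all entries but the first.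
This saves one power of `l`, which is needed for the exponent of the logarithm. -/
theorem card_smolyakIndices_le {d : ℕ} (hd : 1 ≤ d) (l : ℕ) :
    (smolyakIndices d l).card ≤ d * (l + d) ^ (d - 1) := by
  obtain ⟨e, rfl⟩ := Nat.exists_eq_add_of_le' hd
  have hcard : (Finset.range (e + 1) ×ˢ
      Fintype.piFinset fun _ : Fin e => Finset.Icc 1 (l + (e + 1))).card =
      (e + 1) * (l + (e + 1)) ^ (e + 1 - 1) := by
    simp
  rw [← hcard]
  refine Finset.card_le_card_of_injOn (fun k => (∑ i, k i - (l + 1), fun i => k i.succ)) ?_ ?_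
  · intro k hk
    simp only [smolyakIndices, Finset.coe_filter, Set.mem_ofPred_eq, Fintype.mem_piFinset,
      Finset.mem_Icc] at hk
    simp only [Finset.mem_coe, Finset.mem_product, Finset.mem_range, Fintype.mem_piFinset,
      Finset.mem_Icc]
    exact ⟨by omega, fun i => hk.1 _⟩
  · intro k hk k' hk' h
    simp only [smolyakIndices, Finset.coe_filter, Set.mem_ofPred_eq] at hk hk'
    simp only [Prod.mk.injEq] at h
    obtain ⟨h1, h2⟩ := h
    have h3 : ∑ i, k i = ∑ i, k' i := by omega
    have h4 : ∀ i : Fin e, k i.succ = k' i.succ := fun i => congrFun h2 i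
    rw [Fin.sum_univ_succ, Fin.sum_univ_succ, Finset.sum_congr rfl fun i _ => h4 i] at h3
    funext i
    refine Fin.cases ?_ h4 i
    omega

theorem growth_le_two_pow {k : ℕ} (hk : 1 ≤ k) : growth k ≤ 2 ^ k := by
  unfold growth
  split_ifs with h
  · exact Nat.one_le_two_pow
  · have h1 : 2 ^ k = 2 ^ (k - 1) + 2 ^ (k - 1) := by
      rw [← two_mul, ← pow_succ', Nat.sub_add_cancel hk]
    have h2 : 1 ≤ 2 ^ (k - 1) := Nat.one_le_two_pow
    omega

open Classical in
theorem sparseGrid_eq_coe (d : ℕ) (a b : ℝ) (l : ℕ) : sparseGrid d a b l =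
    (((smolyakIndices d l).biUnion fun k => Finset.univ.image (gridPoint a b k) :
      Finset (EuclideanSpace ℝ (Fin d))) : Set (EuclideanSpace ℝ (Fin d))) := by
  ext x
  simp [sparseGrid, eq_comm]

theorem sparseGrid_finite (d : ℕ) (a b : ℝ) (l : ℕ) : (sparseGrid d a b l).Finite := by
  classical
  rw [sparseGrid_eq_coe]
  exact Finset.finite_toSet _

/-- Each tensor grid has at most `2^|k| ≤ 2^(l+d)` points; overlaps between the grids are ignored.
-/
theorem numNodes_le {d : ℕ} (hd : 1 ≤ d) (a b : ℝ) (l : ℕ) :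
    numNodes d a b l ≤ d * (l + d) ^ (d - 1) * 2 ^ (l + d) := by
  classical
  rw [numNodes, sparseGrid_eq_coe, Set.ncard_coe_finset]
  refine Finset.card_biUnion_le.trans ?_
  calc _ ≤ ∑ k ∈ smolyakIndices d l, 2 ^ (l + d) := Finset.sum_le_sum fun k hk => ?_
    _ ≤ _ := by
      rw [Finset.sum_const, smul_eq_mul]
      exact Nat.mul_le_mul_right _ (card_smolyakIndices_le hd l)
  refine Finset.card_image_le.trans ?_
  rw [Finset.card_univ, Fintype.card_pi]
  simp only [Fintype.card_fin]
  simp only [smolyakIndices, Finset.mem_filter, Fintype.mem_piFinset, Finset.mem_Icc] at hk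
  calc ∏ i, growth (k i) ≤ ∏ i, 2 ^ k i :=
        Finset.prod_le_prod' fun i _ => growth_le_two_pow (hk.1 i).1
    _ = 2 ^ ∑ i, k i := Finset.prod_pow_eq_pow_sum _ _ _
    _ ≤ _ := Nat.pow_le_pow_right (by norm_num) hk.2.2

theorem gridPoint_injective {a b : ℝ} (hab : a < b) {d : ℕ} (k : Fin d → ℕ) :
    Function.Injective (gridPoint a b k) := by
  intro j j' h
  funext i
  apply ccNode_injective hab
  exact congrArg (fun x : EuclideanSpace ℝ (Fin d) => x i) h

theorem prod_growth_le_numNodes {a b : ℝ} (hab : a < b) {d l : ℕ} {k : Fin d → ℕ}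
    (hk : k ∈ smolyakIndices d l) : ∏ i, growth (k i) ≤ numNodes d a b l := by
  classical
  have h1 : (Finset.univ.image (gridPoint a b k)).card = ∏ i, growth (k i) := by
    rw [Finset.card_image_of_injective _ (gridPoint_injective hab k), Finset.card_univ,
      Fintype.card_pi]
    simp
  rw [← h1, numNodes, sparseGrid_eq_coe, Set.ncard_coe_finset]
  exact Finset.card_le_card (Finset.subset_biUnion_of_mem
    (fun k => Finset.univ.image (gridPoint a b k)) hk)

/-- The tensor grid refined in a single direction, to level `l + 1`, is already large enough. -/
theorem two_pow_le_numNodes {a b : ℝ} (hab : a < b) {d : ℕ} (hd : 1 ≤ d) (l : ℕ) :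
    2 ^ l ≤ numNodes d a b l := by
  set i₀ : Fin d := ⟨0, hd⟩
  set k : Fin d → ℕ := fun i => if i = i₀ then l + 1 else 1
  have hsum : ∑ i, k i = l + d := by
    have : ∀ i, k i = (if i = i₀ then l else 0) + 1 := by
      intro i
      simp only [k]
      split_ifs <;> simp
    simp only [this, Finset.sum_add_distrib]
    simp
  have hk : k ∈ smolyakIndices d l := by
    simp only [smolyakIndices, Finset.mem_filter, Fintype.mem_piFinset, Finset.mem_Icc, hsum]
    refine ⟨fun i => ?_, by omega⟩
    simp only [k]
    split_ifs <;> omega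
  refine le_trans ?_ (prod_growth_le_numNodes hab hk)
  calc 2 ^ l ≤ growth (k i₀) := by
        simp only [k, if_true, growth]
        split_ifs with h
        · have : l = 0 := by omega
          simp [this]
        · simp
    _ ≤ _ := Finset.single_le_prod' (f := fun i => growth (k i)) (fun i _ => growth_pos _)
        (Finset.mem_univ i₀)

theorem ccNode_mem_Icc {a b : ℝ} (hab : a < b) (m j : ℕ) : ccNode a b m j ∈ Set.Icc a b := by
  have h : |ccNodeStd m j| ≤ 1 := by
    unfold ccNodeStd
    split_ifs
    · simp
    · exact Real.abs_cos_le_one _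
  have h' := abs_le.1 h
  unfold ccNode
  constructor <;> nlinarith

theorem gridPoint_mem_cube {a b : ℝ} (hab : a < b) {d : ℕ} (k : Fin d → ℕ)
    (j : (i : Fin d) → Fin (growth (k i))) : gridPoint a b k j ∈ cube d a b :=
  fun _ => ccNode_mem_Icc hab _ _

/-- Stability of the Smolyak rule. -/
theorem abs_sparseRule_le {a b : ℝ} (hab : a < b) {d : ℕ} (hd : 1 ≤ d) (l : ℕ)
    {μ : Fin d → Measure ℝ} {W : ℝ} (hW : ∀ i m, 1 ≤ m → ∑ j, |ccWeight (μ i) a b m j| ≤ W)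
    {g : EuclideanSpace ℝ (Fin d) → ℝ} {ε : ℝ} (hg : ∀ x ∈ cube d a b, |g x| ≤ ε) :
    |sparseRule μ a b l g| ≤ (d * (l + d) ^ (d - 1) : ℕ) * (2 ^ (d - 1) * W ^ d * ε) := by
  have hmem : (WithLp.toLp 2 fun _ : Fin d => a) ∈ cube d a b := fun i => ⟨le_rfl, hab.le⟩
  have hε : 0 ≤ ε := (abs_nonneg _).trans (hg _ hmem)
  have hW0 : 0 ≤ W := (Finset.sum_nonneg fun _ _ => abs_nonneg _).trans (hW ⟨0, hd⟩ 1 le_rfl)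
  have hT : ∀ k, |tensorRule μ a b k g| ≤ W ^ d * ε := by
    intro k
    calc |tensorRule μ a b k g| ≤ ∑ j : (i : Fin d) → Fin (growth (k i)),
          (∏ i, |ccWeight (μ i) a b (growth (k i)) (j i)|) * ε := by
          refine (Finset.abs_sum_le_sum_abs _ _).trans (Finset.sum_le_sum fun j _ => ?_)
          rw [abs_mul, Finset.abs_prod]
          exact mul_le_mul_of_nonneg_left (hg _ (gridPoint_mem_cube hab k j))
            (Finset.prod_nonneg fun _ _ => abs_nonneg _)
      _ = (∏ i, ∑ j, |ccWeight (μ i) a b (growth (k i)) j|) * ε := by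
          rw [Finset.prod_univ_sum, Fintype.piFinset_univ, Finset.sum_mul]
      _ ≤ W ^ d * ε := by
          refine mul_le_mul_of_nonneg_right ?_ hε
          calc _ ≤ ∏ _i : Fin d, W := Finset.prod_le_prod
                (fun i _ => Finset.sum_nonneg fun _ _ => abs_nonneg _)
                fun i _ => hW i _ (growth_pos _)
            _ = W ^ d := by simp
  calc |sparseRule μ a b l g| ≤ ∑ _k ∈ smolyakIndices d l, 2 ^ (d - 1) * W ^ d * ε := by
        refine (Finset.abs_sum_le_sum_abs _ _).trans (Finset.sum_le_sum fun k _ => ?_)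
        rw [abs_mul, abs_mul, abs_pow, abs_neg, abs_one, one_pow, one_mul, Nat.abs_cast, mul_assoc]
        refine mul_le_mul ?_ (hT k) (abs_nonneg _) (by positivity)
        exact_mod_cast Nat.choose_le_two_pow _ _
    _ = (smolyakIndices d l).card * (2 ^ (d - 1) * W ^ d * ε) := by
        rw [Finset.sum_const, nsmul_eq_mul]
    _ ≤ _ := by
        refine mul_le_mul_of_nonneg_right ?_ (by positivity)
        exact_mod_cast card_smolyakIndices_le hd l

/-! ## The number of nodes for fixed level and growing dimension -/

section count

variable {d : ℕ}

open Classical in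
/-- The points all of whose coordinates lie in `Y` on some set of `s` coordinates, and equal `c`
elsewhere. -/
noncomputable def sparsePoints (d s : ℕ) (Y : Finset ℝ) (c : ℝ) : Finset (Fin d → ℝ) :=
  (Finset.powersetCard s Finset.univ).biUnion fun S : Finset (Fin d) =>
    Fintype.piFinset fun i => if i ∈ S then Y else {c}

theorem mem_sparsePoints {s : ℕ} {Y : Finset ℝ} {c : ℝ} {x : Fin d → ℝ} :
    x ∈ sparsePoints d s Y c ↔ ∃ S : Finset (Fin d), S.card = s ∧
      ∀ i, (i ∈ S → x i ∈ Y) ∧ (i ∉ S → x i = c) := by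
  classical
  simp only [sparsePoints, Finset.mem_biUnion, Finset.mem_powersetCard_univ, Fintype.mem_piFinset]
  refine exists_congr fun S => and_congr_right fun _ => forall_congr' fun i => ?_
  by_cases h : i ∈ S <;> simp [h]

theorem card_piFinset_ite (S : Finset (Fin d)) (Y : Finset ℝ) (c : ℝ) [DecidablePred (· ∈ S)] :
    (Fintype.piFinset fun i => if i ∈ S then Y else {c}).card = Y.card ^ S.card := by
  classical
  rw [Fintype.card_piFinset]
  have : ∀ i, (if i ∈ S then Y else {c}).card = if i ∈ S then Y.card else 1 := by
    intro i
    split_ifs <;> simp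
  simp only [this]
  rw [Finset.prod_ite, Finset.prod_const_one, mul_one, Finset.prod_const]
  simp

theorem card_sparsePoints_le (s : ℕ) (Y : Finset ℝ) (c : ℝ) :
    (sparsePoints d s Y c).card ≤ d.choose s * Y.card ^ s := by
  classical
  refine Finset.card_biUnion_le.trans ?_
  rw [Finset.sum_congr rfl fun S hS => (card_piFinset_ite S Y c).trans
    (by rw [(Finset.mem_powersetCard.1 hS).2])]
  simp

/-- When `c ∉ Y`, the set `S` is recovered from a point as the coordinates different from `c`, so
the union is disjoint. -/
theorem card_sparsePoints (s : ℕ) {Y : Finset ℝ} {c : ℝ} (hc : c ∉ Y) :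
    (sparsePoints d s Y c).card = d.choose s * Y.card ^ s := by
  classical
  rw [sparsePoints, Finset.card_biUnion]
  · rw [Finset.sum_congr rfl fun S hS => (card_piFinset_ite S Y c).trans
      (by rw [(Finset.mem_powersetCard.1 hS).2])]
    simp
  · intro S _ S' _ hne
    rw [Function.onFun, Finset.disjoint_left]
    intro x hx hx'
    apply hne
    rw [Fintype.mem_piFinset] at hx hx'
    have : ∀ (S : Finset (Fin d)), (∀ i, x i ∈ if i ∈ S then Y else {c}) →
        ∀ i, i ∈ S ↔ x i ≠ c := by
      intro S h i
      have hi := h i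
      by_cases hiS : i ∈ S
      · rw [if_pos hiS] at hi
        simp only [hiS, true_iff]
        rintro rfl
        exact hc hi
      · rw [if_neg hiS, Finset.mem_singleton] at hi
        simp [hiS, hi]
    ext i
    rw [this S hx, this S' hx']

end count

theorem ccNode_growth_one (a b : ℝ) (j : ℕ) : ccNode a b (growth 1) j = (a + b) / 2 := by
  simp [growth, ccNode, ccNodeStd]

theorem growth_two : growth 2 = 3 := by simp [growth]

theorem ccNode_growth_two_zero (a b : ℝ) : ccNode a b (growth 2) 0 = b := by
  simp [growth_two, ccNode, ccNodeStd]
  ring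

theorem ccNode_growth_two_one (a b : ℝ) : ccNode a b (growth 2) 1 = (a + b) / 2 := by
  have : (1 : ℕ) * Real.pi / (((3 : ℕ) : ℝ) - 1) = Real.pi / 2 := by
    push_cast
    norm_num
  rw [growth_two, ccNode, ccNodeStd, if_neg (by norm_num), this, Real.cos_pi_div_two]
  ring

theorem ccNode_growth_two_two (a b : ℝ) : ccNode a b (growth 2) 2 = a := by
  have : (2 : ℕ) * Real.pi / (((3 : ℕ) : ℝ) - 1) = Real.pi := by
    push_cast
    ring
  rw [growth_two, ccNode, ccNodeStd, if_neg (by norm_num), this, Real.cos_pi]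
  ring

/-- Raising exactly `l` coordinates to level 2, whose nodes include both endpoints, uses up the
whole budget `|k| = l + d`. -/
theorem choose_mul_two_pow_le_numNodes {a b : ℝ} (hab : a < b) {d : ℕ} (hd : 1 ≤ d) (l : ℕ) :
    d.choose l * 2 ^ l ≤ numNodes d a b l := by
  classical
  have hcard : ({a, b} : Finset ℝ).card = 2 := Finset.card_pair hab.ne
  have hc : (a + b) / 2 ∉ ({a, b} : Finset ℝ) := by
    simp only [Finset.mem_insert, Finset.mem_singleton, not_or]
    constructor <;> intro h <;> linarith
  have h1 := card_sparsePoints (d := d) l hc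
  rw [hcard] at h1
  rw [← h1, ← Set.ncard_coe_finset, numNodes,
    ← Set.ncard_image_of_injective (f := WithLp.toLp 2) _ (WithLp.toLp_injective 2)]
  refine Set.ncard_le_ncard ?_ (sparseGrid_finite d a b l)
  rintro _ ⟨x, hx, rfl⟩
  obtain ⟨S, hS, hx⟩ := mem_sparsePoints.1 (Finset.mem_coe.1 hx)
  set k : Fin d → ℕ := fun i => if i ∈ S then 2 else 1 with hk
  have hsum : ∑ i, k i = l + d := by
    have : ∀ i, k i = (if i ∈ S then 1 else 0) + 1 := by
      intro i
      simp only [hk]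
      split_ifs <;> rfl
    simp only [this, Finset.sum_add_distrib]
    simp [hS]
  have hex : ∀ i, ∃ j : Fin (growth (k i)), x i = ccNode a b (growth (k i)) j := by
    intro i
    by_cases hi : i ∈ S
    · have hki : k i = 2 := by simp [hk, hi]
      have h3 := (hx i).1 hi
      rw [hki]
      simp only [Finset.mem_insert, Finset.mem_singleton] at h3
      rcases h3 with h3 | h3
      · exact ⟨⟨2, by simp [growth]⟩, by rw [h3]; exact (ccNode_growth_two_two a b).symm⟩
      · exact ⟨⟨0, by simp [growth]⟩, by rw [h3]; exact (ccNode_growth_two_zero a b).symm⟩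
    · have hki : k i = 1 := by simp [hk, hi]
      rw [hki]
      exact ⟨⟨0, by simp [growth]⟩, by rw [(hx i).2 hi, ccNode_growth_one]⟩
  choose j hj using hex
  refine ⟨k, ?_, j, ?_⟩
  · simp only [smolyakIndices, Finset.mem_filter, Fintype.mem_piFinset, Finset.mem_Icc, hsum]
    refine ⟨fun i => ?_, by omega⟩
    simp only [hk]
    split_ifs with hi
    · have := Finset.card_pos.2 ⟨i, hi⟩
      omega
    · omega
  · rw [gridPoint]
    congr 1
    funext i
    exact hj i

open Classical in
/-- All the nodes of the univariate rules up to level `l + 1`. -/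
noncomputable def nodesUpTo (a b : ℝ) (l : ℕ) : Finset ℝ :=
  (Finset.Icc 1 (l + 1)).biUnion fun k =>
    Finset.univ.image fun j : Fin (growth k) => ccNode a b (growth k) j

/-- A coordinate off the midpoint costs at least one level, so at most `l` of them occur; if all `l`
occur, each has level exactly 2 and is an endpoint. The remainder has order `d^(l-1)`. The case `l =
0` is separated because truncated subtraction would add a spurious point. -/
theorem numNodes_le_choose {a b : ℝ} {d l : ℕ} (hld : l ≤ d) :
    numNodes d a b l ≤ d.choose l * 2 ^ l +
      if l = 0 then 0 else d ^ (l - 1) * (nodesUpTo a b l).card ^ (l - 1) := by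
  classical
  set c := (a + b) / 2 with hc
  set R : Finset (Fin d → ℝ) := if l = 0 then ∅ else sparsePoints d (l - 1) (nodesUpTo a b l) c
  have hsub : sparseGrid d a b l ⊆
      WithLp.toLp 2 '' ((sparsePoints d l {a, b} c ∪ R : Finset (Fin d → ℝ)) : Set (Fin d → ℝ)) := by
    rintro _ ⟨k, hk, j, rfl⟩
    refine ⟨fun i => ccNode a b (growth (k i)) (j i), ?_, rfl⟩
    simp only [smolyakIndices, Finset.mem_filter, Fintype.mem_piFinset, Finset.mem_Icc] at hk
    obtain ⟨hk1, -, hk2⟩ := hk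
    set x : Fin d → ℝ := fun i => ccNode a b (growth (k i)) (j i) with hx
    have hsum : ∑ i, (k i - 1) ≤ l := by
      have : ∑ i, (k i - 1) + d = ∑ i, k i := by
        have h : ∀ i, k i = (k i - 1) + 1 := fun i => by have := (hk1 i).1; omega
        conv_rhs => rw [Finset.sum_congr rfl fun i _ => h i, Finset.sum_add_distrib]
        simp
      omega
    set T : Finset (Fin d) := Finset.univ.filter fun i => x i ≠ c with hT
    have hTk : ∀ i ∈ T, 2 ≤ k i := by
      intro i hi
      rw [hT, Finset.mem_filter] at hi
      by_contra hlt
      have h1 : k i = 1 := by have := (hk1 i).1; omega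
      apply hi.2
      simp only [hx, h1, ccNode_growth_one, hc]
    have hTsum : ∑ i ∈ T, (k i - 1) ≤ l :=
      (Finset.sum_le_sum_of_subset (Finset.subset_univ T)).trans hsum
    have hTcard : T.card ≤ ∑ i ∈ T, (k i - 1) := by
      rw [Finset.card_eq_sum_ones]
      exact Finset.sum_le_sum fun i hi => by have := hTk i hi; omega
    rw [Finset.mem_coe, Finset.mem_union]
    rcases (hTcard.trans hTsum).eq_or_lt with hTl | hTl
    · left
      refine mem_sparsePoints.2 ⟨T, hTl, fun i => ⟨fun hi => ?_, fun hi => ?_⟩⟩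
      · have hki : k i = 2 := by
          by_contra hne
          have h3 : ∑ i ∈ T, 1 < ∑ i ∈ T, (k i - 1) :=
            Finset.sum_lt_sum (fun i hi => by have := hTk i hi; omega)
              ⟨i, hi, by have := hTk i hi; omega⟩
          rw [← Finset.card_eq_sum_ones] at h3
          omega
        rw [hT, Finset.mem_filter] at hi
        have hxi := hi.2
        have hji : (j i : ℕ) < 3 := by
          rw [← growth_two, ← hki]
          exact (j i).2
        simp only [hx, hki] at hxi ⊢
        simp only [Finset.mem_insert, Finset.mem_singleton]
        obtain h0 | h0 | h0 : (j i : ℕ) = 0 ∨ (j i : ℕ) = 1 ∨ (j i : ℕ) = 2 := by omega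
        · right; rw [h0, ccNode_growth_two_zero]
        · exfalso; rw [h0, ccNode_growth_two_one] at hxi; exact hxi rfl
        · left; rw [h0, ccNode_growth_two_two]
      · rw [hT, Finset.mem_filter] at hi
        simpa using hi
    · right
      have hl0 : l ≠ 0 := by omega
      simp only [R, if_neg hl0]
      -- Enlarging `T` to exactly `l - 1` coordinates is harmless, since `nodesUpTo` also contains
      -- the midpoint.
      obtain ⟨S, hTS, hS⟩ := Finset.exists_superset_card_eq (s := T) (n := l - 1) (by omega)
        (by rw [Fintype.card_fin]; omega)
      refine mem_sparsePoints.2 ⟨S, hS, fun i => ⟨fun _ => ?_, fun hi => ?_⟩⟩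
      · simp only [nodesUpTo, Finset.mem_biUnion, Finset.mem_image, Finset.mem_univ, true_and,
          Finset.mem_Icc]
        refine ⟨k i, ⟨(hk1 i).1, ?_⟩, j i, rfl⟩
        have := Finset.single_le_sum (f := fun i => k i - 1) (fun _ _ => Nat.zero_le _)
          (Finset.mem_univ i)
        omega
      · have : i ∉ T := fun h => hi (hTS h)
        rw [hT, Finset.mem_filter] at this
        simpa using this
  calc numNodes d a b l ≤ _ := Set.ncard_le_ncard hsub ((Finset.finite_toSet _).image _)
    _ = (sparsePoints d l {a, b} c ∪ R).card := by
      rw [Set.ncard_image_of_injective _ (WithLp.toLp_injective 2), Set.ncard_coe_finset]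
    _ ≤ (sparsePoints d l {a, b} c).card + R.card := Finset.card_union_le _ _
    _ ≤ _ := by
      refine add_le_add ((card_sparsePoints_le _ _ _).trans (Nat.mul_le_mul_left _
        (Nat.pow_le_pow_left Finset.card_le_two l))) ?_
      simp only [R]
      split_ifs
      · simp
      · exact (card_sparsePoints_le _ _ _).trans (Nat.mul_le_mul_right _ (Nat.choose_le_pow _ _))

/-- For a fixed level the number of nodes grows polynomially in the dimension. -/
theorem isEquivalent_numNodes {a b : ℝ} (hab : a < b) (l : ℕ) :
    Asymptotics.IsEquivalent Filter.atTop (fun d : ℕ => (numNodes d a b l : ℝ))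
      (fun d : ℕ => (2 : ℝ) ^ l / (l.factorial : ℝ) * (d : ℝ) ^ l) := by
  have h1 : Asymptotics.IsEquivalent Filter.atTop (fun d : ℕ => (2 : ℝ) ^ l * (d.choose l : ℝ))
      (fun d : ℕ => (2 : ℝ) ^ l / (l.factorial : ℝ) * (d : ℝ) ^ l) := by
    have h := (Asymptotics.IsEquivalent.refl (u := fun _ : ℕ => (2 : ℝ) ^ l)).mul
      (isEquivalent_choose l)
    refine h.congr_right (Filter.Eventually.of_forall fun d => ?_)
    simp only [Pi.mul_apply]
    ring
  set K : ℝ := ((nodesUpTo a b l).card : ℝ) ^ (l - 1)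
  have h2 : (fun d : ℕ => (numNodes d a b l : ℝ) - (2 : ℝ) ^ l * (d.choose l : ℝ)) =o[Filter.atTop]
      (fun d : ℕ => (2 : ℝ) ^ l / (l.factorial : ℝ) * (d : ℝ) ^ l) := by
    have h3 : (fun d : ℕ => (numNodes d a b l : ℝ) - (2 : ℝ) ^ l * (d.choose l : ℝ)) =O[Filter.atTop]
        (fun d : ℕ => (d : ℝ)⁻¹ * ((2 : ℝ) ^ l / (l.factorial : ℝ) * (d : ℝ) ^ l)) := by
      refine Asymptotics.IsBigO.of_bound (K * ((2 : ℝ) ^ l / (l.factorial : ℝ))⁻¹) ?_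
      filter_upwards [Filter.eventually_ge_atTop (max l 1)] with d hd
      have hld : l ≤ d := (le_max_left _ _).trans hd
      have hd1 : 1 ≤ d := (le_max_right _ _).trans hd
      have hd0 : (d : ℝ) ≠ 0 := by
        have : d ≠ 0 := by omega
        exact_mod_cast this
      have hlow : (2 : ℝ) ^ l * (d.choose l : ℝ) ≤ numNodes d a b l := by
        rw [mul_comm]
        exact_mod_cast choose_mul_two_pow_le_numNodes hab hd1 l
      have hup := numNodes_le_choose (a := a) (b := b) hld
      have hup' : (numNodes d a b l : ℝ) ≤ (2 : ℝ) ^ l * (d.choose l : ℝ) +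
          (d : ℝ)⁻¹ * (d : ℝ) ^ l * K := by
        have hle : (if l = 0 then 0 else (d : ℝ) ^ (l - 1) * K) ≤ (d : ℝ)⁻¹ * (d : ℝ) ^ l * K := by
          split_ifs with h0
          · positivity
          · refine le_of_eq ?_
            congr 1
            obtain ⟨e, rfl⟩ := Nat.exists_eq_succ_of_ne_zero h0
            rw [Nat.succ_sub_one, Nat.succ_eq_add_one, pow_succ]
            field_simp
        refine le_trans ?_ (add_le_add_right hle _)
        rw [mul_comm ((2 : ℝ) ^ l)]
        simp only [K]
        exact_mod_cast hup
      rw [Real.norm_eq_abs, abs_of_nonneg (by linarith), Real.norm_eq_abs,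
        abs_of_nonneg (by positivity)]
      have hne : (2 : ℝ) ^ l / (l.factorial : ℝ) ≠ 0 := by positivity
      calc _ ≤ (d : ℝ)⁻¹ * (d : ℝ) ^ l * K := by linarith
        _ = _ := by
          set z := (2 : ℝ) ^ l / (l.factorial : ℝ)
          field_simp
    refine h3.trans_isLittleO ?_
    have h4 : (fun d : ℕ => (d : ℝ)⁻¹) =o[Filter.atTop] (fun _ => (1 : ℝ)) :=
      (Asymptotics.isLittleO_one_iff ℝ).2 tendsto_inv_atTop_nhds_zero_nat
    simpa using h4.mul_isBigO (Asymptotics.isBigO_refl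
      (fun d : ℕ => (2 : ℝ) ^ l / (l.factorial : ℝ) * (d : ℝ) ^ l) Filter.atTop)
  have h5 := h1.add_isLittleO h2
  refine h5.congr_left (Filter.Eventually.of_forall fun d => ?_)
  simp

/-! ## Derivative bounds for compositions -/

theorem cube_eq_image (d : ℕ) (a b : ℝ) :
    cube d a b = WithLp.toLp 2 '' (Set.univ.pi fun _ : Fin d => Set.Icc a b) := by
  ext x
  constructor
  · intro hx
    exact ⟨fun i => x i, fun i _ => hx i, rfl⟩
  · rintro ⟨y, hy, rfl⟩ i
    exact hy i (Set.mem_univ i)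

theorem isCompact_cube (d : ℕ) (a b : ℝ) : IsCompact (cube d a b) := by
  rw [cube_eq_image]
  exact (isCompact_univ_pi fun _ => isCompact_Icc).image (PiLp.continuous_toLp 2 _)

theorem uniqueDiffOn_cube (d : ℕ) {a b : ℝ} (hab : a < b) : UniqueDiffOn ℝ (cube d a b) := by
  refine uniqueDiffOn_convex ?_ ?_
  · intro x hx y hy s t hs ht hst i
    exact convex_Icc a b (hx i) (hy i) hs ht hst
  · have hopen : IsOpen {x : EuclideanSpace ℝ (Fin d) | ∀ i, x i ∈ Set.Ioo a b} := by
      have : {x : EuclideanSpace ℝ (Fin d) | ∀ i, x i ∈ Set.Ioo a b} =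
          ⋂ i, (fun x : EuclideanSpace ℝ (Fin d) => x i) ⁻¹' Set.Ioo a b := by
        ext x
        simp
      rw [this]
      exact isOpen_iInter_of_finite fun i => isOpen_Ioo.preimage (by fun_prop)
    have hsub : {x : EuclideanSpace ℝ (Fin d) | ∀ i, x i ∈ Set.Ioo a b} ⊆ cube d a b :=
      fun x hx i => Set.Ioo_subset_Icc_self (hx i)
    refine ⟨WithLp.toLp 2 fun _ => (a + b) / 2, interior_maximal hsub hopen fun i => ?_⟩
    constructor
    · show a < (a + b) / 2
      linarith
    · show (a + b) / 2 < b
      linarith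

section ck

variable {d : ℕ} {F : Type*} [NormedAddCommGroup F] [NormedSpace ℝ F]

/-- Compactness of the cube. Without boundedness the real `sSup` in `ckNorm` would be the default
value 0 and bound nothing. -/
theorem bddAbove_partialDeriv {a b : ℝ} (hab : a < b) {k : ℕ} {g : EuclideanSpace ℝ (Fin d) → F}
    (hg : ContDiffOn ℝ k g (cube d a b)) :
    BddAbove {r : ℝ | ∃ n : ℕ, n ≤ k ∧ ∃ i : Fin n → Fin d, ∃ x ∈ cube d a b,
      r = ‖partialDeriv a b i g x‖} := by
  have h : ∀ n : ℕ, ∃ C : ℝ, 0 ≤ C ∧ (n ≤ k → ∀ x ∈ cube d a b,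
      ‖iteratedFDerivWithin ℝ n g (cube d a b) x‖ ≤ C) := by
    intro n
    by_cases hn : n ≤ k
    · obtain ⟨C, hC⟩ := (isCompact_cube d a b).exists_bound_of_continuousOn
        (hg.continuousOn_iteratedFDerivWithin (m := n) (by exact_mod_cast hn)
          (uniqueDiffOn_cube d hab))
      exact ⟨max C 0, le_max_right _ _, fun _ x hx => (hC x hx).trans (le_max_left _ _)⟩
    · exact ⟨0, le_rfl, fun h => absurd h hn⟩
  choose C hC0 hC using h
  refine ⟨∑ n ∈ Finset.range (k + 1), C n, ?_⟩
  rintro r ⟨n, hn, i, x, hx, rfl⟩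
  refine le_trans ?_ (Finset.single_le_sum (fun n _ => hC0 n) (Finset.mem_range.2 (Nat.lt_succ_of_le hn)))
  refine (ContinuousMultilinearMap.le_opNorm _ _).trans ?_
  simpa using hC n hn x hx

theorem norm_partialDeriv_le_ckNorm {a b : ℝ} (hab : a < b) {k : ℕ}
    {g : EuclideanSpace ℝ (Fin d) → F} (hg : ContDiffOn ℝ k g (cube d a b)) {n : ℕ} (hn : n ≤ k)
    (i : Fin n → Fin d) {x : EuclideanSpace ℝ (Fin d)} (hx : x ∈ cube d a b) :
    ‖partialDeriv a b i g x‖ ≤ ckNorm a b k g :=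
  le_csSup (bddAbove_partialDeriv hab hg) ⟨n, hn, i, x, hx, rfl⟩

theorem ckNorm_nonneg (a b : ℝ) (k : ℕ) (g : EuclideanSpace ℝ (Fin d) → F) :
    0 ≤ ckNorm a b k g := by
  refine Real.sSup_nonneg ?_
  rintro r ⟨n, _, i, x, _, rfl⟩
  exact norm_nonneg _

/-- Expanding every argument in the standard basis yields `d^n` partial derivatives. -/
theorem norm_iteratedFDerivWithin_le_ckNorm {a b : ℝ} (hab : a < b) {k : ℕ}
    {g : EuclideanSpace ℝ (Fin d) → F} (hg : ContDiffOn ℝ k g (cube d a b)) {n : ℕ} (hn : n ≤ k)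
    {x : EuclideanSpace ℝ (Fin d)} (hx : x ∈ cube d a b) :
    ‖iteratedFDerivWithin ℝ n g (cube d a b) x‖ ≤ (d : ℝ) ^ n * ckNorm a b k g := by
  have h0 := ckNorm_nonneg a b k g
  refine ContinuousMultilinearMap.opNorm_le_bound (by positivity) fun v => ?_
  have hv : v = fun j => ∑ i : Fin d, v j i • EuclideanSpace.single i (1 : ℝ) := by
    funext j
    ext i
    simp [Pi.single_apply]
  conv_lhs => rw [hv]
  rw [ContinuousMultilinearMap.map_sum]
  refine (norm_sum_le _ _).trans ?_
  calc _ ≤ ∑ _r : Fin n → Fin d, (∏ j, ‖v j‖) * ckNorm a b k g := by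
        refine Finset.sum_le_sum fun r _ => ?_
        rw [ContinuousMultilinearMap.map_smul_univ, norm_smul, norm_prod]
        refine mul_le_mul ?_ (norm_partialDeriv_le_ckNorm hab hg hn r hx) (norm_nonneg _)
          (Finset.prod_nonneg fun _ _ => norm_nonneg _)
        exact Finset.prod_le_prod (fun _ _ => norm_nonneg _) fun j _ => PiLp.norm_apply_le (v j) (r j)
    _ = _ := by
      rw [Finset.sum_const, Finset.card_univ, Fintype.card_fun, Fintype.card_fin, Fintype.card_fin,
        nsmul_eq_mul]
      push_cast
      ring

theorem norm_iteratedFDerivWithin_le_pow_ckNorm (hd : 1 ≤ d) {a b : ℝ} (hab : a < b) {k : ℕ}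
    {g : EuclideanSpace ℝ (Fin d) → F} (hg : ContDiffOn ℝ k g (cube d a b)) {n : ℕ} (hn : n ≤ k)
    {x : EuclideanSpace ℝ (Fin d)} (hx : x ∈ cube d a b) :
    ‖iteratedFDerivWithin ℝ n g (cube d a b) x‖ ≤ (d : ℝ) ^ k * ckNorm a b k g := by
  refine (norm_iteratedFDerivWithin_le_ckNorm hab hg hn hx).trans ?_
  refine mul_le_mul_of_nonneg_right ?_ (ckNorm_nonneg a b k g)
  exact pow_le_pow_right₀ (by exact_mod_cast hd) hn

end ck

/-- The point of the cube with angular coordinates `θ`. -/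
noncomputable def cosPoint {d : ℕ} (a b : ℝ) (θ : Fin d → ℝ) : EuclideanSpace ℝ (Fin d) :=
  WithLp.toLp 2 fun i => (a + b) / 2 + (b - a) / 2 * Real.cos (θ i)

theorem cosPoint_mem_cube {a b : ℝ} (hab : a < b) {d : ℕ} (θ : Fin d → ℝ) :
    cosPoint a b θ ∈ cube d a b := by
  intro i
  have h1 := Real.neg_one_le_cos (θ i)
  have h2 := Real.cos_le_one (θ i)
  show (a + b) / 2 + (b - a) / 2 * Real.cos (θ i) ∈ Set.Icc a b
  constructor <;> nlinarith

theorem cosPoint_update {d : ℕ} (a b : ℝ) (θ : Fin d → ℝ) (i : Fin d) (t : ℝ) :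
    cosPoint a b (Function.update θ i t) =
      WithLp.toLp 2 (Function.update (fun j => (a + b) / 2 + (b - a) / 2 * Real.cos (θ j)) i
        ((a + b) / 2)) + Real.cos t • EuclideanSpace.single i ((b - a) / 2) := by
  ext j
  by_cases hj : j = i
  · subst hj
    simp [cosPoint]
    ring
  · simp [cosPoint, hj]

theorem contDiff_cosPoint_update {d : ℕ} (a b : ℝ) (θ : Fin d → ℝ) (i : Fin d) (n : ℕ) :
    ContDiff ℝ n fun t => cosPoint a b (Function.update θ i t) := by
  simp only [cosPoint_update]
  exact contDiff_const.add (Real.contDiff_cos.smul contDiff_const)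

/-- The curve is affine in `cos t`, whose derivatives are bounded by 1. The bound is written as an
`n`-th power because the estimate for derivatives of compositions expects that form. -/
theorem norm_iteratedFDeriv_cosPoint_update_le {a b : ℝ} (hab : a < b) {d : ℕ} (θ : Fin d → ℝ)
    (i : Fin d) {n : ℕ} (hn : 1 ≤ n) (t : ℝ) :
    ‖iteratedFDeriv ℝ n (fun t => cosPoint a b (Function.update θ i t)) t‖ ≤
      (1 + (b - a) / 2) ^ n := by
  have hh : 0 < (b - a) / 2 := by linarith
  simp only [cosPoint_update]
  rw [norm_iteratedFDeriv_eq_norm_iteratedDeriv, iteratedDeriv_const_add hn,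
    ← norm_iteratedFDeriv_eq_norm_iteratedDeriv]
  have h1 := ((ContinuousLinearMap.toSpanSingleton ℝ
    (EuclideanSpace.single i ((b - a) / 2) : EuclideanSpace ℝ (Fin d)))).norm_iteratedFDeriv_comp_left
    (f := Real.cos) (x := t) (n := n) (Real.contDiff_cos (n := n)).contDiffAt le_rfl
  have h2 : ‖iteratedFDeriv ℝ n Real.cos t‖ ≤ 1 := by
    rw [norm_iteratedFDeriv_eq_norm_iteratedDeriv]
    exact Real.abs_iteratedDeriv_cos_le_one n t
  rw [ContinuousLinearMap.norm_toSpanSingleton, PiLp.norm_single, Real.norm_eq_abs,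
    abs_of_pos hh] at h1
  have h3 : (b - a) / 2 ≤ (1 + (b - a) / 2) ^ n := by
    have := one_add_mul_le_pow (a := (b - a) / 2) (by linarith) n
    have hn' : (1 : ℝ) ≤ n := by exact_mod_cast hn
    nlinarith
  calc _ ≤ (b - a) / 2 * ‖iteratedFDeriv ℝ n Real.cos t‖ := h1
    _ ≤ (b - a) / 2 * 1 := mul_le_mul_of_nonneg_left h2 hh.le
    _ ≤ _ := by linarith

/-- The one-dimensional restrictions of a composition, in angular coordinates. -/
theorem exists_norm_iteratedFDeriv_comp_le {a b : ℝ} (hab : a < b) {d : ℕ} (hd : 1 ≤ d) (k : ℕ) :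
    ∃ C : ℝ, 0 ≤ C ∧ ∀ (φ : EuclideanSpace ℝ (Fin d) → ℝ)
      (Φ : EuclideanSpace ℝ (Fin d) → EuclideanSpace ℝ (Fin d)),
      ContDiffOn ℝ k φ (cube d a b) → ContDiffOn ℝ k Φ (cube d a b) →
      Set.MapsTo Φ (cube d a b) (cube d a b) → ∀ (i : Fin d) (θ : Fin d → ℝ),
        (ContDiff ℝ k fun t => φ (Φ (cosPoint a b (Function.update θ i t)))) ∧
        ∀ t, ‖iteratedFDeriv ℝ k (fun t => φ (Φ (cosPoint a b (Function.update θ i t)))) t‖ ≤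
          C * (ckNorm a b k φ * (1 + ckNorm a b k Φ) ^ k) := by
  have hh : 0 < (b - a) / 2 := by linarith
  have hd' : (1 : ℝ) ≤ (d : ℝ) ^ k := one_le_pow₀ (by exact_mod_cast hd)
  refine ⟨k.factorial * (k.factorial * (d : ℝ) ^ k * ((d : ℝ) ^ k) ^ k) * (1 + (b - a) / 2) ^ k,
    by positivity, fun φ Φ hφ hΦ hmaps i θ => ?_⟩
  have hu := uniqueDiffOn_cube d hab
  set γ : ℝ → EuclideanSpace ℝ (Fin d) := fun t => cosPoint a b (Function.update θ i t) with hγ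
  have hγm : Set.MapsTo γ Set.univ (cube d a b) := fun t _ => cosPoint_mem_cube hab _
  have hγc : ContDiff ℝ k γ := contDiff_cosPoint_update a b θ i k
  have hcomp : ContDiffOn ℝ k (φ ∘ Φ) (cube d a b) := hφ.comp hΦ hmaps
  set A := ckNorm a b k φ
  set B := ckNorm a b k Φ
  have hA : 0 ≤ A := ckNorm_nonneg _ _ _ _
  have hB : 0 ≤ B := ckNorm_nonneg _ _ _ _
  -- The composition estimate needs the `j`-th derivative of `Φ` bounded by `D^j`. A base at least 1
  -- makes `D ≤ D^j` and `D^n ≤ D^k`; this is the reason for `1 + ‖Φ‖`.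
  have hD1 : 1 ≤ (d : ℝ) ^ k * (1 + B) := by nlinarith
  have h1 : ∀ x ∈ cube d a b, ∀ n ≤ k, ‖iteratedFDerivWithin ℝ n (φ ∘ Φ) (cube d a b) x‖ ≤
      k.factorial * ((d : ℝ) ^ k * A) * ((d : ℝ) ^ k * (1 + B)) ^ k := by
    intro x hx n hn
    have := norm_iteratedFDerivWithin_comp_le hφ hΦ (n := n) (by exact_mod_cast hn) hu hu hmaps hx
      (C := (d : ℝ) ^ k * A) (D := (d : ℝ) ^ k * (1 + B))
      (fun j hj => norm_iteratedFDerivWithin_le_pow_ckNorm hd hab hφ (hj.trans hn) (hmaps hx))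
      (fun j hj1 hj => by
        refine (norm_iteratedFDerivWithin_le_pow_ckNorm hd hab hΦ (hj.trans hn) hx).trans ?_
        refine le_trans ?_ (le_self_pow₀ hD1 (by omega))
        exact mul_le_mul_of_nonneg_left (by linarith) (by positivity))
    refine this.trans ?_
    have hf : (n.factorial : ℝ) ≤ k.factorial := by exact_mod_cast Nat.factorial_le hn
    have hp : ((d : ℝ) ^ k * (1 + B)) ^ n ≤ ((d : ℝ) ^ k * (1 + B)) ^ k := pow_le_pow_right₀ hD1 hn
    gcongr
  have hfun : (fun t => φ (Φ (cosPoint a b (Function.update θ i t)))) = (φ ∘ Φ) ∘ γ := rfl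
  refine ⟨?_, fun t => ?_⟩
  · rw [hfun, ← contDiffOn_univ]
    exact hcomp.comp hγc.contDiffOn hγm
  · have := norm_iteratedFDerivWithin_comp_le hcomp (hγc.contDiffOn (s := Set.univ)) (n := k) le_rfl
      hu uniqueDiffOn_univ hγm (Set.mem_univ t) (fun j hj => h1 _ (hγm (Set.mem_univ t)) j hj)
      (D := 1 + (b - a) / 2) (fun j hj1 hj => by
        rw [iteratedFDerivWithin_univ]
        exact norm_iteratedFDeriv_cosPoint_update_le hab θ i hj1 t)
    rw [iteratedFDerivWithin_univ] at this
    rw [hfun]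
    refine this.trans (le_of_eq ?_)
    rw [mul_pow]
    ring

/-! ## Integration against product densities -/

section density

variable {d : ℕ} {a b : ℝ} {f : Fin d → ℝ → ℝ}

theorem measurableSet_cube (d : ℕ) (a b : ℝ) : MeasurableSet (cube d a b) :=
  (isCompact_cube d a b).measurableSet

theorem quasiMeasurePreserving_coord (i : Fin d) :
    Measure.QuasiMeasurePreserving (fun x : EuclideanSpace ℝ (Fin d) => x i) volume volume :=
  (Measure.quasiMeasurePreserving_eval (fun _ : Fin d => (volume : Measure ℝ)) i).comp
    (PiLp.volume_preserving_ofLp (Fin d)).quasiMeasurePreserving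

theorem prod_indicator_coord (F : Fin d → ℝ → ℝ) (x : EuclideanSpace ℝ (Fin d)) :
    ∏ i, (Set.Icc a b).indicator (F i) (x i) =
      (cube d a b).indicator (fun x => ∏ i, F i (x i)) x := by
  by_cases hx : x ∈ cube d a b
  · rw [Set.indicator_of_mem hx]
    exact Finset.prod_congr rfl fun i _ => Set.indicator_of_mem (hx i) _
  · rw [Set.indicator_of_notMem hx]
    have : ∃ i, x i ∉ Set.Icc a b := by
      by_contra h
      push Not at h
      exact hx h
    obtain ⟨i, hi⟩ := this
    exact Finset.prod_eq_zero (Finset.mem_univ i) (Set.indicator_of_notMem hi _)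

theorem aemeasurable_prod_density
    (hf : ∀ i, AEMeasurable (f i) (volume.restrict (Set.Icc a b))) :
    AEMeasurable (fun x : EuclideanSpace ℝ (Fin d) => ∏ i, f i (x i))
      (volume.restrict (cube d a b)) := by
  rw [← aemeasurable_indicator_iff (measurableSet_cube d a b)]
  have h : AEMeasurable (fun x : EuclideanSpace ℝ (Fin d) =>
      ∏ i, (Set.Icc a b).indicator (f i) (x i)) volume :=
    Finset.aemeasurable_fun_prod _ fun i _ =>
      ((aemeasurable_indicator_iff measurableSet_Icc).2 (hf i)).comp_quasiMeasurePreserving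
        (quasiMeasurePreserving_coord i)
  simpa only [prod_indicator_coord] using h

/-- Fubini. The indicators of the intervals multiply to that of the cube, so both sides become
Lebesgue integrals over the full space, where the product formula applies. -/
theorem integral_prod_cubeDensityMeasure
    (hf : ∀ i, AEMeasurable (f i) (volume.restrict (Set.Icc a b)))
    (hf0 : ∀ i, ∀ x ∈ Set.Icc a b, 0 ≤ f i x) (F : Fin d → ℝ → ℝ) :
    ∫ x, ∏ i, F i (x i) ∂cubeDensityMeasure a b f =
      ∏ i, ∫ x, F i x ∂intervalDensityMeasure a b (f i) := by
  have h1 : ∀ i, ∫ x, F i x ∂intervalDensityMeasure a b (f i) =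
      ∫ x, (Set.Icc a b).indicator (fun x => f i x * F i x) x := by
    intro i
    rw [intervalDensityMeasure, integral_withDensity_eq_integral_toReal_smul₀
      (hf i).ennreal_ofReal (Filter.Eventually.of_forall fun x => ENNReal.ofReal_lt_top),
      integral_indicator measurableSet_Icc]
    refine setIntegral_congr_fun measurableSet_Icc fun x hx => ?_
    rw [ENNReal.toReal_ofReal (hf0 i x hx), smul_eq_mul]
  simp only [h1]
  rw [← integral_fintype_prod_volume_eq_prod, ← (PiLp.volume_preserving_ofLp (Fin d)).integral_comp
    (MeasurableEquiv.toLp 2 (Fin d → ℝ)).symm.measurableEmbedding, cubeDensityMeasure,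
    integral_withDensity_eq_integral_toReal_smul₀ (aemeasurable_prod_density hf).ennreal_ofReal
      (Filter.Eventually.of_forall fun x => ENNReal.ofReal_lt_top)]
  have h2 : ∀ x : EuclideanSpace ℝ (Fin d),
      ∏ i, (Set.Icc a b).indicator (fun x => f i x * F i x) (x.ofLp i) =
      (cube d a b).indicator (fun x => ∏ i, (f i (x i) * F i (x i))) x :=
    fun x => prod_indicator_coord (fun i x => f i x * F i x) x
  simp only [h2]
  rw [integral_indicator (measurableSet_cube d a b)]
  refine setIntegral_congr_fun (measurableSet_cube d a b) fun x hx => ?_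
  rw [ENNReal.toReal_ofReal (Finset.prod_nonneg fun i _ => hf0 i _ (hx i)), smul_eq_mul,
    Finset.prod_mul_distrib]

theorem isProbabilityMeasure_cubeDensityMeasure
    (hf : ∀ i, AEMeasurable (f i) (volume.restrict (Set.Icc a b)))
    (hf0 : ∀ i, ∀ x ∈ Set.Icc a b, 0 ≤ f i x)
    (hprob : ∀ i, IsProbabilityMeasure (intervalDensityMeasure a b (f i))) :
    IsProbabilityMeasure (cubeDensityMeasure a b f) := by
  have h := integral_prod_cubeDensityMeasure hf hf0 fun _ _ => 1
  simp only [Finset.prod_const_one, integral_const, probReal_univ, smul_eq_mul, mul_one] at h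
  refine ⟨?_⟩
  rwa [Measure.real, ENNReal.toReal_eq_one_iff] at h

theorem ae_mem_cube : ∀ᵐ x ∂cubeDensityMeasure a b f, x ∈ cube d a b :=
  (withDensity_absolutelyContinuous _ _).ae_le (ae_restrict_mem (measurableSet_cube d a b))

theorem integrable_of_continuousOn_cube [IsFiniteMeasure (cubeDensityMeasure a b f)]
    {g : EuclideanSpace ℝ (Fin d) → ℝ} (hg : ContinuousOn g (cube d a b)) :
    Integrable g (cubeDensityMeasure a b f) := by
  obtain ⟨C, hC⟩ := (isCompact_cube d a b).exists_bound_of_continuousOn hg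
  refine Integrable.of_bound ?_ C ?_
  · exact (hg.aestronglyMeasurable (measurableSet_cube d a b)).mono_ac
      (withDensity_absolutelyContinuous _ _)
  · filter_upwards [ae_mem_cube] with x hx using hC x hx

end density

/-! ### Linearity of the Smolyak rule and reduction of its error to approximation -/

theorem sparseRule_sub {d : ℕ} (μ : Fin d → Measure ℝ) (a b : ℝ) (l : ℕ)
    (g h : EuclideanSpace ℝ (Fin d) → ℝ) :
    sparseRule μ a b l (fun x => g x - h x) = sparseRule μ a b l g - sparseRule μ a b l h := by
  simp only [sparseRule, tensorRule, mul_sub, Finset.sum_sub_distrib]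

theorem sparseRule_sum_mul {d : ℕ} (μ : Fin d → Measure ℝ) (a b : ℝ) (l : ℕ) {ι : Type*}
    (s : Finset ι) (u : ι → ℝ) (g : ι → EuclideanSpace ℝ (Fin d) → ℝ) :
    sparseRule μ a b l (fun x => ∑ r ∈ s, u r * g r x) = ∑ r ∈ s, u r * sparseRule μ a b l (g r) := by
  have hT : ∀ k, tensorRule μ a b k (fun x => ∑ r ∈ s, u r * g r x) =
      ∑ r ∈ s, u r * tensorRule μ a b k (g r) := by
    intro k
    simp only [tensorRule, Finset.mul_sum]
    rw [Finset.sum_comm]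
    exact Finset.sum_congr rfl fun r _ => Finset.sum_congr rfl fun j _ => by ring
  simp only [sparseRule, hT, Finset.mul_sum]
  rw [Finset.sum_comm]
  exact Finset.sum_congr rfl fun r _ => Finset.sum_congr rfl fun j _ => by ring

/-- The error of the Smolyak rule is controlled by the distance to tensor product polynomials. -/
theorem abs_integral_sub_sparseRule_le {a b : ℝ} (hab : a < b) {d : ℕ} (hd : 1 ≤ d) (l : ℕ)
    {f : Fin d → ℝ → ℝ} (hf : ∀ i, AEMeasurable (f i) (volume.restrict (Set.Icc a b)))
    (hf0 : ∀ i, ∀ x ∈ Set.Icc a b, 0 ≤ f i x)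
    (hprob : ∀ i, IsProbabilityMeasure (intervalDensityMeasure a b (f i))) {W : ℝ}
    (hW : ∀ i m, 1 ≤ m → ∑ j, |ccWeight (intervalDensityMeasure a b (f i)) a b m j| ≤ W)
    {g : EuclideanSpace ℝ (Fin d) → ℝ} (hg : ContinuousOn g (cube d a b))
    {ι : Type} [Fintype ι] {p : ι → Fin d → Polynomial ℝ} {u : ι → ℝ}
    (hp : ∀ r i, (p r i).natDegree < growth (l / d + 1)) {ε : ℝ}
    (happ : ∀ x ∈ cube d a b, |g x - ∑ r, u r * ∏ i, (p r i).eval (x i)| ≤ ε) :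
    |∫ x, g x ∂cubeDensityMeasure a b f -
        sparseRule (fun i => intervalDensityMeasure a b (f i)) a b l g| ≤
      (1 + (d * (l + d) ^ (d - 1) : ℕ) * (2 ^ (d - 1) * W ^ d)) * ε := by
  have hν := isProbabilityMeasure_cubeDensityMeasure hf hf0 hprob
  set μ : Fin d → Measure ℝ := fun i => intervalDensityMeasure a b (f i)
  set ν := cubeDensityMeasure a b f
  set R : EuclideanSpace ℝ (Fin d) → ℝ := fun x => ∑ r, u r * ∏ i, (p r i).eval (x i)
  have hcoord : ∀ r i, Continuous fun x : EuclideanSpace ℝ (Fin d) => (p r i).eval (x i) :=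
    fun r i => (p r i).continuous.comp (by fun_prop)
  have hprodc : ∀ r, Continuous fun x : EuclideanSpace ℝ (Fin d) => ∏ i, (p r i).eval (x i) :=
    fun r => continuous_finsetProd _ fun i _ => hcoord r i
  have hRc : Continuous R := continuous_finsetSum _ fun r _ => (hprodc r).const_mul _
  have hR : ∫ x, R x ∂ν = sparseRule μ a b l R := by
    rw [sparseRule_sum_mul, integral_finsetSum _ fun r _ =>
      (integrable_of_continuousOn_cube (hprodc r).continuousOn).const_mul _]
    refine Finset.sum_congr rfl fun r _ => ?_
    rw [integral_const_mul, integral_prod_cubeDensityMeasure hf hf0 fun i x => (p r i).eval x,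
      sparseRule_prod_polynomial hab hd l μ
        (fun i P => integrable_eval_intervalDensityMeasure a b (f i) P) (p r) (hp r)]
  -- The rule is exact on `R`, so only the remainder `g - R` is integrated and sampled.
  have h1 : ∫ x, g x ∂ν - sparseRule μ a b l g =
      ∫ x, (g x - R x) ∂ν - sparseRule μ a b l fun x => g x - R x := by
    rw [sparseRule_sub, integral_sub (integrable_of_continuousOn_cube hg)
      (integrable_of_continuousOn_cube hRc.continuousOn), hR]
    ring
  have h2 : |∫ x, (g x - R x) ∂ν| ≤ ε := by
    have := norm_integral_le_of_norm_le_const (μ := ν) (f := fun x => g x - R x) (C := ε)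
      (by filter_upwards [ae_mem_cube] with x hx using happ x hx)
    simpa using this
  have h3 := abs_sparseRule_le hab hd l hW happ
  rw [h1]
  refine (abs_sub _ _).trans ((add_le_add h2 h3).trans (le_of_eq ?_))
  ring

/-! ## Convergence rate -/

/-- Passing from the level to the number of nodes. -/
theorem rate_le {d l m : ℕ} (k : ℕ) (hd : 1 ≤ d) {A : ℝ} (hA : 0 < A) (hl : 1 ≤ l)
    (hm1 : 2 ^ l ≤ m) (hm2 : (m : ℝ) ≤ A * (l : ℝ) ^ (d - 1) * 2 ^ l) :
    (l : ℝ) ^ (d - 1) * ((2 : ℝ) ^ l) ^ (-((k : ℝ) / d)) ≤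
      A ^ ((k : ℝ) / d) * 2 ^ (((d : ℝ) - 1) * ((k : ℝ) / d + 1)) *
        ((m : ℝ) ^ (-((k : ℝ) / d)) * Real.log m ^ (((d : ℝ) - 1) * ((k : ℝ) / d + 1))) := by
  set κ : ℝ := (k : ℝ) / d with hκ
  have hκ0 : 0 ≤ κ := by positivity
  set e : ℝ := ((d : ℝ) - 1) * (κ + 1) with he
  have hd' : (1 : ℝ) ≤ d := by exact_mod_cast hd
  have he0 : 0 ≤ e := mul_nonneg (by linarith) (by linarith)
  have hl' : (0 : ℝ) < l := by exact_mod_cast hl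
  have h2l : (0 : ℝ) < 2 ^ l := by positivity
  have hm1' : (2 : ℝ) ^ l ≤ m := by exact_mod_cast hm1
  have hm0 : (0 : ℝ) < m := h2l.trans_le hm1'
  -- From `2^l ≤ m` and `log 2 > 1/2`.
  have hlog : (l : ℝ) ≤ 2 * Real.log m := by
    have h1 := Real.log_le_log h2l hm1'
    rw [Real.log_pow] at h1
    have h2 := Real.log_two_gt_d9
    nlinarith
  have hP : (0 : ℝ) < A * (l : ℝ) ^ (d - 1) := by positivity
  have h1 : ((2 : ℝ) ^ l) ^ (-κ) ≤ (m : ℝ) ^ (-κ) * (A ^ κ * ((l : ℝ) ^ (d - 1)) ^ κ) := by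
    have h2 : (m : ℝ) / (A * (l : ℝ) ^ (d - 1)) ≤ 2 ^ l := by
      rw [div_le_iff₀ hP, mul_comm]
      exact hm2
    refine (Real.rpow_le_rpow_of_nonpos (by positivity) h2 (by linarith)).trans (le_of_eq ?_)
    rw [Real.div_rpow hm0.le hP.le, Real.rpow_neg hP.le, div_inv_eq_mul,
      Real.mul_rpow hA.le (by positivity)]
  -- One factor `l^(d-1)` comes from stability, its `κ`-th power from the node count; together they
  -- form the exponent of the logarithm.
  have h3 : (l : ℝ) ^ (d - 1) * ((l : ℝ) ^ (d - 1)) ^ κ = (l : ℝ) ^ e := by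
    rw [← Real.rpow_natCast, ← Real.rpow_mul hl'.le, ← Real.rpow_add hl', Nat.cast_sub hd,
      Nat.cast_one, he]
    congr 1
    ring
  have h4 : (l : ℝ) ^ e ≤ 2 ^ e * Real.log m ^ e := by
    rw [← Real.mul_rpow (by norm_num) (Real.log_natCast_nonneg m)]
    exact Real.rpow_le_rpow hl'.le hlog he0
  calc (l : ℝ) ^ (d - 1) * ((2 : ℝ) ^ l) ^ (-κ)
      ≤ (l : ℝ) ^ (d - 1) * ((m : ℝ) ^ (-κ) * (A ^ κ * ((l : ℝ) ^ (d - 1)) ^ κ)) :=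
        mul_le_mul_of_nonneg_left h1 (by positivity)
    _ = A ^ κ * (m : ℝ) ^ (-κ) * ((l : ℝ) ^ (d - 1) * ((l : ℝ) ^ (d - 1)) ^ κ) := by ring
    _ ≤ A ^ κ * (m : ℝ) ^ (-κ) * (2 ^ e * Real.log m ^ e) := by
        rw [h3]
        exact mul_le_mul_of_nonneg_left h4 (by positivity)
    _ = _ := by ring

/-- The constant is `656 = 82 · 4 · 2`: a factor 4 from the choice of degree `2^(l/d) / 4` and a
factor 2 from rounding `l/d` down. -/
theorem two_pow_div_le {d l : ℕ} (hd : 1 ≤ d) (k : ℕ) :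
    (82 / (((2 ^ (l / d) / 4 : ℕ) : ℝ) + 1)) ^ k ≤ 656 ^ k * ((2 : ℝ) ^ l) ^ (-((k : ℝ) / d)) := by
  have hd' : (0 : ℝ) < d := by exact_mod_cast hd
  set L := l / d with hL
  have h1 : (2 : ℝ) ^ L / 4 ≤ ((2 ^ L / 4 : ℕ) : ℝ) + 1 := by
    have h := Nat.lt_div_mul_add (a := 2 ^ L) (b := 4) (by norm_num)
    have h' : ((2 : ℝ) ^ L) < ((2 ^ L / 4 : ℕ) : ℝ) * 4 + 4 := by exact_mod_cast h
    linarith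
  have h2 : (2 : ℝ) ^ ((l : ℝ) / d) ≤ 2 * 2 ^ L := by
    have h : (l : ℝ) / d ≤ L + 1 := by
      rw [div_le_iff₀ hd']
      have := Nat.lt_mul_div_succ l (b := d) (by omega)
      rw [← hL] at this
      have h' : (l : ℝ) < d * (L + 1) := by exact_mod_cast this
      linarith
    calc (2 : ℝ) ^ ((l : ℝ) / d) ≤ 2 ^ ((L : ℝ) + 1) :=
          Real.rpow_le_rpow_of_exponent_le (by norm_num) h
      _ = 2 * 2 ^ L := by
          rw [Real.rpow_add (by norm_num), Real.rpow_natCast, Real.rpow_one, mul_comm]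
  have h3 : 82 / (((2 ^ L / 4 : ℕ) : ℝ) + 1) ≤ 656 * ((2 : ℝ) ^ ((l : ℝ) / d))⁻¹ := by
    have h2L : (0 : ℝ) < 2 ^ L := by positivity
    have hr : (0 : ℝ) < 2 ^ ((l : ℝ) / d) := by positivity
    calc 82 / (((2 ^ L / 4 : ℕ) : ℝ) + 1) ≤ 82 / ((2 : ℝ) ^ L / 4) := by gcongr
      _ = 656 * (2 * 2 ^ L)⁻¹ := by
          field_simp
          norm_num
      _ ≤ _ := by gcongr
  calc _ ≤ (656 * ((2 : ℝ) ^ ((l : ℝ) / d))⁻¹) ^ k := pow_le_pow_left₀ (by positivity) h3 k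
    _ = _ := by
      rw [mul_pow]
      congr 1
      rw [← Real.rpow_neg (by norm_num), ← Real.rpow_natCast, ← Real.rpow_natCast,
        ← Real.rpow_mul (by norm_num), ← Real.rpow_mul (by norm_num)]
      congr 1
      ring

/-- The sampling operator has degree `3n`, so dividing `2^L` by 4 keeps it within the exactness of
level `L + 1`. -/
theorem three_mul_lt_growth (L : ℕ) : 3 * (2 ^ L / 4) < growth (L + 1) := by
  unfold growth
  split_ifs with h
  · obtain rfl : L = 0 := by omega
    norm_num
  · rw [Nat.add_sub_cancel]
    omega

/-- The constants of the stability and cardinality estimates grow like `l ^ (d - 1)`. -/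
theorem cast_mul_add_pow_le {d l : ℕ} (hl : 1 ≤ l) :
    ((d * (l + d) ^ (d - 1) : ℕ) : ℝ) ≤ d * ((d : ℝ) + 1) ^ (d - 1) * (l : ℝ) ^ (d - 1) := by
  have hl' : (1 : ℝ) ≤ l := by exact_mod_cast hl
  have hd' : (0 : ℝ) ≤ d := d.cast_nonneg
  push_cast
  rw [mul_assoc, ← mul_pow]
  gcongr
  nlinarith

end SparseGrid

/-! ### The main theorem -/

theorem mainTheorem3 (a b : ℝ) (hab : a < b) :
    (∀ (d k : ℕ), 1 ≤ d → ∀ (p : ℝ≥0∞), 1 < p → ∀ (M : ℝ≥0),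
      ∃ c : ℝ, 0 < c ∧
        ∀ (f : Fin d → ℝ → ℝ),
          (∀ i, ∀ x ∈ Set.Icc a b, 0 ≤ f i x) →
          (∀ i, IsProbabilityMeasure (SparseGrid.intervalDensityMeasure a b (f i))) →
          (∀ i, MemLp (f i) p (volume.restrict (Set.Icc a b))) →
          (∀ i, eLpNorm (f i) p (volume.restrict (Set.Icc a b)) ≤ M) →
        ∀ (φ : EuclideanSpace ℝ (Fin d) → ℝ)
          (Φ : EuclideanSpace ℝ (Fin d) → EuclideanSpace ℝ (Fin d)),
          ContDiffOn ℝ k φ (SparseGrid.cube d a b) →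
          ContDiffOn ℝ k Φ (SparseGrid.cube d a b) →
          Set.MapsTo Φ (SparseGrid.cube d a b) (SparseGrid.cube d a b) →
        ∀ l : ℕ, 1 ≤ l →
          |∫ x, φ (Φ x) ∂(SparseGrid.cubeDensityMeasure a b f) -
              SparseGrid.sparseRule (fun i => SparseGrid.intervalDensityMeasure a b (f i)) a b l
                (fun x => φ (Φ x))| ≤
            c * (SparseGrid.numNodes d a b l : ℝ) ^ (-((k : ℝ) / d)) *
              Real.log (SparseGrid.numNodes d a b l) ^ (((d : ℝ) - 1) * ((k : ℝ) / d + 1)) *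
              SparseGrid.ckNorm a b k φ * (1 + SparseGrid.ckNorm a b k Φ) ^ k) ∧
    (∀ l : ℕ, Asymptotics.IsEquivalent Filter.atTop
      (fun d : ℕ => (SparseGrid.numNodes d a b l : ℝ))
      (fun d : ℕ => (2 : ℝ) ^ l / (l.factorial : ℝ) * (d : ℝ) ^ l)) := by
  refine ⟨fun d k hd p hp M => ?_, fun l => SparseGrid.isEquivalent_numNodes hab l⟩
  obtain ⟨C, hC0, hC⟩ := SparseGrid.exists_norm_iteratedFDeriv_comp_le hab hd k
  obtain ⟨W, hW1, hW⟩ := SparseGrid.exists_sum_abs_ccWeight_le hab hp M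
  set D : ℝ := d * ((d : ℝ) + 1) ^ (d - 1) with hD
  have hd0 : (0 : ℝ) < d := by exact_mod_cast hd
  have hD0 : 0 < D := by positivity
  -- `A₁` carries stability, `A₂` approximation and `A₃` the passage from level to node count.
  set A₁ : ℝ := 1 + D * (2 ^ (d - 1) * W ^ d) with hA₁
  set A₂ : ℝ := 2 ^ d * (3 * (C * 656 ^ k)) with hA₂
  set A₃ : ℝ := (D * 2 ^ d) ^ ((k : ℝ) / d) * 2 ^ (((d : ℝ) - 1) * ((k : ℝ) / d + 1)) with hA₃
  have hW0 : 0 ≤ W := by linarith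
  have hA₁0 : 0 ≤ A₁ := by positivity
  have hA₂0 : 0 ≤ A₂ := by positivity
  have hA₃0 : 0 ≤ A₃ := by positivity
  -- Adding 1 makes the constant strictly positive even if `C = 0`.
  refine ⟨A₁ * A₂ * A₃ + 1, by positivity, fun f hf0 hprob hf hfM φ Φ hφ hΦ hmaps l hl => ?_⟩
  set X : ℝ := SparseGrid.ckNorm a b k φ * (1 + SparseGrid.ckNorm a b k Φ) ^ k with hX
  have hX0 : 0 ≤ X := mul_nonneg (SparseGrid.ckNorm_nonneg _ _ _ _)
    (pow_nonneg (by linarith [SparseGrid.ckNorm_nonneg a b k Φ]) _)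
  have hl' : (1 : ℝ) ≤ l := by exact_mod_cast hl
  obtain ⟨ι, _, P, u, hP, happ⟩ := SparseGrid.exists_tensor_approx hab k (2 ^ (l / d) / 4)
    (g := fun x => φ (Φ x)) (G := fun θ => φ (Φ (SparseGrid.cosPoint a b θ))) (B := C * X)
    (fun θ => rfl) (fun i θ => (hC φ Φ hφ hΦ hmaps i θ).1) (fun i θ => (hC φ Φ hφ hΦ hmaps i θ).2)
  have h1 := SparseGrid.abs_integral_sub_sparseRule_le hab hd l (fun i => (hf i).1.aemeasurable)
    hf0 hprob (fun i m hm => hW (f i) (hprob i) (hf i) (hfM i) m hm)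
    (hφ.continuousOn.comp hΦ.continuousOn hmaps)
    (fun r i => (hP r i).trans_lt (SparseGrid.three_mul_lt_growth _)) happ
  have hfac : 1 + ((d * (l + d) ^ (d - 1) : ℕ) : ℝ) * (2 ^ (d - 1) * W ^ d) ≤
      A₁ * (l : ℝ) ^ (d - 1) := by
    have h2 : (1 : ℝ) ≤ (l : ℝ) ^ (d - 1) := one_le_pow₀ hl'
    have h3 : ((d * (l + d) ^ (d - 1) : ℕ) : ℝ) * (2 ^ (d - 1) * W ^ d) ≤
        D * (l : ℝ) ^ (d - 1) * (2 ^ (d - 1) * W ^ d) :=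
      mul_le_mul_of_nonneg_right (SparseGrid.cast_mul_add_pow_le hl) (by positivity)
    rw [hA₁, add_mul, one_mul]
    linarith
  have hε : (2 ^ d - 1) * (3 * (C * X * (82 / (((2 ^ (l / d) / 4 : ℕ) : ℝ) + 1)) ^ k)) ≤
      A₂ * X * ((2 : ℝ) ^ l) ^ (-((k : ℝ) / d)) := by
    have h2 := SparseGrid.two_pow_div_le (l := l) hd k
    have h3 : (2 : ℝ) ^ d - 1 ≤ 2 ^ d := by linarith
    calc _ ≤ 2 ^ d * (3 * (C * X * (656 ^ k * ((2 : ℝ) ^ l) ^ (-((k : ℝ) / d))))) := by gcongr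
      _ = _ := by rw [hA₂]; ring
  have hm2 : (SparseGrid.numNodes d a b l : ℝ) ≤ D * 2 ^ d * (l : ℝ) ^ (d - 1) * 2 ^ l := by
    have h2 := SparseGrid.numNodes_le hd a b l
    calc (SparseGrid.numNodes d a b l : ℝ) ≤ ((d * (l + d) ^ (d - 1) : ℕ) : ℝ) * 2 ^ (l + d) := by
          exact_mod_cast h2
      _ ≤ D * (l : ℝ) ^ (d - 1) * 2 ^ (l + d) :=
          mul_le_mul_of_nonneg_right (SparseGrid.cast_mul_add_pow_le hl) (by positivity)
      _ = _ := by rw [pow_add]; ring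
  have hrate := SparseGrid.rate_le k hd (by positivity : 0 < D * 2 ^ d) hl
    (SparseGrid.two_pow_le_numNodes hab hd l) hm2
  have hr0 : 0 ≤ (SparseGrid.numNodes d a b l : ℝ) ^ (-((k : ℝ) / d)) *
      Real.log (SparseGrid.numNodes d a b l) ^ (((d : ℝ) - 1) * ((k : ℝ) / d + 1)) :=
    mul_nonneg (by positivity) (Real.rpow_nonneg (Real.log_natCast_nonneg _) _)
  refine h1.trans ?_
  calc _ ≤ (A₁ * (l : ℝ) ^ (d - 1)) * (A₂ * X * ((2 : ℝ) ^ l) ^ (-((k : ℝ) / d))) := by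
        refine (mul_le_mul_of_nonneg_left hε (by positivity)).trans ?_
        exact mul_le_mul_of_nonneg_right hfac (by positivity)
    _ = A₁ * A₂ * X * ((l : ℝ) ^ (d - 1) * ((2 : ℝ) ^ l) ^ (-((k : ℝ) / d))) := by ring
    _ ≤ A₁ * A₂ * X * (A₃ * ((SparseGrid.numNodes d a b l : ℝ) ^ (-((k : ℝ) / d)) *
          Real.log (SparseGrid.numNodes d a b l) ^ (((d : ℝ) - 1) * ((k : ℝ) / d + 1)))) :=
        mul_le_mul_of_nonneg_left hrate (by positivity)
    _ = (A₁ * A₂ * A₃) * ((SparseGrid.numNodes d a b l : ℝ) ^ (-((k : ℝ) / d)) *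
          Real.log (SparseGrid.numNodes d a b l) ^ (((d : ℝ) - 1) * ((k : ℝ) / d + 1)) * X) := by
        ring
    _ ≤ (A₁ * A₂ * A₃ + 1) * ((SparseGrid.numNodes d a b l : ℝ) ^ (-((k : ℝ) / d)) *
          Real.log (SparseGrid.numNodes d a b l) ^ (((d : ℝ) - 1) * ((k : ℝ) / d + 1)) * X) :=
        mul_le_mul_of_nonneg_right (by linarith) (mul_nonneg hr0 hX0)
    _ = _ := by rw [hX]; ring
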